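/- **Conventions.** Let $\Sigma=\{1,\dots,\sigma\}$ and let $T=T[1,n]\in\Sigma^n$ be a text with $n\ge 2$ in which every character of $\Sigma$ occurs, and whose first character $T[1]=\$=1$ (the smallest one) occurs nowhere else in $T$. A string $w$ that occurs in $T$ (possibly empty) is *right-maximal* if it is a suffix of $T$ or if $wa$ and $wb$ both occur in $T$ for two distinct characters $a\neq b$; its *one-character right-extensions* are the strings $wc$, $c\in\Sigma$, that occur in $T$. A set $S\subseteq[n]=\{1,\dots,n\}$ is *suffixient* for $T$ if for every one-character right-extension $wc$ of every right-maximal $w$ there is an $x\in S$ such that $wc$ is a suffix of $T[1,x]$. Let $R=T[n]\cdots T[1]$ be the reversed text. $\mathrm{SA}_r$ is the permutation of $[n]$ that sorts the suffixes $R[p,n]$ lexicographically. $\mathrm{LCP}_r[1]=0$, and for $i\ge2$, $\mathrm{LCP}_r[i]$ is the length of the longest common prefix of the $(i-1)$-st and the $i$-th suffix in this order. $\mathrm{BWT}_r[i]=R[\mathrm{SA}_r[i]-1]$ if $\mathrm{SA}_r[i]>1$, and $\mathrm{BWT}_r[i]=R[n]=\$$ otherwise. $\mathrm{PSV}[i]$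 is the largest $j<i$ with $\mathrm{LCP}_r[j]<\mathrm{LCP}_r[i]$ ($0$ if there is none), and $\mathrm{NSV}[i]$ is the smallest $j>i$ with $\mathrm{LCP}_r[j]<\mathrm{LCP}_r[i]$ ($n+1$ if there is none). For $x\in[n]$, $bwt(x)$ is the position in $\mathrm{BWT}_r$ of the character $T[x]$, that is, $bwt(x)=\mathrm{SA}_r^{-1}[n-x+2]$ for $x\ge2$ and $bwt(1)=\mathrm{SA}_r^{-1}[1]$. **Algorithm.** Input: $T$, and the elements of $S\subseteq[n]$ in an arbitrary order. 1. Compute the arrays $\mathrm{BWT}_r,\mathrm{LCP}_r,\mathrm{SA}_r^{-1},\mathrm{PSV},\mathrm{NSV}$ by a suitable subroutine. 2. Compute the array $\mathrm{SLPR}$, writing $\max\arg\min\mathrm{LCP}_r[\{u,v\}]$ for the larger of those elements of $\{u,v\}$ at which $\mathrm{LCP}_r$ is minimal (similarly with $\arg\max$): set all entries of $\mathrm{SBPR}$, $\mathrm{SAPR}$ and $\mathrm{SLPR}$ to $1$. For $i=2,\dots,n$ let $\mathrm{SBPR}[i]\gets i$ if $\mathrm{BWT}_r[i-1]\ne\mathrm{BWT}_r[i]$,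 and $\mathrm{SBPR}[i]\gets\max\arg\min\mathrm{LCP}_r[\{\mathrm{SBPR}[i-1],i\}]$ otherwise. For $j=n-1,\dots,1$ let $\mathrm{SAPR}[j]\gets j+1$ if $\mathrm{BWT}_r[j]\ne\mathrm{BWT}_r[j+1]$, and $\mathrm{SAPR}[j]\gets\max\arg\min\mathrm{LCP}_r[\{j+1,\mathrm{SAPR}[j+1]\}]$ otherwise. For $i=1,\dots,n$ let $\mathrm{SLPR}[i]\gets\max\arg\max\mathrm{LCP}_r[\{\mathrm{SBPR}[i],\mathrm{SAPR}[i]\}]$. 3. Compute $\mathcal A=\{bwt(s)\mid s\in S\}$ and sort it (bucket sort) into an array $\mathcal B$. Start with empty linked lists $\mathcal C[c]$, $c\in\Sigma$; for $k=1,\dots,|\mathcal B|$ append $\mathrm{SLPR}[\mathcal B[k]]$ to $\mathcal C[\mathrm{BWT}_r[\mathcal B[k]]]$. Let $\mathcal P[c]\gets1$ (a pointer to the first entry of $\mathcal C[c]$) for all $c\in\Sigma$. 4. For $i=2,\dots,n$ with $\mathrm{BWT}_r[i-1]\neq\mathrm{BWT}_r[i]$, and for $i'=i-1$ and then $i'=i$: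 let $c\gets\mathrm{BWT}_r[i']$. If $\mathcal C[c]$ is empty, return false. While $\mathcal C[c][\mathcal P[c]]\le\mathrm{PSV}[i]$: if $\mathcal P[c]=|\mathcal C[c]|$, return false, else $\mathcal P[c]\gets\mathcal P[c]+1$. If $\mathrm{NSV}[i]\le\mathcal C[c][\mathcal P[c]]$, return false. 5. Return true. **Lemma.** There are a subroutine for step 1 and a constant $K$ such that, on a unit-cost word RAM (whose memory is initially zero apart from the input), for every such $T$ and every $S\subseteq[n]$, given in any order without repetitions: the subroutine computes the five arrays correctly within $Kn$ steps; the whole algorithm stops within $Kn$ steps; it uses at most $Kn$ words of memory, each holding a number below $n^K$ (that is, of $O(\log n)$ bits); and it returns true if and only if $S$ is suffixient for $T$. In short, the algorithm decides whether $S$ is suffixient for $T$ in $O(n)$ time and $O(n)$ words of space. -/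

import Mathlib

namespace SuffTest

/-! ## Strings, right-maximal substrings, suffixient sets

Strings are lists of natural numbers.  A text over the alphabet `{1, …, σ}` uses every character,
has length at least two, and starts with the end marker `$ = 1`, which occurs nowhere else. -/

/-- The texts over the effective alphabet `{1, …, σ}`, with `$ = 1` in first position only. -/
structure IsText (σ : ℕ) (T : List ℕ) : Prop where
  two_le : 2 ≤ T.length
  alphabet : ∀ c, c ∈ T ↔ 1 ≤ c ∧ c ≤ σ
  head : T.head? = some 1
  unique : T.count 1 = 1

/-- `w` occurs in `T`, and it is a suffix of `T` or is followed in `T` by two distinct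
characters. -/
def RightMaximal (T w : List ℕ) : Prop :=
  w <:+: T ∧ (w <:+ T ∨ ∃ a b : ℕ, a ≠ b ∧ w ++ [a] <:+: T ∧ w ++ [b] <:+: T)

/-- Every one-character right-extension `w ++ [c]` (occurring in `T`) of every right-maximal
string `w` is a suffix of the prefix `T[1, x]` for some `x ∈ S`. -/
def Suffixient (T : List ℕ) (S : Set ℕ) : Prop :=
  ∀ (w : List ℕ) (c : ℕ), RightMaximal T w → w ++ [c] <:+: T → ∃ x ∈ S, w ++ [c] <:+ T.take x

/-! ## Suffix array, LCP array, BWT, PSV and NSV (positions start at `1`) -/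

/-- The character in position `p`, for `1 ≤ p ≤ |T|`. -/
def charAt (T : List ℕ) (p : ℕ) : ℕ := T.getD (p - 1) 0

/-- The suffix `T[p, n]`. -/
def suffixAt (T : List ℕ) (p : ℕ) : List ℕ := T.drop (p - 1)

/-- The positions `1, …, n`, sorted by the lexicographic order of the suffixes starting there. -/
def saList (T : List ℕ) : List ℕ :=
  (List.range' 1 T.length).mergeSort (fun p q => decide (suffixAt T p ≤ suffixAt T q))

/-- The suffix array. -/
def SA (T : List ℕ) (i : ℕ) : ℕ := (saList T).getD (i - 1) 0

/-- The inverse of the suffix array. -/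
def ISA (T : List ℕ) (p : ℕ) : ℕ := (saList T).idxOf p + 1

/-- The length of the longest common prefix of two strings. -/
def lcp : List ℕ → List ℕ → ℕ
  | a :: u, b :: v => if a = b then lcp u v + 1 else 0
  | _, _ => 0

/-- The LCP array. -/
def LCP (T : List ℕ) (i : ℕ) : ℕ :=
  if 2 ≤ i ∧ i ≤ T.length then lcp (suffixAt T (SA T (i - 1))) (suffixAt T (SA T i)) else 0

/-- The Burrows-Wheeler transform: the character to the left of the `i`-th suffix, cyclically. -/
def BWT (T : List ℕ) (i : ℕ) : ℕ :=
  if SA T i = 1 then charAt T T.length else charAt T (SA T i - 1)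

/-- Previous smaller value in the array `A[1, n]`: the largest `j` with `1 ≤ j < i` and
`A[j] < A[i]`, and `0` if there is none. -/
def PSV (A : ℕ → ℕ) (i : ℕ) : ℕ :=
  ((Finset.Ico 1 i).filter (fun j => A j < A i)).sup id

/-- Next smaller value in the array `A[1, n]`: the smallest `j` with `i < j ≤ n` and
`A[j] < A[i]`, and `n + 1` if there is none. -/
def NSV (n : ℕ) (A : ℕ → ℕ) (i : ℕ) : ℕ :=
  (insert (n + 1) ((Finset.Ioc i n).filter (fun j => A j < A i))).min' (Finset.insert_nonempty _ _)

/-! ## The machine model: a unit-cost word RAM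

A program uses a fixed finite number of registers and arrays; each register and each array cell
holds one word.  Every arithmetic operation, comparison, memory access and branch costs one step.
Execution is relative to two bounds: an access to an array cell with index `≥ B` and the creation
of a number `≥ W` are faults, for which there is no run. -/

inductive BinOp where
  | add | sub | mul | div | mod | lt | le | eq | ne

/-- The value of an operation; a comparison gives `1` or `0`, subtraction stops at `0`. -/
def BinOp.eval : BinOp → ℕ → ℕ → ℕ
  | .add, a, b => a + b
  | .sub, a, b => a - b
  | .mul, a, b => a * b
  | .div, a, b => a / b
  | .mod, a, b => a % b
  | .lt, a, b => if a < b then 1 else 0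
  | .le, a, b => if a ≤ b then 1 else 0
  | .eq, a, b => if a = b then 1 else 0
  | .ne, a, b => if a = b then 0 else 1

inductive Expr where
  | const (k : ℕ)
  | reg (r : ℕ)
  | get (a : ℕ) (e : Expr)
  | bin (op : BinOp) (e₁ e₂ : Expr)

inductive Cmd where
  | skip
  /-- register `r` gets the value of `e` -/
  | set (r : ℕ) (e : Expr)
  /-- cell `e₁` of array `a` gets the value of `e₂` -/
  | put (a : ℕ) (e₁ e₂ : Expr)
  | seq (c₁ c₂ : Cmd)
  /-- a condition holds if its value is not `0` -/
  | ite (e : Expr) (c₁ c₂ : Cmd)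
  | loop (e : Expr) (c : Cmd)
  /-- end the whole program with the value of `e` as its result -/
  | ret (e : Expr)

/-- The contents of the registers and of the arrays. -/
structure State where
  reg : ℕ → ℕ
  arr : ℕ → ℕ → ℕ

def State.setReg (s : State) (r v : ℕ) : State :=
  { s with reg := Function.update s.reg r v }

def State.setArr (s : State) (a i v : ℕ) : State :=
  { s with arr := Function.update s.arr a (Function.update (s.arr a) i v) }

/-- The value of an expression; `none` is a fault. -/
def Expr.eval (B W : ℕ) (s : State) : Expr → Option ℕ
  | .const k => if k < W then some k else none
  | .reg r => some (s.reg r)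
  | .get a e => (e.eval B W s).bind fun i => if i < B then some (s.arr a i) else none
  | .bin op e₁ e₂ => (e₁.eval B W s).bind fun x => (e₂.eval B W s).bind fun y =>
      if op.eval x y < W then some (op.eval x y) else none

/-- The number of steps for evaluating an expression. -/
def Expr.cost : Expr → ℕ
  | .const _ => 1
  | .reg _ => 1
  | .get _ e => e.cost + 1
  | .bin _ e₁ e₂ => e₁.cost + e₂.cost + 1

/-- A command falls through to the next one with a new state, or ends the program. -/
inductive Outcome where
  | next (s : State)
  | ret (v : ℕ)

/-- `Exec B W c s o t`: without a fault, `c` started in state `s` has outcome `o` after exactly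
`t` steps. -/
inductive Exec (B W : ℕ) : Cmd → State → Outcome → ℕ → Prop where
  | skip (s : State) : Exec B W .skip s (.next s) 1
  | set {s : State} {r : ℕ} {e : Expr} {v : ℕ} (h : e.eval B W s = some v) :
      Exec B W (.set r e) s (.next (s.setReg r v)) (e.cost + 1)
  | put {s : State} {a : ℕ} {e₁ e₂ : Expr} {i v : ℕ} (h₁ : e₁.eval B W s = some i)
      (h₂ : e₂.eval B W s = some v) (hi : i < B) :
      Exec B W (.put a e₁ e₂) s (.next (s.setArr a i v)) (e₁.cost + e₂.cost + 1)
  | seq_next {c₁ c₂ : Cmd} {s s₁ : State} {o : Outcome} {t₁ t₂ : ℕ}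
      (h₁ : Exec B W c₁ s (.next s₁) t₁) (h₂ : Exec B W c₂ s₁ o t₂) :
      Exec B W (.seq c₁ c₂) s o (t₁ + t₂)
  | seq_ret {c₁ c₂ : Cmd} {s : State} {v t : ℕ} (h : Exec B W c₁ s (.ret v) t) :
      Exec B W (.seq c₁ c₂) s (.ret v) t
  | ite_true {e : Expr} {c₁ c₂ : Cmd} {s : State} {o : Outcome} {v t : ℕ}
      (h : e.eval B W s = some v) (hv : v ≠ 0) (h₁ : Exec B W c₁ s o t) :
      Exec B W (.ite e c₁ c₂) s o (e.cost + 1 + t)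
  | ite_false {e : Expr} {c₁ c₂ : Cmd} {s : State} {o : Outcome} {t : ℕ}
      (h : e.eval B W s = some 0) (h₂ : Exec B W c₂ s o t) :
      Exec B W (.ite e c₁ c₂) s o (e.cost + 1 + t)
  | loop_done {e : Expr} {c : Cmd} {s : State} (h : e.eval B W s = some 0) :
      Exec B W (.loop e c) s (.next s) (e.cost + 1)
  | loop_next {e : Expr} {c : Cmd} {s s₁ : State} {o : Outcome} {v t₁ t₂ : ℕ}
      (h : e.eval B W s = some v) (hv : v ≠ 0) (h₁ : Exec B W c s (.next s₁) t₁)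
      (h₂ : Exec B W (.loop e c) s₁ o t₂) :
      Exec B W (.loop e c) s o (e.cost + 1 + t₁ + t₂)
  | loop_ret {e : Expr} {c : Cmd} {s : State} {v w t : ℕ}
      (h : e.eval B W s = some v) (hv : v ≠ 0) (h₁ : Exec B W c s (.ret w) t) :
      Exec B W (.loop e c) s (.ret w) (e.cost + 1 + t)
  | ret {e : Expr} {s : State} {v : ℕ} (h : e.eval B W s = some v) :
      Exec B W (.ret e) s (.ret v) (e.cost + 1)

/-- The registers that occur in an expression. -/
def Expr.regs : Expr → Finset ℕ
  | .const _ => ∅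
  | .reg r => {r}
  | .get _ e => e.regs
  | .bin _ e₁ e₂ => e₁.regs ∪ e₂.regs

/-- The arrays that occur in an expression. -/
def Expr.arrs : Expr → Finset ℕ
  | .const _ => ∅
  | .reg _ => ∅
  | .get a e => insert a e.arrs
  | .bin _ e₁ e₂ => e₁.arrs ∪ e₂.arrs

/-- The registers that occur in a program. -/
def Cmd.regs : Cmd → Finset ℕ
  | .skip => ∅
  | .set r e => insert r e.regs
  | .put _ e₁ e₂ => e₁.regs ∪ e₂.regs
  | .seq c₁ c₂ => c₁.regs ∪ c₂.regs
  | .ite e c₁ c₂ => e.regs ∪ c₁.regs ∪ c₂.regs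
  | .loop e c => e.regs ∪ c.regs
  | .ret e => e.regs

/-- The arrays that occur in a program. -/
def Cmd.arrs : Cmd → Finset ℕ
  | .skip => ∅
  | .set _ e => e.arrs
  | .put a e₁ e₂ => insert a (e₁.arrs ∪ e₂.arrs)
  | .seq c₁ c₂ => c₁.arrs ∪ c₂.arrs
  | .ite e c₁ c₂ => e.arrs ∪ c₁.arrs ∪ c₂.arrs
  | .loop e c => e.arrs ∪ c.arrs
  | .ret e => e.arrs

/-- The number of words occupied by a program (input included) whose arrays have length `B`. -/
def Cmd.words (c : Cmd) (B : ℕ) : ℕ := c.regs.card + c.arrs.card * B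

/-! ## Abbreviations for writing programs -/

instance (k : ℕ) : OfNat Expr k := ⟨.const k⟩
instance : Add Expr := ⟨.bin .add⟩
instance : Sub Expr := ⟨.bin .sub⟩
instance : Mod Expr := ⟨.bin .mod⟩

abbrev v (r : ℕ) : Expr := .reg r
abbrev get (a : ℕ) (e : Expr) : Expr := .get a e
abbrev lt (e₁ e₂ : Expr) : Expr := .bin .lt e₁ e₂
abbrev le (e₁ e₂ : Expr) : Expr := .bin .le e₁ e₂
abbrev eq (e₁ e₂ : Expr) : Expr := .bin .eq e₁ e₂
abbrev ne (e₁ e₂ : Expr) : Expr := .bin .ne e₁ e₂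

/-- The commands of a list, one after the other. -/
def block : List Cmd → Cmd
  | [] => .skip
  | [c] => c
  | c :: d :: l => .seq c (block (d :: l))

/-- `if e then c` -/
def when (e : Expr) (c : Cmd) : Cmd := .ite e c .skip

/-- `for r = lo, …, hi do c` -/
def forUp (r : ℕ) (lo hi : Expr) (c : Cmd) : Cmd :=
  block [.set r lo, .loop (le (v r) hi) (block [c, .set r (v r + 1)])]

/-- `for r = hi, …, lo do c`, where `lo ≥ 1` -/
def forDown (r : ℕ) (hi lo : Expr) (c : Cmd) : Cmd :=
  block [.set r hi, .loop (le lo (v r)) (block [c, .set r (v r - 1)])]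

/-! Registers: the input `n = |T|`, `σ`, `m = |S|`, and the variables of the program. -/

abbrev rN : ℕ := 0
abbrev rSigma : ℕ := 1
abbrev rM : ℕ := 2
abbrev rI : ℕ := 3
abbrev rJ : ℕ := 4
abbrev rK : ℕ := 5
abbrev rC : ℕ := 6
abbrev rB : ℕ := 7

/-! Arrays: the input `T[1, n]` and `S[1, m]`, and the arrays of the program. -/

abbrev aT : ℕ := 0
abbrev aS : ℕ := 1
abbrev aBWT : ℕ := 2
abbrev aLCP : ℕ := 3
abbrev aISA : ℕ := 4
abbrev aPSV : ℕ := 5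
abbrev aNSV : ℕ := 6
abbrev aSAPR : ℕ := 7
abbrev aSBPR : ℕ := 8
abbrev aSLPR : ℕ := 9
abbrev aA : ℕ := 10
abbrev aMark : ℕ := 11
abbrev aB : ℕ := 12
abbrev aVal : ℕ := 13
abbrev aNext : ℕ := 14
abbrev aHead : ℕ := 15
abbrev aTail : ℕ := 16
abbrev aP : ℕ := 17

/-- The input convention: `n`, `σ`, `m` in registers, `T` and the elements of `S` in arrays, in
cells `1, 2, …`; everything else is `0`. -/
def initState (σ : ℕ) (T S : List ℕ) : State where
  reg r := if r = rN then T.length else if r = rSigma then σ else if r = rM then S.length else 0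
  arr a i := if i = 0 then 0 else if a = aT then T.getD (i - 1) 0 else
    if a = aS then S.getD (i - 1) 0 else 0

/-- The input is unchanged, and the arrays `BWT_r`, `LCP_r`, `SA_r⁻¹`, `PSV(LCP_r)`,
`NSV(LCP_r)` of the reversed text are in cells `1, …, n` of the corresponding arrays. -/
def ArraysReady (σ : ℕ) (T S : List ℕ) (s : State) : Prop :=
  (∀ r ∈ [rN, rSigma, rM], s.reg r = (initState σ T S).reg r) ∧
  (∀ a ∈ [aT, aS], s.arr a = (initState σ T S).arr a) ∧
  ∀ i ∈ Finset.Icc 1 T.length,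
    s.arr aBWT i = BWT T.reverse i ∧
    s.arr aLCP i = LCP T.reverse i ∧
    s.arr aISA i = ISA T.reverse i ∧
    s.arr aPSV i = PSV (LCP T.reverse) i ∧
    s.arr aNSV i = NSV T.length (LCP T.reverse) i

/-! ## The algorithm -/

/-- Cell `dst` of array `a` gets `max argmin LCP[{x, y}]`. -/
def putMaxArgmin (a : ℕ) (dst x y : Expr) : Cmd :=
  .ite (lt (get aLCP x) (get aLCP y)) (.put a dst x) <|
  .ite (lt (get aLCP y) (get aLCP x)) (.put a dst y) <|
  .ite (lt x y) (.put a dst y) (.put a dst x)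

/-- Cell `dst` of array `a` gets `max argmax LCP[{x, y}]`. -/
def putMaxArgmax (a : ℕ) (dst x y : Expr) : Cmd :=
  .ite (lt (get aLCP y) (get aLCP x)) (.put a dst x) <|
  .ite (lt (get aLCP x) (get aLCP y)) (.put a dst y) <|
  .ite (lt x y) (.put a dst y) (.put a dst x)

/-- Computing the array `SLPR` from `LCP_r` and `BWT_r`. -/
def computeSLPR : Cmd := block [
  forUp rI 1 (v rN) (block [
    .put aSAPR (v rI) 1,
    .put aSBPR (v rI) 1,
    .put aSLPR (v rI) 1]),
  forUp rI 2 (v rN) (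
    .ite (ne (get aBWT (v rI - 1)) (get aBWT (v rI)))
      (.put aSBPR (v rI) (v rI))
      (putMaxArgmin aSBPR (v rI) (get aSBPR (v rI - 1)) (v rI))),
  forDown rJ (v rN - 1) 1 (
    .ite (ne (get aBWT (v rJ)) (get aBWT (v rJ + 1)))
      (.put aSAPR (v rJ) (v rJ + 1))
      (putMaxArgmin aSAPR (v rJ) (v rJ + 1) (get aSAPR (v rJ + 1)))),
  forUp rI 1 (v rN) (
    putMaxArgmax aSLPR (v rI) (get aSBPR (v rI)) (get aSAPR (v rI)))]

/-- `A ← {bwt(s) | s ∈ S}`.  Here `bwt(s)`, the position in `BWT_r` of the character `T[s]`, is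
`SA_r⁻¹[n - s + 2]` for `s ≥ 2`, and `SA_r⁻¹[1]` for `s = 1`. -/
def computeA : Cmd :=
  forUp rK 1 (v rM) (
    .put aA (v rK) (get aISA ((v rN + 1 - get aS (v rK)) % v rN + 1)))

/-- `B[1, |A|] ← sort(A)`, by a bucket sort; register `rB` gets `|A|`. -/
def sortA : Cmd := block [
  forUp rI 1 (v rN) (.put aMark (v rI) 0),
  forUp rK 1 (v rM) (.put aMark (get aA (v rK)) 1),
  .set rB 0,
  forUp rI 1 (v rN) (
    when (eq (get aMark (v rI)) 1) (block [
      .set rB (v rB + 1),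
      .put aB (v rB) (v rI)]))]

/-- `C[BWT_r[B[k]]].append(SLPR[B[k]])` for `k = 1, …, |B|`, and `P[c] ← 1` for all `c`.
The lists `C[c]` are singly linked: the entry appended in round `k` is node `k`, with its value in
`aVal` and its successor in `aNext`, and `0` is the null pointer.  `P[c]` is stored as the node at
which it points, and hence starts as the head of `C[c]`. -/
def buildLists : Cmd := block [
  forUp rC 1 (v rSigma) (block [
    .put aHead (v rC) 0,
    .put aTail (v rC) 0]),
  forUp rK 1 (v rB) (block [
    .set rC (get aBWT (get aB (v rK))),
    .put aVal (v rK) (get aSLPR (get aB (v rK))),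
    .put aNext (v rK) 0,
    .ite (eq (get aTail (v rC)) 0)
      (.put aHead (v rC) (v rK))
      (.put aNext (get aTail (v rC)) (v rK)),
    .put aTail (v rC) (v rK)]),
  forUp rC 1 (v rSigma) (.put aP (v rC) (get aHead (v rC)))]

/-- The scan of the run breaks. -/
def scan : Cmd := block [
  forUp rI 2 (v rN) (
    when (ne (get aBWT (v rI - 1)) (get aBWT (v rI))) (
      forUp rJ (v rI - 1) (v rI) (block [
        .set rC (get aBWT (v rJ)),
        when (eq (get aHead (v rC)) 0) (.ret 0),
        .loop (le (get aVal (get aP (v rC))) (get aPSV (v rI))) (block [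
          when (eq (get aNext (get aP (v rC))) 0) (.ret 0),
          .put aP (v rC) (get aNext (get aP (v rC)))]),
        when (le (get aNSV (v rI)) (get aVal (get aP (v rC)))) (.ret 0)]))),
  .ret 1]

/-- The whole algorithm, with a subroutine for the arrays `BWT_r`, `LCP_r`, `SA_r⁻¹`, `PSV`,
`NSV`.  It returns `1` for true and `0` for false. -/
def testSuffixient (computeArrays : Cmd) : Cmd :=
  block [computeArrays, computeSLPR, computeA, sortA, buildLists, scan]

end SuffTest

/-!
The algorithm is analysed in a program logic: `Run B W c s t Q R` says that the command `c`, started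
in the state `s` at time `t`, runs without a fault into `Q` or returns into `R`. Since `Q` and `R`
see the time, loop invariants carry potentials (`Run.loop`, `Run.up`), and correctness, running time
and the bound on the size of words come out of the same induction.

*The arrays.* Everything rests on sorting the suffixes of the reversed text in linear time. The
suffixes at the positions not divisible by `3` are ordered like the suffixes of a text of about two
thirds of the length, whose characters are names for triples (`suf_childTxt_lt_iff`). Given the order
of these sample suffixes, two suffixes whose positions `i`, `j` satisfy `3 ∤ i + δ` and `3 ∤ j + δ`
are compared by a name for the first `δ` characters and a sample rank. Each of the shifts
`δ = 0, 1, 2` handles two of the three residue classes, so three rankings of pairs count, for each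
suffix, the smaller ones in its own class twice and the others once; one more ranking, inside the
classes, removes the excess (`rank_of_passes`). All rankings are bucket sorts of pairs
(`run_pairRank`). The texts of the recursion lie one behind the other in memory, and their total
length is bounded by a geometric sum (`levOff_add_le`). The LCP array is computed by Kasai's method,
where the common prefix with the predecessor loses at most one character from one suffix of the text
to the next (`IsRank.agree_pred`). Previous smaller values are found by following the previous
smaller values of the predecessor, with the length of this chain (`chainLen`) as a potential; next
smaller values are those of the mirrored array (`NSV_eq_PSV`).

*Suffixient sets.* Rows `i - 1` and `i` with different characters of the Burrows-Wheeler transform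
are called a break. The rows that share the `LCP[i]` characters common to both rows of a break are
those in the interval `[PSV[i], NSV[i])` (`mem_box_iff_agree`), and a set is suffixient if and only if
for each break and each of its two characters, it has an element with this character whose row is in
the interval (`suffixient_iff`). Indeed the shared characters spell a right-maximal string backwards,
and between two rows with different characters there is a break with at least their common context
(`exists_break`). Since `SLPR[k]` is the position of the larger one of the minima of the LCP array
from `k` to the breaks on its two sides, a row `k` lies in the interval if and only if `SLPR[k]` lies
in the open interval `(PSV[i], NSV[i])` (`IsSLPR.mem_box_iff`).

*The scan.* `SLPR` is monotone (`IsSLPR.sl_mono`), so each list is sorted. A pointer passes a node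
only if the node is at most `PSV[i]`. Should a later break `i'` need such a node, its interval contains
that of `i`, by nestedness, so the node that served `i` serves `i'` as well (`Hit.of_nested`).
Hence the pointers need not return, and the number of nodes in front of them (`nodesLeft`) is a
potential that makes the scan linear.
-/


namespace SuffTest
set_option linter.unusedSimpArgs false

/-! ### A program logic for the word RAM -/

@[simp] theorem Expr.add_def (e₁ e₂ : Expr) : e₁ + e₂ = .bin .add e₁ e₂ := rfl
@[simp] theorem Expr.sub_def (e₁ e₂ : Expr) : e₁ - e₂ = .bin .sub e₁ e₂ := rfl
@[simp] theorem Expr.mod_def (e₁ e₂ : Expr) : e₁ % e₂ = .bin .mod e₁ e₂ := rfl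

@[simp] theorem State.setReg_reg (s : State) (r x r' : ℕ) :
    (s.setReg r x).reg r' = if r' = r then x else s.reg r' := by
  simp [State.setReg, Function.update_apply]

@[simp] theorem State.setReg_arr (s : State) (r x : ℕ) : (s.setReg r x).arr = s.arr := rfl

@[simp] theorem State.setArr_reg (s : State) (a i x : ℕ) : (s.setArr a i x).reg = s.reg := rfl

@[simp] theorem State.setArr_arr (s : State) (a i x a' : ℕ) :
    (s.setArr a i x).arr a' = if a' = a then Function.update (s.arr a) i x else s.arr a' := by
  by_cases h : a' = a
  · subst h; simp [State.setArr]
  · simp [State.setArr, h]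

/-- The value of an expression, with the bounds of the machine ignored. -/
@[simp] def Expr.val (s : State) : Expr → ℕ
  | .const k => k
  | .reg r => s.reg r
  | .get a e => s.arr a (e.val s)
  | .bin op e₁ e₂ => op.eval (e₁.val s) (e₂.val s)

/-- The results of an operation are words. Comparisons need no condition, as `1` is a word. -/
@[simp] def BinOp.Ok (W : ℕ) : BinOp → ℕ → ℕ → Prop
  | .add, a, b => a + b < W
  | .sub, a, b => a - b < W
  | .mul, a, b => a * b < W
  | .div, a, b => a / b < W
  | .mod, a, b => a % b < W
  | .lt, _, _ => True
  | .le, _, _ => True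
  | .eq, _, _ => True
  | .ne, _, _ => True

/-- The evaluation of the expression does not fault. -/
@[simp] def Expr.Safe (B W : ℕ) (s : State) : Expr → Prop
  | .const k => k < W
  | .reg _ => True
  | .get _ e => e.Safe B W s ∧ e.val s < B
  | .bin op e₁ e₂ => e₁.Safe B W s ∧ e₂.Safe B W s ∧ op.Ok W (e₁.val s) (e₂.val s)

attribute [simp] BinOp.eval

theorem Expr.eval_of_safe {B W : ℕ} (hW : 1 < W) {s : State} {e : Expr} (h : e.Safe B W s) :
    e.eval B W s = some (e.val s) := by
  induction e with
  | const k => simpa [Expr.eval] using h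
  | reg r => simp [Expr.eval]
  | get a e ih => simp_all [Expr.eval]
  | bin op e₁ e₂ ih₁ ih₂ =>
    obtain ⟨h₁, h₂, h₃⟩ := h
    have : op.eval (e₁.val s) (e₂.val s) < W := by
      cases op <;> simp only [BinOp.Ok, BinOp.eval] at h₃ ⊢ <;> first | exact h₃ | (split <;> omega)
    simp only [Expr.eval, ih₁ h₁, ih₂ h₂, Option.bind_some, this, if_true, Expr.val]

@[simp] theorem Expr.val_ofNat (s : State) (k : ℕ) :
    Expr.val s (no_index (OfNat.ofNat k : Expr)) = k := rfl

@[simp] theorem Expr.safe_ofNat (B W : ℕ) (s : State) (k : ℕ) :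
    Expr.Safe B W s (no_index (OfNat.ofNat k : Expr)) ↔ k < W := Iff.rfl

/-- A bound for the running time of a command without loops. -/
def Cmd.cost : Cmd → ℕ
  | .skip => 1
  | .set _ e => e.cost + 1
  | .put _ e₁ e₂ => e₁.cost + e₂.cost + 1
  | .seq c₁ c₂ => c₁.cost + c₂.cost
  | .ite e c₁ c₂ => e.cost + 1 + (max c₁.cost c₂.cost)
  | .loop _ _ => 0
  | .ret e => e.cost + 1

/-- The weakest precondition of a command without loops: `Q` holds for the final state, `R` for a
returned value. -/
@[simp] def Cmd.vc (B W : ℕ) : Cmd → State → (State → Prop) → (ℕ → Prop) → Prop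
  | .skip, s, Q, _ => Q s
  | .set r e, s, Q, _ => e.Safe B W s ∧ Q (s.setReg r (e.val s))
  | .put a e₁ e₂, s, Q, _ => e₁.Safe B W s ∧ e₂.Safe B W s ∧ e₁.val s < B ∧
      Q (s.setArr a (e₁.val s) (e₂.val s))
  | .seq c₁ c₂, s, Q, R => c₁.vc B W s (fun s' => c₂.vc B W s' Q R) R
  | .ite e c₁ c₂, s, Q, R => e.Safe B W s ∧ (e.val s ≠ 0 → c₁.vc B W s Q R) ∧
      (e.val s = 0 → c₂.vc B W s Q R)
  | .loop _ _, _, _, _ => False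
  | .ret e, s, _, R => e.Safe B W s ∧ R (e.val s)

/-- Execution of `c` from state `s` at time `t`, without a fault: either it falls through and `Q`
holds for the final state and time, or it ends the program and `R` holds for the result and the
time. -/
def Run (B W : ℕ) (c : Cmd) (s : State) (t : ℕ) (Q : State → ℕ → Prop) (R : ℕ → ℕ → Prop) : Prop :=
  (∃ s' t', Exec B W c s (.next s') t' ∧ Q s' (t + t')) ∨
  (∃ x t', Exec B W c s (.ret x) t' ∧ R x (t + t'))

theorem Run.mono {B W c s t} {Q Q' : State → ℕ → Prop} {R R' : ℕ → ℕ → Prop}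
    (h : Run B W c s t Q R) (hQ : ∀ s' t', Q s' t' → Q' s' t') (hR : ∀ x t', R x t' → R' x t') :
    Run B W c s t Q' R' := by
  rcases h with ⟨s', t', h, h'⟩ | ⟨x, t', h, h'⟩
  · exact Or.inl ⟨s', t', h, hQ _ _ h'⟩
  · exact Or.inr ⟨x, t', h, hR _ _ h'⟩

theorem Run.post {B W c s t} {Q Q' : State → ℕ → Prop} {R : ℕ → ℕ → Prop}
    (h : Run B W c s t Q R) (hQ : ∀ s' t', Q s' t' → Q' s' t') : Run B W c s t Q' R :=
  h.mono hQ fun _ _ h => h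

theorem Run.seq {B W c₁ c₂ s t} {Q : State → ℕ → Prop} {R : ℕ → ℕ → Prop}
    (h : Run B W c₁ s t (fun s' t' => Run B W c₂ s' t' Q R) R) :
    Run B W (.seq c₁ c₂) s t Q R := by
  rcases h with ⟨s', t', h, h' | h'⟩ | ⟨x, t', h, h'⟩
  · obtain ⟨s₂, t₂, h₂, hQ⟩ := h'
    exact Or.inl ⟨s₂, _, .seq_next h h₂, by rwa [← Nat.add_assoc]⟩
  · obtain ⟨x, t₂, h₂, hR⟩ := h'
    exact Or.inr ⟨x, _, .seq_next h h₂, by rwa [← Nat.add_assoc]⟩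
  · exact Or.inr ⟨x, t', .seq_ret h, h'⟩

theorem Run.block_cons {B W c d l s t} {Q : State → ℕ → Prop} {R : ℕ → ℕ → Prop}
    (h : Run B W c s t (fun s' t' => Run B W (block (d :: l)) s' t' Q R) R) :
    Run B W (block (c :: d :: l)) s t Q R := Run.seq h

/-- Commands without loops are verified by computing their weakest precondition. -/
theorem Run.of_vc {B W : ℕ} (hW : 1 < W) {c : Cmd} {s : State} {t : ℕ} {Q : State → ℕ → Prop}
    {R : ℕ → ℕ → Prop}
    (h : c.vc B W s (fun s' => ∀ t' ≤ t + c.cost, Q s' t') (fun x => ∀ t' ≤ t + c.cost, R x t')) :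
    Run B W c s t Q R := by
  have key : ∀ (c : Cmd) (s : State) (Q : State → Prop) (R : ℕ → Prop), c.vc B W s Q R →
      (∃ s' t', Exec B W c s (.next s') t' ∧ t' ≤ c.cost ∧ Q s') ∨
      (∃ x t', Exec B W c s (.ret x) t' ∧ t' ≤ c.cost ∧ R x) := by
    intro c
    induction c with
    | skip => exact fun s Q R h => Or.inl ⟨s, 1, .skip s, le_rfl, h⟩
    | set r e => exact fun s Q R h => Or.inl ⟨_, _, .set (Expr.eval_of_safe hW h.1), le_rfl, h.2⟩
    | put a e₁ e₂ =>
      exact fun s Q R h => Or.inl ⟨_, _, .put (Expr.eval_of_safe hW h.1)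
        (Expr.eval_of_safe hW h.2.1) h.2.2.1, le_rfl, h.2.2.2⟩
    | seq c₁ c₂ ih₁ ih₂ =>
      intro s Q R h
      rcases ih₁ _ _ _ h with ⟨s', t', h₁, ht, h'⟩ | ⟨x, t', h₁, ht, h'⟩
      · rcases ih₂ _ _ _ h' with ⟨s₂, t₂, h₂, ht₂, h''⟩ | ⟨x, t₂, h₂, ht₂, h''⟩
        · exact Or.inl ⟨_, _, .seq_next h₁ h₂, by simp only [Cmd.cost]; omega, h''⟩
        · exact Or.inr ⟨_, _, .seq_next h₁ h₂, by simp only [Cmd.cost]; omega, h''⟩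
      · exact Or.inr ⟨_, _, .seq_ret h₁, by simp only [Cmd.cost]; omega, h'⟩
    | ite e c₁ c₂ ih₁ ih₂ =>
      intro s Q R h
      have he := Expr.eval_of_safe hW h.1
      by_cases h0 : e.val s = 0
      · rw [h0] at he
        rcases ih₂ _ _ _ (h.2.2 h0) with ⟨s', t', h₁, ht, h'⟩ | ⟨x, t', h₁, ht, h'⟩
        · exact Or.inl ⟨_, _, .ite_false he h₁, by simp only [Cmd.cost]; omega, h'⟩
        · exact Or.inr ⟨_, _, .ite_false he h₁, by simp only [Cmd.cost]; omega, h'⟩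
      · rcases ih₁ _ _ _ (h.2.1 h0) with ⟨s', t', h₁, ht, h'⟩ | ⟨x, t', h₁, ht, h'⟩
        · exact Or.inl ⟨_, _, .ite_true he h0 h₁, by simp only [Cmd.cost]; omega, h'⟩
        · exact Or.inr ⟨_, _, .ite_true he h0 h₁, by simp only [Cmd.cost]; omega, h'⟩
    | loop e c => exact fun s Q R h => h.elim
    | ret e => exact fun s Q R h => Or.inr ⟨_, _, .ret (Expr.eval_of_safe hW h.1), le_rfl, h.2⟩
  rcases key _ _ _ _ h with ⟨s', t', h₁, ht, h'⟩ | ⟨x, t', h₁, ht, h'⟩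
  · exact Or.inl ⟨s', t', h₁, h' _ (by omega)⟩
  · exact Or.inr ⟨x, t', h₁, h' _ (by omega)⟩

/-- Whether the command may write register `r`. -/
def Cmd.wR (r : ℕ) : Cmd → Bool
  | .set r' _ => r == r'
  | .seq c₁ c₂ => c₁.wR r || c₂.wR r
  | .ite _ c₁ c₂ => c₁.wR r || c₂.wR r
  | .loop _ c => c.wR r
  | _ => false

/-- Whether the command may write array `a`. -/
def Cmd.wA (a : ℕ) : Cmd → Bool
  | .put a' _ _ => a == a'
  | .seq c₁ c₂ => c₁.wA a || c₂.wA a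
  | .ite _ c₁ c₂ => c₁.wA a || c₂.wA a
  | .loop _ c => c.wA a
  | _ => false

/-- The two states agree in all the registers and arrays that do not occur in `c` as a target. -/
def Frame (c : Cmd) (s s' : State) : Prop :=
  (∀ r, c.wR r = false → s'.reg r = s.reg r) ∧ ∀ a, c.wA a = false → s'.arr a = s.arr a

theorem Frame.refl (c : Cmd) (s : State) : Frame c s s := ⟨fun _ _ => rfl, fun _ _ => rfl⟩

theorem Frame.trans {c : Cmd} {s s' s'' : State} (h : Frame c s s') (h' : Frame c s' s'') :
    Frame c s s'' :=
  ⟨fun r hr => (h'.1 r hr).trans (h.1 r hr), fun a ha => (h'.2 a ha).trans (h.2 a ha)⟩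

theorem Frame.weaken {c d : Cmd} {s s' : State} (h : Frame c s s')
    (hr : ∀ r, d.wR r = false → c.wR r = false) (ha : ∀ a, d.wA a = false → c.wA a = false) :
    Frame d s s' :=
  ⟨fun r h' => h.1 r (hr r h'), fun a h' => h.2 a (ha a h')⟩

theorem Exec.frame {B W : ℕ} {c : Cmd} {s s' : State} {o : Outcome} {t : ℕ}
    (h : Exec B W c s o t) (ho : o = .next s') : Frame c s s' := by
  induction h generalizing s' with
  | skip s => cases ho; exact Frame.refl _ _
  | set h =>
    cases ho
    refine ⟨fun r hr => ?_, fun a _ => rfl⟩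
    simp only [Cmd.wR, beq_eq_false_iff_ne] at hr
    simp [hr]
  | put =>
    cases ho
    refine ⟨fun r _ => rfl, fun a ha => ?_⟩
    simp only [Cmd.wA, beq_eq_false_iff_ne] at ha
    simp [ha]
  | seq_next _ _ ih₁ ih₂ =>
    refine ((ih₁ rfl).weaken ?_ ?_).trans ((ih₂ ho).weaken ?_ ?_) <;>
      simp +contextual [Cmd.wR, Cmd.wA]
  | seq_ret => cases ho
  | ite_true _ _ _ ih => exact (ih ho).weaken (by simp +contextual [Cmd.wR]) (by simp +contextual [Cmd.wA])
  | ite_false _ _ ih => exact (ih ho).weaken (by simp +contextual [Cmd.wR]) (by simp +contextual [Cmd.wA])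
  | loop_done => cases ho; exact Frame.refl _ _
  | loop_next _ _ _ _ ih₁ ih₂ =>
    exact ((ih₁ rfl).weaken (by simp [Cmd.wR]) (by simp [Cmd.wA])).trans (ih₂ ho)
  | loop_ret => cases ho
  | ret => cases ho

theorem Run.frame {B W c s t} {Q : State → ℕ → Prop} {R : ℕ → ℕ → Prop}
    (h : Run B W c s t Q R) : Run B W c s t (fun s' t' => Q s' t' ∧ Frame c s s') R := by
  rcases h with ⟨s', t', h, h'⟩ | h
  · exact Or.inl ⟨s', t', h, h', h.frame rfl⟩
  · exact Or.inr h

/-- The rule for loops. Every round takes time, so the bound `T` for the time at which the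
invariant can hold forces the loop to end. -/
theorem Run.loop {B W : ℕ} (hW : 1 < W) {e : Expr} {c : Cmd} {s : State} {t : ℕ}
    {Q : State → ℕ → Prop} {R : ℕ → ℕ → Prop} (I : State → ℕ → Prop) (T : ℕ)
    (hI : I s t) (hT : ∀ s' t', I s' t' → t' ≤ T)
    (hsafe : ∀ s' t', I s' t' → e.Safe B W s')
    (hdone : ∀ s' t', I s' t' → Frame c s s' → e.val s' = 0 → Q s' (t' + (e.cost + 1)))
    (hbody : ∀ s' t', I s' t' → Frame c s s' → e.val s' ≠ 0 → Run B W c s' (t' + (e.cost + 1)) I R) :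
    Run B W (.loop e c) s t Q R := by
  suffices key : ∀ k s' t', T - t' < k → I s' t' → Frame c s s' → Run B W (.loop e c) s' t' Q R from
    key _ s t (Nat.lt_succ_self _) hI (Frame.refl _ _)
  intro k
  induction k with
  | zero => omega
  | succ k ih =>
    intro s' t' hk hI' hF
    have he := Expr.eval_of_safe hW (hsafe s' t' hI')
    by_cases h0 : e.val s' = 0
    · rw [h0] at he
      exact Or.inl ⟨s', _, .loop_done he, hdone s' t' hI' hF h0⟩
    · rcases (hbody s' t' hI' hF h0).frame with ⟨s₂, t₂, hx, hI₂, hF₂⟩ | ⟨x, t₂, hx, hR⟩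
      · have hle := hT _ _ hI₂
        rcases ih s₂ _ (by omega) hI₂ (hF.trans hF₂) with ⟨s₃, t₃, hx₃, hQ⟩ | ⟨x, t₃, hx₃, hR⟩
        · exact Or.inl ⟨s₃, _, .loop_next he h0 hx hx₃, by
            convert hQ using 1; omega⟩
        · exact Or.inr ⟨x, _, .loop_next he h0 hx hx₃, by
            convert hR using 1; omega⟩
      · exact Or.inr ⟨x, _, .loop_ret he h0 hx, by convert hR using 1; omega⟩

/-- The rule for counting loops. The invariant `I i s t` is to hold whenever the loop is entered
with the counter at `i`, at time `t`; the test and the increment of the counter cost at most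
`hi.cost + 7` steps. -/
theorem Run.up {B W : ℕ} {r : ℕ} {lo hi : Expr} {c : Cmd} {s : State} {t : ℕ}
    {Q : State → ℕ → Prop} {R : ℕ → ℕ → Prop} (l H : ℕ) (I : ℕ → State → ℕ → Prop)
    (hW : H + 1 < W) (hW1 : 1 < W) (hlH : l ≤ H + 1) (hr : c.wR r = false)
    (hlo : lo.Safe B W s ∧ lo.val s = l)
    (hhi : ∀ s', Frame (forUp r lo hi c) s s' → hi.Safe B W s' ∧ hi.val s' = H)
    (hI : I l (s.setReg r l) (t + lo.cost + 1))
    (hbody : ∀ i s' t', l ≤ i → i ≤ H → s'.reg r = i → Frame (forUp r lo hi c) s s' → I i s' t' →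
      Run B W c s' (t' + hi.cost + 3)
        (fun s'' t'' => I (i + 1) (s''.setReg r (i + 1)) (t'' + 4)) R)
    (hQ : ∀ s' t', s'.reg r = H + 1 → Frame (forUp r lo hi c) s s' → I (H + 1) s' t' →
      Q s' (t' + hi.cost + 3)) :
    Run B W (forUp r lo hi c) s t Q R := by
  have hloop : ∀ k i s' t', H + 1 - i = k → l ≤ i → i ≤ H + 1 → s'.reg r = i →
      Frame (forUp r lo hi c) s s' → I i s' t' →
      Run B W (.loop (le (v r) hi) (block [c, .set r (v r + 1)])) s' t' Q R := by
    intro k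
    induction k with
    | zero =>
      intro i s' t' hk h1 h2 h3 hF hI'
      have hi' := hhi s' hF
      obtain rfl : i = H + 1 := by omega
      have he := Expr.eval_of_safe (B := B) (W := W) hW1 (s := s') (e := le (v r) hi)
        (by simp [hi'.1])
      have h0 : (le (v r) hi).val s' = 0 := by simp [h3, hi'.2]
      rw [h0] at he
      refine Or.inl ⟨s', _, .loop_done he, ?_⟩
      convert hQ s' t' h3 hF hI' using 1
      simp [Expr.cost]; omega
    | succ k ih =>
      intro i s' t' hk h1 h2 h3 hF hI'
      have hi' := hhi s' hF
      have he := Expr.eval_of_safe (B := B) (W := W) hW1 (s := s') (e := le (v r) hi)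
        (by simp [hi'.1])
      have h0 : (le (v r) hi).val s' ≠ 0 := by simp [h3, hi'.2]; omega
      rcases (hbody i s' t' h1 (by omega) h3 hF hI').frame with
        ⟨s₂, t₂, hx, hI₂, hF₂⟩ | ⟨x, t₂, hx, hR⟩
      · have hs₂ : s₂.reg r = i := by rw [hF₂.1 r hr, h3]
        have hset : Exec B W (.set r (v r + 1)) s₂ (.next (s₂.setReg r (i + 1))) 4 := by
          have := Exec.set (B := B) (W := W) (s := s₂) (r := r) (e := v r + 1)
            (Expr.eval_of_safe hW1 (by simp [hs₂]; omega))
          simpa [hs₂, Expr.cost] using this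
        have hF₃ : Frame (forUp r lo hi c) s (s₂.setReg r (i + 1)) := by
          refine hF.trans ⟨fun r' hr' => ?_, fun a ha => ?_⟩
          · simp [forUp, block, Cmd.wR] at hr'
            simp [hr', hF₂.1 r' hr'.2.1]
          · simp [forUp, block, Cmd.wA] at ha
            simp [hF₂.2 a ha]
        rcases ih (i + 1) (s₂.setReg r (i + 1)) (t' + hi.cost + 3 + t₂ + 4) (by omega) (by omega)
          (by omega) (by simp) hF₃ hI₂ with ⟨s₃, t₃, hx₃, hQ₃⟩ | ⟨x, t₃, hx₃, hR⟩
        · refine Or.inl ⟨s₃, _, .loop_next he h0 (.seq_next hx hset) hx₃, ?_⟩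
          convert hQ₃ using 1; simp [Expr.cost]; omega
        · refine Or.inr ⟨x, _, .loop_next he h0 (.seq_next hx hset) hx₃, ?_⟩
          convert hR using 1; simp [Expr.cost]; omega
      · refine Or.inr ⟨x, _, .loop_ret he h0 (.seq_ret hx), ?_⟩
        convert hR using 1; simp [Expr.cost]; omega
  refine Run.block_cons (Or.inl ⟨s.setReg r l, lo.cost + 1, ?_, ?_⟩)
  · have := Exec.set (B := B) (W := W) (s := s) (r := r) (Expr.eval_of_safe hW1 hlo.1)
    rwa [hlo.2] at this
  · refine hloop _ l _ _ rfl le_rfl hlH (by simp) ?_ hI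
    refine ⟨fun r' hr' => ?_, fun a ha => rfl⟩
    simp [forUp, block, Cmd.wR] at hr'
    simp [hr']

/-- The rule for counting loops with a loop-free body. -/
theorem Run.up_vc {B W : ℕ} {r : ℕ} {lo hi : Expr} {c : Cmd} {s : State} {t : ℕ}
    {Q : State → ℕ → Prop} {R : ℕ → ℕ → Prop} (l H C : ℕ) (I : ℕ → State → Prop)
    (hC : c.cost + hi.cost + lo.cost + 8 ≤ C)
    (hW : H + 1 < W) (hW1 : 1 < W) (hlH : l ≤ H + 1) (hr : c.wR r = false)
    (hlo : lo.Safe B W s ∧ lo.val s = l)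
    (hhi : ∀ s', Frame (forUp r lo hi c) s s' → hi.Safe B W s' ∧ hi.val s' = H)
    (hI : I l (s.setReg r l))
    (hbody : ∀ i s', l ≤ i → i ≤ H → s'.reg r = i → Frame (forUp r lo hi c) s s' → I i s' →
      c.vc B W s' (fun s'' => I (i + 1) (s''.setReg r (i + 1))) (fun _ => False))
    (hQ : ∀ s' t', t' ≤ t + (H + 2 - l) * C → s'.reg r = H + 1 → Frame (forUp r lo hi c) s s' →
      I (H + 1) s' → Q s' t') :
    Run B W (forUp r lo hi c) s t Q R := by
  refine Run.up l H (fun i s' t' => I i s' ∧ t' ≤ t + (lo.cost + 1) + (i - l) * C) hW hW1 hlH hr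
    hlo hhi ⟨hI, by simp⟩ ?_ ?_
  · intro i s' t' h1 h2 h3 hF ⟨hI', ht⟩
    refine Run.of_vc hW1 ?_
    have := hbody i s' h1 h2 h3 hF hI'
    have mono : ∀ (c : Cmd) (s : State) (Q Q' : State → Prop) (R R' : ℕ → Prop),
        c.vc B W s Q R → (∀ s, Q s → Q' s) → (∀ x, R x → R' x) → c.vc B W s Q' R' := by
      intro c
      induction c with
      | skip => exact fun s Q Q' R R' h hQ hR => hQ _ h
      | set r e => exact fun s Q Q' R R' h hQ hR => ⟨h.1, hQ _ h.2⟩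
      | put a e₁ e₂ => exact fun s Q Q' R R' h hQ hR => ⟨h.1, h.2.1, h.2.2.1, hQ _ h.2.2.2⟩
      | seq c₁ c₂ ih₁ ih₂ =>
        exact fun s Q Q' R R' h hQ hR => ih₁ _ _ _ _ _ h (fun s h => ih₂ _ _ _ _ _ h hQ hR) hR
      | ite e c₁ c₂ ih₁ ih₂ =>
        exact fun s Q Q' R R' h hQ hR => ⟨h.1, fun h0 => ih₁ _ _ _ _ _ (h.2.1 h0) hQ hR,
          fun h0 => ih₂ _ _ _ _ _ (h.2.2 h0) hQ hR⟩
      | loop e c => exact fun s Q Q' R R' h hQ hR => h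
      | ret e => exact fun s Q Q' R R' h hQ hR => ⟨h.1, hR _ h.2⟩
    refine mono _ _ _ _ _ _ this (fun s'' h t'' ht'' => ⟨h, ?_⟩) (fun _ h => h.elim)
    have : i + 1 - l = (i - l) + 1 := by omega
    rw [this, Nat.add_mul]; omega
  · intro s' t' h3 hF ⟨hI', ht⟩
    refine hQ s' _ ?_ h3 hF hI'
    have : H + 2 - l = (H + 1 - l) + 1 := by omega
    rw [this, Nat.add_mul]; omega

/-- The rule for counting loops that fill a segment of an array. -/
theorem Run.up_map {B W : ℕ} {r : ℕ} {lo hi : Expr} {c : Cmd} {s : State} {t : ℕ}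
    {Q : State → ℕ → Prop} {R : ℕ → ℕ → Prop} (l H C : ℕ) (a b : ℕ) (f : ℕ → ℕ)
    (hC : c.cost + hi.cost + lo.cost + 8 ≤ C)
    (hW : H + 1 < W) (hW1 : 1 < W) (hlH : l ≤ H + 1) (hr : c.wR r = false)
    (hlo : lo.Safe B W s ∧ lo.val s = l)
    (hhi : ∀ s', Frame (forUp r lo hi c) s s' → hi.Safe B W s' ∧ hi.val s' = H)
    (hbody : ∀ i s', l ≤ i → i ≤ H → s'.reg r = i → Frame (forUp r lo hi c) s s' →
      (∀ j, s'.arr a j = if b + l ≤ j ∧ j < b + i then f (j - b) else s.arr a j) →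
      c.vc B W s' (fun s'' => s''.arr a = Function.update (s'.arr a) (b + i) (f i)) (fun _ => False))
    (hQ : ∀ s' t', t' ≤ t + (H + 2 - l) * C → s'.reg r = H + 1 → Frame (forUp r lo hi c) s s' →
      (∀ j, s'.arr a j = if b + l ≤ j ∧ j ≤ b + H then f (j - b) else s.arr a j) → Q s' t') :
    Run B W (forUp r lo hi c) s t Q R := by
  refine Run.up_vc l H C
    (fun i s' => ∀ j, s'.arr a j = if b + l ≤ j ∧ j < b + i then f (j - b) else s.arr a j)
    hC hW hW1 hlH hr hlo hhi ?_ ?_ ?_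
  · intro j
    rw [if_neg (by omega)]; rfl
  · intro i s' h1 h2 h3 hF hI
    have := hbody i s' h1 h2 h3 hF hI
    have h4 : (fun s'' : State => s''.arr a = Function.update (s'.arr a) (b + i) (f i)) =
        fun s'' => ∀ j, (s''.setReg r (i + 1)).arr a j =
          if b + l ≤ j ∧ j < b + (i + 1) then f (j - b) else s.arr a j := by
      funext s''
      rw [State.setReg_arr, funext_iff]
      refine propext (forall_congr' fun j => ?_)
      rw [Function.update_apply, hI j]
      by_cases hj : j = b + i
      · subst hj
        rw [if_pos rfl, if_pos (by omega)]; simp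
      · rw [if_neg hj]
        have : (b + l ≤ j ∧ j < b + i) ↔ (b + l ≤ j ∧ j < b + (i + 1)) := by omega
        simp only [this]
    rwa [← h4]
  · intro s' t' ht h3 hF hI
    refine hQ s' t' ht h3 hF fun j => ?_
    rw [hI j]
    have : (b + l ≤ j ∧ j < b + (H + 1)) ↔ (b + l ≤ j ∧ j ≤ b + H) := by omega
    simp only [this]

/-! ### Counting ranks -/

/-- The number of indices below `N` with a smaller key than `i`. -/
def crk {α : Type*} [LinearOrder α] (N : ℕ) (κ : ℕ → α) (i : ℕ) : ℕ :=
  ((Finset.range N).filter fun j => κ j < κ i).card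

section crk
variable {α : Type*} [LinearOrder α] {N : ℕ} {κ : ℕ → α} {i j : ℕ}

theorem crk_le_crk (h : κ i ≤ κ j) : crk N κ i ≤ crk N κ j :=
  Finset.card_le_card (Finset.monotone_filter_right _ fun _ _ hk => lt_of_lt_of_le hk h)

theorem crk_lt_crk (hi : i < N) (h : κ i < κ j) : crk N κ i < crk N κ j := by
  refine Finset.card_lt_card (Finset.ssubset_iff_of_subset
    (Finset.monotone_filter_right _ fun _ _ hk => hk.trans h) |>.2 ⟨i, ?_, ?_⟩)
  · simp [hi, h]
  · simp

theorem crk_lt_crk_iff (hi : i < N) : crk N κ i < crk N κ j ↔ κ i < κ j :=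
  ⟨fun h => lt_of_not_ge fun h' => absurd (crk_le_crk (N := N) h') (by omega), crk_lt_crk hi⟩

theorem crk_eq_crk_iff (hi : i < N) (hj : j < N) : crk N κ i = crk N κ j ↔ κ i = κ j := by
  constructor
  · intro h
    rcases lt_trichotomy (κ i) (κ j) with h' | h' | h'
    · have := crk_lt_crk hi h'; omega
    · exact h'
    · have := crk_lt_crk hj h'; omega
  · intro h; simp [crk, h]

theorem crk_lt (hi : i < N) : crk N κ i < N := by
  conv_rhs => rw [← Finset.card_range N]
  refine Finset.card_lt_card (Finset.ssubset_iff_of_subset (Finset.filter_subset _ _) |>.2 ⟨i, ?_, ?_⟩)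
  · simpa using hi
  · simp

/-- The ranks under an injective key are a permutation. -/
theorem exists_crk_eq (hκ : ∀ i < N, ∀ j < N, κ i = κ j → i = j) {p : ℕ} (hp : p < N) :
    ∃ i < N, crk N κ i = p := by
  have h := Finset.surj_on_of_inj_on_of_card_le (s := Finset.range N) (t := Finset.range N)
    (fun i _ => crk N κ i) (fun i hi => by simpa using crk_lt (by simpa using hi))
    (fun i j hi hj h => hκ i (by simpa using hi) j (by simpa using hj)
      ((crk_eq_crk_iff (by simpa using hi) (by simpa using hj)).1 h)) le_rfl p (by simpa using hp)
  obtain ⟨i, hi, h⟩ := h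
  exact ⟨i, by simpa using hi, h.symm⟩

end crk

/-! ### Suffixes of texts as infinite sequences -/

/-- Infinite sequences of characters. -/
def Seqs : Type := Lex (ℕ → ℕ)

/-- Sequences are compared lexicographically. -/
noncomputable instance : LinearOrder Seqs := inferInstanceAs (LinearOrder (Lex (ℕ → ℕ)))

/-- The suffix at `i`, as an infinite sequence. -/
def suf (t : ℕ → ℕ) (i : ℕ) : Seqs := toLex fun k => t (i + k)

/-- The suffixes at `i` and `j` have a common prefix of length `δ`. -/
def Agree (t : ℕ → ℕ) (δ i j : ℕ) : Prop := ∀ k < δ, t (i + k) = t (j + k)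

theorem Agree.symm {t δ i j} (h : Agree t δ i j) : Agree t δ j i := fun k hk => (h k hk).symm

theorem Agree.trans {t δ i j l} (h : Agree t δ i j) (h' : Agree t δ j l) : Agree t δ i l :=
  fun k hk => (h k hk).trans (h' k hk)

theorem Agree.mono {t δ δ' i j} (h : Agree t δ i j) (hd : δ' ≤ δ) : Agree t δ' i j :=
  fun k hk => h k (by omega)

theorem suf_lt_iff {t : ℕ → ℕ} {i j : ℕ} :
    suf t i < suf t j ↔ ∃ k, Agree t k i j ∧ t (i + k) < t (j + k) := Iff.rfl

theorem Agree.suf_lt_suf_iff {t : ℕ → ℕ} {δ i j : ℕ} (h : Agree t δ i j) :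
    suf t i < suf t j ↔ suf t (i + δ) < suf t (j + δ) := by
  simp only [suf_lt_iff]
  constructor
  · rintro ⟨k, hk, hlt⟩
    have : δ ≤ k := by
      by_contra hc
      have := h k (by omega); omega
    obtain ⟨k, rfl⟩ := Nat.exists_eq_add_of_le this
    refine ⟨k, fun l hl => ?_, by simpa only [Nat.add_assoc] using hlt⟩
    simpa only [Nat.add_assoc] using hk (δ + l) (by omega)
  · rintro ⟨k, hk, hlt⟩
    refine ⟨δ + k, fun l hl => ?_, by simpa only [Nat.add_assoc] using hlt⟩
    by_cases hl' : l < δ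
    · exact h l hl'
    · obtain ⟨l, rfl⟩ := Nat.exists_eq_add_of_le (not_lt.1 hl')
      simpa only [Nat.add_assoc] using hk l (by omega)

/-- A common prefix of two suffixes is one of any suffix between them. -/
theorem Agree.between {t : ℕ → ℕ} {δ i j l : ℕ} (h : Agree t δ i l) (h₁ : suf t i ≤ suf t j)
    (h₂ : suf t j ≤ suf t l) : Agree t δ i j := by
  intro k hk
  induction k using Nat.strong_induction_on with
  | _ k ih =>
    have hij : Agree t k i j := fun m hm => ih m hm (by omega)
    rcases lt_trichotomy (t (i + k)) (t (j + k)) with h' | h' | h'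
    · exfalso
      have hl := h k hk
      refine absurd (suf_lt_iff.2 ⟨k, ?_, ?_⟩) (not_lt.2 h₂)
      · exact (h.mono hk.le).symm.trans hij
      · omega
    · exact h'
    · exact absurd (suf_lt_iff.2 ⟨k, hij.symm, h'⟩) (not_lt.2 h₁)

/-- `t` is a text of length `n`, continued by zeros. The bound on the characters is what
makes bucket sorting linear. -/
structure IsTxt (n : ℕ) (t : ℕ → ℕ) : Prop where
  pos : ∀ i < n, 1 ≤ t i
  le : ∀ i < n, t i ≤ 2 * n
  zero : ∀ i, n ≤ i → t i = 0

theorem IsTxt.le' {n t} (h : IsTxt n t) (i : ℕ) : t i ≤ 2 * n := by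
  by_cases hi : i < n
  · exact h.le i hi
  · rw [h.zero i (by omega)]; omega

/-- Distinct suffixes reach the end of the text at different times, so a common prefix ends before
that. -/
theorem IsTxt.agree_bound {n t δ i j} (h : IsTxt n t) (hi : i ≤ n) (hj : j ≤ n) (hij : i ≠ j)
    (ha : Agree t δ i j) : i + δ ≤ n ∧ j + δ ≤ n := by
  have key : ∀ i j, i < j → j ≤ n → Agree t δ i j → j + δ ≤ n := by
    intro i j hij hj ha
    by_contra hc
    have h1 := ha (n - j) (by omega)
    rw [h.zero (j + (n - j)) (by omega)] at h1
    have := h.pos (i + (n - j)) (by omega)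
    omega
  rcases Nat.lt_or_gt_of_ne hij with h' | h'
  · have := key i j h' hj ha; omega
  · have := key j i h' hi ha.symm; omega

theorem IsTxt.suf_injOn {n t i j} (h : IsTxt n t) (hi : i ≤ n) (hj : j ≤ n)
    (hs : suf t i = suf t j) : i = j := by
  by_contra hij
  have : Agree t (n + 1) i j := fun k _ => congrFun (congrArg ofLex hs) k
  have := h.agree_bound hi hj hij this
  omega

/-- `r` ranks the suffixes of the text, the empty one included. -/
def IsRank (n : ℕ) (t r : ℕ → ℕ) : Prop := ∀ i ≤ n, r i = crk (n + 1) (suf t) i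

theorem IsRank.lt_iff {n t r i j} (h : IsRank n t r) (hi : i ≤ n) (hj : j ≤ n) :
    r i < r j ↔ suf t i < suf t j := by
  rw [h i hi, h j hj, crk_lt_crk_iff (by omega)]

/-- The numbers `D i` are order-preserving names for the prefixes of length `δ` of the suffixes. -/
def IsName (n : ℕ) (t : ℕ → ℕ) (δ : ℕ) (D : ℕ → ℕ) : Prop :=
  ∀ i ≤ n, ∀ j ≤ n, (D i = D j ↔ Agree t δ i j) ∧ (D i < D j → suf t i < suf t j)

theorem isName_zero (n t) : IsName n t 0 (fun _ => 0) :=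
  fun _ _ _ _ => ⟨by simp [Agree], by simp⟩

theorem isName_one (n t) : IsName n t 1 t :=
  fun i _ j _ => ⟨by simp [Agree], fun h => suf_lt_iff.2 ⟨0, by simp [Agree], by simpa using h⟩⟩

/-- Pairs of a name for a prefix and a rank for the rest of the suffix are ordered as the
suffixes are. -/
theorem IsName.pair_lt_iff {n t δ D} {y : ℕ → ℕ} (h : IsName n t δ D) {i j : ℕ} (hi : i ≤ n)
    (hj : j ≤ n) (hy : i ≠ j → D i = D j → (y i < y j ↔ suf t (i + δ) < suf t (j + δ))) :
    toLex (D i, y i) < toLex (D j, y j) ↔ suf t i < suf t j := by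
  rw [Prod.Lex.toLex_lt_toLex]
  by_cases hij : i = j
  · subst hij; simp
  rcases lt_trichotomy (D i) (D j) with h' | h' | h'
  · simp [h', (h i hi j hj).2 h']
  · rw [((h i hi j hj).1.1 h').suf_lt_suf_iff, ← hy hij h']
    simp [h']
  · have := (h j hj i hi).2 h'
    simp [h'.not_gt, h'.ne', this.not_gt]

theorem IsName.ext {n t δ D} (h : IsName n t δ D) :
    IsName n t (δ + 1) (crk (n + 1) fun i => toLex (D i, t (i + δ))) := by
  intro i hi j hj
  rw [crk_eq_crk_iff (by omega) (by omega), crk_lt_crk_iff (by omega)]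
  have ha : Agree t (δ + 1) i j ↔ Agree t δ i j ∧ t (i + δ) = t (j + δ) :=
    ⟨fun h => ⟨h.mono (by omega), h δ (by omega)⟩, fun h k hk => by
      rcases Nat.lt_succ_iff_lt_or_eq.1 hk with hk | rfl
      exacts [h.1 k hk, h.2]⟩
  refine ⟨?_, fun hlt => ?_⟩
  · rw [ha, ← (h i hi j hj).1]
    simp
  · rcases Prod.Lex.toLex_lt_toLex.1 hlt with hlt | ⟨h1, h2⟩
    · exact (h i hi j hj).2 hlt
    · exact suf_lt_iff.2 ⟨δ, (h i hi j hj).1.1 h1, h2⟩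

/-! ### The difference cover recursion -/

/-- The length of the derived text: the number of positions up to `n` that are not divisible by `3`.
The suffixes at these positions are ordered like the suffixes of the derived text, whose characters
are names for triples of characters. -/
def childLen (n : ℕ) : ℕ := n - n / 3

/-- The position in the text that belongs to position `q` of the derived text. -/
def childPos (n q : ℕ) : ℕ := if q < (n + 2) / 3 then 3 * q + 1 else 3 * (q - (n + 2) / 3) + 2

/-- The derived text, from names `e` for triples. -/
def childTxt (n : ℕ) (e : ℕ → ℕ) (q : ℕ) : ℕ := if q < childLen n then e (childPos n q) + 1 else 0

theorem childPos_le {n q} (hq : q < childLen n) : childPos n q ≤ n := by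
  unfold childLen at hq; unfold childPos; split <;> omega

theorem childPos_inj {n q q'} (h : childPos n q = childPos n q') : q = q' := by
  unfold childPos at h; split at h <;> split at h <;> omega

/-- The last triple in either residue class contains the end of the text, so that a step from one
class to the other never matters. -/
theorem childPos_succ {n q} (hq : q < childLen n) (h : childPos n q + 3 ≤ n) :
    q + 1 < childLen n ∧ childPos n (q + 1) = childPos n q + 3 := by
  have hm : n - n / 3 = (n + 2) / 3 + (n + 1) / 3 := by omega
  unfold childLen childPos at *
  rw [hm] at hq ⊢
  split at h
  · rw [if_pos (by omega)]
    rw [if_pos (by omega)]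
    omega
  · rw [if_neg (by omega), if_neg (by omega)]
    omega

theorem isTxt_childTxt {n e} (hn : 3 ≤ n) (he : ∀ p ≤ n, e p ≤ n) :
    IsTxt (childLen n) (childTxt n e) where
  pos q hq := by simp [childTxt, hq]
  le q hq := by
    have := he _ (childPos_le hq)
    simp only [childTxt, hq, if_true]
    unfold childLen
    omega
  zero q hq := by simp [childTxt, hq]

/-- Reading triples from equal names on, a difference of two suffixes of the text shows up as a
difference of the names before either residue class is left. -/
theorem suf_childTxt_lt {n t e} (ht : IsTxt n t) (he : IsName n t 3 e) (k : ℕ) :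
    ∀ q q', q < childLen n → q' < childLen n → n - childPos n q ≤ k →
      suf t (childPos n q) < suf t (childPos n q') →
      suf (childTxt n e) q < suf (childTxt n e) q' := by
  induction k with
  | zero =>
    intro q q' hq hq' hk hlt
    have hp := childPos_le hq
    have hp' := childPos_le hq'
    have h0 := ht.zero (childPos n q) (by omega)
    have hne : e (childPos n q) ≠ e (childPos n q') := fun h => by
      have := (he _ hp _ hp').1.1 h
      have := ht.agree_bound hp hp' (fun hc => by rw [hc] at hlt; exact lt_irrefl _ hlt) this
      omega
    refine suf_lt_iff.2 ⟨0, by simp [Agree], ?_⟩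
    have : e (childPos n q) < e (childPos n q') := lt_of_le_of_ne
      (not_lt.1 fun h => absurd ((he _ hp' _ hp).2 h) hlt.not_gt) hne
    simpa [childTxt, hq, hq'] using this
  | succ k ih =>
    intro q q' hq hq' hk hlt
    have hp := childPos_le hq
    have hp' := childPos_le hq'
    by_cases hne : e (childPos n q) = e (childPos n q')
    · have ha := (he _ hp _ hp').1.1 hne
      have hb := ht.agree_bound hp hp' (fun hc => by rw [hc] at hlt; exact lt_irrefl _ hlt) ha
      obtain ⟨h1, h2⟩ := childPos_succ hq hb.1
      obtain ⟨h1', h2'⟩ := childPos_succ hq' hb.2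
      rw [ha.suf_lt_suf_iff, ← h2, ← h2'] at hlt
      have hlt' := ih _ _ h1 h1' (by omega) hlt
      have ha' : Agree (childTxt n e) 1 q q' := by simp [Agree, childTxt, hq, hq', hne]
      exact ha'.suf_lt_suf_iff.2 hlt'
    · refine suf_lt_iff.2 ⟨0, by simp [Agree], ?_⟩
      have : e (childPos n q) < e (childPos n q') := lt_of_le_of_ne
        (not_lt.1 fun h => absurd ((he _ hp' _ hp).2 h) hlt.not_gt) hne
      simpa [childTxt, hq, hq'] using this

theorem suf_childTxt_lt_iff {n t e} (ht : IsTxt n t) (he : IsName n t 3 e) {q q' : ℕ}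
    (hq : q < childLen n) (hq' : q' < childLen n) :
    suf (childTxt n e) q < suf (childTxt n e) q' ↔
      suf t (childPos n q) < suf t (childPos n q') := by
  refine ⟨fun h => ?_, suf_childTxt_lt ht he _ _ _ hq hq' le_rfl⟩
  rcases lt_trichotomy (suf t (childPos n q)) (suf t (childPos n q')) with h' | h' | h'
  · exact h'
  · rw [childPos_inj (ht.suf_injOn (childPos_le hq) (childPos_le hq') h')] at h
    exact absurd h (lt_irrefl _)
  · exact absurd (suf_childTxt_lt ht he _ _ _ hq' hq le_rfl h') h.not_gt

/-- The ranks `r` of the derived text, transported to the positions that are not divisible by `3`. -/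
def sampleRank (n : ℕ) (r : ℕ → ℕ) (p : ℕ) : ℕ :=
  if n < p then 0 else if p % 3 = 1 then r (p / 3) else
    if p % 3 = 2 then r ((n + 2) / 3 + p / 3) else 0

theorem exists_childPos {n p r} (hp : p ≤ n) (h3 : p % 3 ≠ 0) :
    ∃ q < childLen n, childPos n q = p ∧ sampleRank n r p = r q := by
  unfold childLen childPos sampleRank
  by_cases h1 : p % 3 = 1
  · refine ⟨p / 3, by omega, ?_, ?_⟩
    · rw [if_pos (by omega)]; omega
    · rw [if_neg (by omega), if_pos h1]
  · refine ⟨(n + 2) / 3 + p / 3, by omega, ?_, ?_⟩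
    · rw [if_neg (by omega)]; omega
    · rw [if_neg (by omega), if_neg h1, if_pos (by omega)]

theorem sampleRank_lt_iff {n t e r} (ht : IsTxt n t) (he : IsName n t 3 e)
    (hr : IsRank (childLen n) (childTxt n e) r) {p q : ℕ} (hp : p ≤ n) (hp3 : p % 3 ≠ 0)
    (hq : q ≤ n) (hq3 : q % 3 ≠ 0) :
    sampleRank n r p < sampleRank n r q ↔ suf t p < suf t q := by
  obtain ⟨a, ha, rfl, h1⟩ := exists_childPos (r := r) hp hp3
  obtain ⟨b, hb, rfl, h2⟩ := exists_childPos (r := r) hq hq3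
  rw [h1, h2, hr.lt_iff (by omega) (by omega), suf_childTxt_lt_iff ht he ha hb]

theorem sampleRank_le {n t r} (hr : IsRank (childLen n) t r) (p : ℕ) : sampleRank n r p ≤ n := by
  by_cases hp : p ≤ n ∧ p % 3 ≠ 0
  · obtain ⟨q, hq, -, h⟩ := exists_childPos (r := r) hp.1 hp.2
    rw [h, hr q (by omega)]
    have := crk_lt (N := childLen n + 1) (κ := suf t) (i := q) (by omega)
    unfold childLen at *
    omega
  · unfold sampleRank
    split
    · omega
    · rw [if_neg (by omega), if_neg (by omega)]; omega

/-- The key in the pass of shift `δ`: the suffixes at the positions `i` such that `i + δ` is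
divisible by `3` are excluded by a large first component. -/
def passKey (n δ : ℕ) (D s : ℕ → ℕ) (i : ℕ) : ℕ ×ₗ ℕ :=
  toLex (if (i + δ) % 3 = 0 then 2 * n + 1 else D i, s (i + δ))

/-- The number of suffixes below the one at `i`, at positions in the residue class `k`. -/
noncomputable def classCount (n : ℕ) (t : ℕ → ℕ) (k i : ℕ) : ℕ :=
  ((Finset.range (n + 1)).filter fun j => j % 3 = k ∧ suf t j < suf t i).card

theorem crk_suf_eq (n t i) : crk (n + 1) (suf t) i =
    classCount n t 0 i + classCount n t 1 i + classCount n t 2 i := by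
  unfold crk classCount
  rw [← Finset.card_union_of_disjoint, ← Finset.card_union_of_disjoint]
  · congr 1; ext j; simp only [Finset.mem_union, Finset.mem_filter]
    have : j % 3 = 0 ∨ j % 3 = 1 ∨ j % 3 = 2 := by omega
    tauto
  · rw [Finset.disjoint_left]; intro j; simp only [Finset.mem_union, Finset.mem_filter]; omega
  · rw [Finset.disjoint_left]; intro j; simp only [Finset.mem_filter]; omega

theorem crk_passKey {n t e r δ D} (ht : IsTxt n t) (he : IsName n t 3 e)
    (hr : IsRank (childLen n) (childTxt n e) r) (hD : IsName n t δ D) (hD' : ∀ i ≤ n, D i ≤ 2 * n)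
    {i : ℕ} (hi : i ≤ n) (h3 : (i + δ) % 3 ≠ 0) (k k' : ℕ) (hk : k < 3) (hk' : k' < 3)
    (hkk : k ≠ k') (hδk : (k + δ) % 3 ≠ 0) (hδk' : (k' + δ) % 3 ≠ 0) :
    crk (n + 1) (passKey n δ D (sampleRank n r)) i = classCount n t k i + classCount n t k' i := by
  unfold crk classCount
  rw [← Finset.card_union_of_disjoint]
  · congr 1; ext j
    simp only [Finset.mem_union, Finset.mem_filter, Finset.mem_range]
    rw [← and_or_left, and_congr_right_iff]
    intro hj
    rw [← or_and_right]
    have hcl : (j % 3 = k ∨ j % 3 = k') ↔ (j + δ) % 3 ≠ 0 := by omega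
    rw [hcl]
    by_cases hj3 : (j + δ) % 3 = 0
    · have := hD' i hi
      have h4 : ¬ (2 * n + 1 < D i) := by omega
      have h5 : ¬ (2 * n + 1 = D i) := by omega
      simp [passKey, h3, hj3, Prod.Lex.toLex_lt_toLex, h4, h5]
    · simp only [passKey, hj3, h3, if_false, ne_eq, not_false_eq_true, true_and]
      refine hD.pair_lt_iff (y := fun i => sampleRank n r (i + δ)) (by omega) hi fun hne hDe => ?_
      have hb := ht.agree_bound (by omega) hi hne ((hD j (by omega) i hi).1.1 hDe)
      exact sampleRank_lt_iff ht he hr hb.1 hj3 hb.2 h3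
  · rw [Finset.disjoint_left]; intro j; simp only [Finset.mem_filter]; omega

/-- The part of the pass of shift `δ` in the sum over the passes. -/
noncomputable def passPart (n δ : ℕ) (D s : ℕ → ℕ) (i : ℕ) : ℕ :=
  if (i + δ) % 3 = 0 then 0 else crk (n + 1) (passKey n δ D s) i

/-- The number of positions up to `n` in the residue classes below `k`. -/
def classOffset (n k : ℕ) : ℕ :=
  if k = 0 then 0 else if k = 1 then n / 3 + 1 else n / 3 + 1 + (n + 2) / 3

theorem card_classOffset (n k : ℕ) (hk : k < 3) :
    ((Finset.range (n + 1)).filter fun j => j % 3 < k).card = classOffset n k := by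
  induction n with
  | zero => interval_cases k <;> decide
  | succ n ih =>
    rw [Finset.range_add_one, Finset.filter_insert]
    unfold classOffset at *
    split
    · rw [Finset.card_insert_of_notMem (by simp), ih]
      split_ifs <;> omega
    · rw [ih]
      split_ifs <;> omega

/-- The sum over the passes counts the suffixes of the class of `i` twice and the others
once; a last ranking, within the classes, gives the number of the former. -/
theorem rank_of_passes {n t e r D₁ D₂} (ht : IsTxt n t) (he : IsName n t 3 e)
    (hr : IsRank (childLen n) (childTxt n e) r)
    (hD₁ : IsName n t 1 D₁) (hD₁' : ∀ i ≤ n, D₁ i ≤ 2 * n)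
    (hD₂ : IsName n t 2 D₂) (hD₂' : ∀ i ≤ n, D₂ i ≤ 2 * n) (F : ℕ → ℕ)
    (hF : ∀ i ≤ n, F i = passPart n 0 (fun _ => 0) (sampleRank n r) i +
      passPart n 1 D₁ (sampleRank n r) i + passPart n 2 D₂ (sampleRank n r) i) :
    (∀ i ≤ n, F i ≤ 2 * n) ∧
    IsRank n t (fun i => F i + classOffset n (i % 3) -
      crk (n + 1) (fun j => toLex (j % 3, F j)) i) := by
  have hF' : ∀ i ≤ n, F i = crk (n + 1) (suf t) i + classCount n t (i % 3) i := by
    intro i hi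
    rw [hF i hi, crk_suf_eq]
    unfold passPart
    have h : i % 3 = 0 ∨ i % 3 = 1 ∨ i % 3 = 2 := by omega
    rcases h with h | h | h
    · rw [if_pos (by omega), if_neg (by omega), if_neg (by omega),
        crk_passKey ht he hr hD₁ hD₁' hi (by omega) 0 1 (by omega) (by omega) (by omega) (by omega)
          (by omega),
        crk_passKey ht he hr hD₂ hD₂' hi (by omega) 0 2 (by omega) (by omega) (by omega) (by omega)
          (by omega), h]
      omega
    · rw [if_neg (by omega), if_neg (by omega), if_pos (by omega),
        crk_passKey ht he hr (isName_zero n t) (by simp) hi (by omega) 1 2 (by omega) (by omega)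
          (by omega) (by omega) (by omega),
        crk_passKey ht he hr hD₁ hD₁' hi (by omega) 0 1 (by omega) (by omega) (by omega) (by omega)
          (by omega), h]
      omega
    · rw [if_neg (by omega), if_pos (by omega), if_neg (by omega),
        crk_passKey ht he hr (isName_zero n t) (by simp) hi (by omega) 1 2 (by omega) (by omega)
          (by omega) (by omega) (by omega),
        crk_passKey ht he hr hD₂ hD₂' hi (by omega) 0 2 (by omega) (by omega) (by omega) (by omega)
          (by omega), h]
      omega
  have hmono : ∀ i ≤ n, ∀ j ≤ n, i % 3 = j % 3 → (F i < F j ↔ suf t i < suf t j) := by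
    have h1 : ∀ i ≤ n, ∀ j ≤ n, i % 3 = j % 3 → suf t i < suf t j → F i < F j := by
      intro i hi j hj hij hlt
      rw [hF' i hi, hF' j hj, hij]
      have h1 : crk (n + 1) (suf t) i < crk (n + 1) (suf t) j := crk_lt_crk (by omega) hlt
      have h2 : classCount n t (j % 3) i ≤ classCount n t (j % 3) j :=
        Finset.card_le_card (Finset.monotone_filter_right _
          fun _ _ hk => ⟨hk.1, hk.2.trans hlt⟩)
      omega
    intro i hi j hj hij
    refine ⟨fun h => ?_, h1 i hi j hj hij⟩
    rcases lt_trichotomy (suf t i) (suf t j) with h' | h' | h'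
    · exact h'
    · rw [ht.suf_injOn hi hj h'] at h; omega
    · have := h1 j hj i hi hij.symm h'; omega
  refine ⟨fun i hi => ?_, fun i hi => ?_⟩
  · have h1 : crk (n + 1) (suf t) i < n + 1 := crk_lt (by omega)
    have h2 : classCount n t (i % 3) i ≤ crk (n + 1) (suf t) i :=
      Finset.card_le_card (Finset.monotone_filter_right _ fun _ _ hk => hk.2)
    rw [hF' i hi]; omega
  · have hcrk : crk (n + 1) (fun j => toLex (j % 3, F j)) i =
        classOffset n (i % 3) + classCount n t (i % 3) i := by
      rw [← card_classOffset n (i % 3) (by omega)]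
      unfold crk classCount
      rw [← Finset.card_union_of_disjoint]
      · congr 1; ext j
        simp only [Finset.mem_union, Finset.mem_filter, Finset.mem_range,
          Prod.Lex.toLex_lt_toLex]
        constructor
        · rintro ⟨hj, h | ⟨h, h'⟩⟩
          · exact Or.inl ⟨hj, h⟩
          · exact Or.inr ⟨hj, h, (hmono j (by omega) i hi h).1 h'⟩
        · rintro (⟨hj, h⟩ | ⟨hj, h, h'⟩)
          · exact ⟨hj, Or.inl h⟩
          · exact ⟨hj, Or.inr ⟨h, (hmono j (by omega) i hi h).2 h'⟩⟩
      · rw [Finset.disjoint_left]; intro j; simp only [Finset.mem_filter]; omega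
    simp only [hcrk, hF' i hi]
    omega

/-- The two suffixes of a text of length two are sorted by one comparison. -/
theorem isRank_two {t : ℕ → ℕ} (ht : IsTxt 2 t) {r : ℕ → ℕ} (h0 : r 0 = if t 0 < t 1 then 1 else 2)
    (h1 : r 1 = if t 0 < t 1 then 2 else 1) (h2 : r 2 = 0) : IsRank 2 t r := by
  have hz := ht.zero
  have hp0 := ht.pos 0 (by omega)
  have hp1 := ht.pos 1 (by omega)
  have hl : ∀ i j, t i < t j → suf t i < suf t j := fun i j h =>
    suf_lt_iff.2 ⟨0, by simp [Agree], by simpa using h⟩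
  have h20 : suf t 2 < suf t 0 := hl _ _ (by rw [hz 2 le_rfl]; omega)
  have h21 : suf t 2 < suf t 1 := hl _ _ (by rw [hz 2 le_rfl]; omega)
  have h01 : suf t 0 < suf t 1 ↔ t 0 < t 1 := by
    refine ⟨fun h => ?_, hl 0 1⟩
    by_contra hc
    refine absurd h (not_lt.2 (le_of_lt ?_))
    by_cases he : t 0 = t 1
    · refine suf_lt_iff.2 ⟨1, by simp [Agree, he], ?_⟩
      have := hz 2 le_rfl
      simp [this]; omega
    · exact hl _ _ (by omega)
  have h10 : suf t 1 < suf t 0 ↔ ¬ t 0 < t 1 := by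
    rw [← h01, not_lt]
    exact ⟨le_of_lt, fun h => lt_of_le_of_ne h fun h => by
      have := ht.suf_injOn (by omega) (by omega) h; omega⟩
  have hr : Finset.range 3 = {0, 1, 2} := by decide
  intro i hi
  by_cases h : t 0 < t 1 <;>
  · interval_cases i <;>
      simp [crk, hr, Finset.filter_insert, Finset.filter_singleton, h20, h21, h20.not_gt, h21.not_gt,
        h01, h10, h, h0, h1, h2]

/-! ### Ranking pairs by bucket sorting -/

/-- The offset in `aTxt` of the text that is being sorted. -/
abbrev rO : ℕ := 8
/-- The length of the text that is being sorted. -/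
abbrev rL : ℕ := 9
/-- A loop counter. -/
abbrev rP : ℕ := 10
/-- A work register. -/
abbrev rQ : ℕ := 11
/-- A work register. -/
abbrev rV : ℕ := 12
/-- The texts of all recursion depths, one behind the other, each padded with three zeros. -/
abbrev aTxt : ℕ := 18
/-- At the offset of a derived text, the length of the text that it is derived from. -/
abbrev aPar : ℕ := 19
/-- The first components of the pairs to be ranked; later, the mirrored LCP array. -/
abbrev aKx : ℕ := 20
/-- The second components of the pairs to be ranked; later, the previous smaller values of the
mirrored LCP array. -/
abbrev aKy : ℕ := 21
/-- The counters of the buckets. -/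
abbrev aCnt : ℕ := 22
/-- The indices in the order of their second components. -/
abbrev aOrd : ℕ := 23
/-- The ranks of the pairs. -/
abbrev aOut : ℕ := 24
/-- For each bucket, the second component of the last visited pair in it. -/
abbrev aLy : ℕ := 25
/-- For each bucket, the rank of the last visited pair in it. -/
abbrev aLv : ℕ := 26
/-- The ranks of the suffixes of the current text. -/
abbrev aRk : ℕ := 27
/-- The ranks of the sample suffixes, at their positions in the text. -/
abbrev aSm : ℕ := 28
/-- Names for pairs of characters. -/
abbrev aNm : ℕ := 29
/-- The sums of the ranks over the passes. -/
abbrev aSum : ℕ := 30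
/-- The inverse of the ranks, that is, the suffix array with positions counted from `0`. -/
abbrev aSuf : ℕ := 31

/-- The number of indices below `N` with a key below `x`. -/
def below (N : ℕ) (f : ℕ → ℕ) (x : ℕ) : ℕ := ((Finset.range N).filter fun j => f j < x).card

/-- Cell `x` of `aCnt` gets the number of keys below `x`, for the keys in `key[0, n]`. -/
def countBelow (key : ℕ) : Cmd := block [
  forUp rP 0 (v rL + v rL + 2) (.put aCnt (v rP) 0),
  forUp rP 0 (v rL) (
    .put aCnt (get key (v rP) + 1) (get aCnt (get key (v rP) + 1) + 1)),
  forUp rP 1 (v rL + v rL + 2) (.put aCnt (v rP) (get aCnt (v rP) + get aCnt (v rP - 1)))]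

theorem run_countBelow {B W n key : ℕ} {s : State} {t : ℕ} {R : ℕ → ℕ → Prop} (hBW : B ≤ W)
    (hB : 4 * n + 16 ≤ B) (hL : s.reg rL = n) (hkey : key ≠ aCnt)
    (hk : ∀ i ≤ n, s.arr key i ≤ 2 * n + 1) :
    Run B W (countBelow key) s t (fun s' t' => t' ≤ t + 300 * (n + 1) ∧
      ∀ x ≤ 2 * n + 2, s'.arr aCnt x = below (n + 1) (s.arr key) x) R := by
  have hW1 : 1 < W := by omega
  refine Run.block_cons ?_
  refine Run.up_map 0 (2 * n + 2) 30 aCnt 0 (fun _ => 0) (by decide) (by omega) hW1 (by omega)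
    (by decide) (by simp; omega) ?_ ?_ ?_
  · intro s' hF
    have h1 := hF.1 rL (by decide)
    simp [h1, hL]; omega
  · intro i s' h1 h2 h3 hF hI
    simp [h3]; omega
  intro s₁ t₁ ht₁ _ hF₁ h₁
  have hL₁ : s₁.reg rL = n := (hF₁.1 rL (by decide)).trans hL
  have hk₁ : s₁.arr key = s.arr key := hF₁.2 key (by simp [forUp, block, Cmd.wA, hkey])
  refine Run.block_cons ?_
  refine Run.up_vc 0 n 30 (fun i s' => ∀ x ≤ 2 * n + 2, s'.arr aCnt x =
    ((Finset.range i).filter fun j => s.arr key j + 1 = x).card) (Nat.le_of_ble_eq_true rfl) (by omega) hW1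
    (by omega) (by simp [Cmd.wR]) (by simp; omega) ?_ ?_ ?_ ?_
  · intro s' hF
    simp [hF.1 rL rfl, hL₁]
  · intro x hx
    rw [State.setReg_arr, h₁]; simp; omega
  · intro i s' h1 h2 h3 hF hI
    have hk' : s'.arr key = s.arr key := (hF.2 key (by simp [forUp, block, Cmd.wA, hkey])).trans hk₁
    have hki := hk i h2
    have hc : ((Finset.range i).filter fun j => s.arr key j + 1 = s.arr key i + 1).card ≤ i :=
      (Finset.card_filter_le _ _).trans (by simp)
    have := hI (s.arr key i + 1) (by omega)
    simp +decide only [Cmd.vc, Expr.Safe, Expr.val, h3, hk', BinOp.Ok, BinOp.eval, Expr.add_def, Expr.sub_def, Expr.val_ofNat, Expr.safe_ofNat, this]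
    and_intros <;> try first | trivial | omega
    intro x hx
    simp +decide only [State.setReg_arr, State.setArr_arr, if_true, Function.update_apply,
      Finset.range_add_one, Finset.filter_insert]
    by_cases hxi : s.arr key i + 1 = x
    · subst hxi
      simp
    · rw [if_neg (Ne.symm hxi), if_neg hxi, hI x hx]
  intro s₂ t₂ ht₂ _ hF₂ h₂
  have hL₂ : s₂.reg rL = n := (hF₂.1 rL rfl).trans hL₁
  refine Run.up_vc 1 (2 * n + 2) 30 (fun i s' =>
    (∀ x < i, s'.arr aCnt x = below (n + 1) (s.arr key) x) ∧
    ∀ x, i ≤ x → s'.arr aCnt x = s₂.arr aCnt x) (by decide) (by omega) hW1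
    (by omega) (by decide) (by simp; omega) ?_ ?_ ?_ ?_
  · intro s' hF
    simp [hF.1 rL (by decide), hL₂]; omega
  · refine ⟨fun x hx => ?_, fun x _ => rfl⟩
    obtain rfl : x = 0 := by omega
    rw [State.setReg_arr, h₂ 0 (by omega)]
    simp [below]
  · intro i s' h1 h2 h3 hF hI
    have e1 := hI.1 (i - 1) (by omega)
    have e2 := (hI.2 i le_rfl).trans (h₂ i (by omega))
    have hsum : ((Finset.range (n + 1)).filter fun j => s.arr key j + 1 = i).card +
        below (n + 1) (s.arr key) (i - 1) = below (n + 1) (s.arr key) i := by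
      unfold below
      rw [← Finset.card_union_of_disjoint]
      · congr 1; ext j; simp only [Finset.mem_union, Finset.mem_filter, Finset.mem_range]; omega
      · rw [Finset.disjoint_left]; intro j; simp only [Finset.mem_filter]; omega
    have hb : below (n + 1) (s.arr key) i ≤ n + 1 :=
      (Finset.card_filter_le _ _).trans (by simp)
    simp +decide only [Cmd.vc, Expr.Safe, Expr.val, h3, BinOp.Ok, BinOp.eval, Expr.add_def, Expr.sub_def, Expr.val_ofNat, Expr.safe_ofNat, e1, e2, hsum]
    and_intros <;> try first | trivial | omega
    · intro x hx
      simp +decide only [State.setReg_arr, State.setArr_arr, if_true, Function.update_apply]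
      split
      · subst x; rfl
      · exact hI.1 x (by omega)
    · intro x hx
      simp +decide only [State.setReg_arr, State.setArr_arr, if_true, Function.update_apply]
      rw [if_neg (by omega)]
      exact hI.2 x (by omega)
  intro s₃ t₃ ht₃ _ hF₃ h₃
  exact ⟨by omega, fun x hx => h₃.1 x (by omega)⟩

/-- The position of `j` when the indices below `N` are sorted stably by `y`. -/
def stablePos (N : ℕ) (y : ℕ → ℕ) (j : ℕ) : ℕ := crk N (fun k => toLex (y k, k)) j

theorem crk_pair (N : ℕ) (x y : ℕ → ℕ) (i : ℕ) :
    crk N (fun j => toLex (x j, y j)) i = below N x (x i) +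
      ((Finset.range N).filter fun k => x k = x i ∧ y k < y i).card := by
  unfold crk below
  rw [← Finset.card_union_of_disjoint]
  · congr 1; ext j
    simp only [Finset.mem_union, Finset.mem_filter, Prod.Lex.toLex_lt_toLex]; tauto
  · rw [Finset.disjoint_left]; intro j; simp only [Finset.mem_filter]; omega

theorem stablePos_eq {N : ℕ} {y : ℕ → ℕ} {j : ℕ} (hj : j < N) : stablePos N y j =
    below N y (y j) + ((Finset.range j).filter fun k => y k = y j).card := by
  unfold stablePos
  rw [crk_pair]
  congr 2; ext k
  simp only [Finset.mem_filter, Finset.mem_range]; omega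

theorem stablePos_inj {N : ℕ} {y : ℕ → ℕ} {i j : ℕ} (hi : i < N) (hj : j < N)
    (h : stablePos N y i = stablePos N y j) : i = j := by
  have := (crk_eq_crk_iff hi hj).1 h
  simp at this
  exact this.2

theorem stablePos_lt {N : ℕ} {y : ℕ → ℕ} {j : ℕ} (hj : j < N) : stablePos N y j < N := crk_lt hj

theorem exists_stablePos (N : ℕ) (y : ℕ → ℕ) {p : ℕ} (hp : p < N) :
    ∃ j < N, stablePos N y j = p :=
  exists_crk_eq (fun i _ j _ h => by simp at h; exact h.2) hp

theorem le_of_stablePos_lt {N : ℕ} {y : ℕ → ℕ} {i j : ℕ} (hi : i < N)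
    (h : stablePos N y i < stablePos N y j) : y i ≤ y j := by
  rcases Prod.Lex.toLex_lt_toLex.1 ((crk_lt_crk_iff hi).1 h) with h | h
  · exact le_of_lt h
  · exact le_of_eq h.1

theorem stablePos_lt_of_lt {N : ℕ} {y : ℕ → ℕ} {i j : ℕ} (hi : i < N) (h : y i < y j) :
    stablePos N y i < stablePos N y j :=
  crk_lt_crk hi (Prod.Lex.toLex_lt_toLex.2 (Or.inl h))

/-- The indices `0, …, n` are put into `aOrd`, stably sorted by the keys `aKy`. -/
def sortByKy : Cmd := forUp rP 0 (v rL) (block [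
  .put aOrd (get aCnt (get aKy (v rP))) (v rP),
  .put aCnt (get aKy (v rP)) (get aCnt (get aKy (v rP)) + 1)])

theorem run_sortByKy {B W n : ℕ} {s : State} {t : ℕ} {R : ℕ → ℕ → Prop} (hBW : B ≤ W)
    (hB : 4 * n + 16 ≤ B) (hL : s.reg rL = n) (hk : ∀ i ≤ n, s.arr aKy i ≤ 2 * n + 1)
    (hc : ∀ x ≤ 2 * n + 2, s.arr aCnt x = below (n + 1) (s.arr aKy) x) :
    Run B W sortByKy s t (fun s' t' => t' ≤ t + 100 * (n + 1) ∧
      ∀ j ≤ n, s'.arr aOrd (stablePos (n + 1) (s.arr aKy) j) = j) R := by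
  have hW1 : 1 < W := by omega
  refine Run.up_vc 0 n 40 (fun i s' =>
    (∀ x ≤ 2 * n + 2, s'.arr aCnt x = below (n + 1) (s.arr aKy) x +
      ((Finset.range i).filter fun k => s.arr aKy k = x).card) ∧
    ∀ j < i, s'.arr aOrd (stablePos (n + 1) (s.arr aKy) j) = j) (by decide) (by omega) hW1
    (by omega) (by decide) (by simp; omega) ?_ ?_ ?_ ?_
  · intro s' hF
    simp [hF.1 rL rfl, hL]
  · exact ⟨fun x hx => by simp [hc x hx], fun j hj => by omega⟩
  · intro i s' h1 h2 h3 hF ⟨hI, hI'⟩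
    have hk' : s'.arr aKy = s.arr aKy := hF.2 _ rfl
    have hki := hk i h2
    have e1 := hI (s.arr aKy i) (by omega)
    rw [← stablePos_eq (by omega)] at e1
    have hlt := stablePos_lt (N := n + 1) (y := s.arr aKy) (j := i) (by omega)
    simp +decide only [block, Cmd.vc, Expr.Safe, Expr.val, h3, hk', BinOp.Ok, BinOp.eval, Expr.add_def, Expr.sub_def, Expr.val_ofNat, Expr.safe_ofNat, e1,
      State.setArr_reg, State.setArr_arr, reduceIte]
    and_intros <;> try first | trivial | omega
    · intro x hx
      simp +decide only [State.setReg_arr, State.setArr_arr, if_true, Function.update_apply,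
        Finset.range_add_one, Finset.filter_insert, reduceIte]
      by_cases hxi : x = s.arr aKy i
      · subst hxi
        have := hI (s.arr aKy i) (by omega)
        simp; omega
      · rw [if_neg hxi, if_neg (Ne.symm hxi), hI x hx]
    · intro j hj
      simp +decide only [State.setReg_arr, State.setArr_arr, Function.update_apply, reduceIte]
      by_cases hji : j = i
      · subst hji; simp
      · rw [if_neg fun h => hji (stablePos_inj (by omega) (by omega) h), hI' j (by omega)]
  · intro s' t' ht _ hF hI
    exact ⟨by omega, fun j hj => hI.2 j (by omega)⟩

/-- The indices are visited in the order of `aKy`. Cell `aLy[x]` holds the key in `aKy` of the last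
visited index with `aKx = x`, and `aLv[x]` the rank of that pair. -/
def rankInOrder : Cmd := block [
  forUp rP 0 (v rL + v rL + 2) (.put aLy (v rP) (v rL + v rL + 2)),
  forUp rP 0 (v rL) (block [
    .set rQ (get aOrd (v rP)),
    .set rV (get aKx (v rQ)),
    when (ne (get aLy (v rV)) (get aKy (v rQ))) (block [
      .put aLy (v rV) (get aKy (v rQ)),
      .put aLv (v rV) (get aCnt (v rV))]),
    .put aOut (v rQ) (get aLv (v rV)),
    .put aCnt (v rV) (get aCnt (v rV) + 1)])]

theorem run_rankInOrder {B W n : ℕ} {s : State} {t : ℕ} {R : ℕ → ℕ → Prop} (hBW : B ≤ W)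
    (hB : 4 * n + 16 ≤ B) (hL : s.reg rL = n) (hx : ∀ i ≤ n, s.arr aKx i ≤ 2 * n + 1)
    (hy : ∀ i ≤ n, s.arr aKy i ≤ 2 * n + 1)
    (hc : ∀ x ≤ 2 * n + 2, s.arr aCnt x = below (n + 1) (s.arr aKx) x)
    (ho : ∀ j ≤ n, s.arr aOrd (stablePos (n + 1) (s.arr aKy) j) = j) :
    Run B W rankInOrder s t (fun s' t' => t' ≤ t + 300 * (n + 1) ∧
      ∀ j ≤ n, s'.arr aOut j = crk (n + 1) (fun i => toLex (s.arr aKx i, s.arr aKy i)) j) R := by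
  have hW1 : 1 < W := by omega
  refine Run.block_cons ?_
  refine Run.up_map 0 (2 * n + 2) 30 aLy 0 (fun _ => 2 * n + 2) (by decide) (by omega) hW1
    (by omega) (by decide) (by simp; omega) ?_ ?_ ?_
  · intro s' hF
    have h1 := hF.1 rL (by decide)
    simp [h1, hL]; omega
  · intro i s' h1 h2 h3 hF hI
    simp [h3, hF.1 rL rfl, hL]
    and_intros <;> first | omega | (congr 1; omega)
  intro s₁ t₁ ht₁ _ hF₁ h₁
  have hL₁ : s₁.reg rL = n := (hF₁.1 rL rfl).trans hL
  have ex₁ : s₁.arr aKx = s.arr aKx := hF₁.2 _ rfl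
  have ey₁ : s₁.arr aKy = s.arr aKy := hF₁.2 _ rfl
  have ec₁ : s₁.arr aCnt = s.arr aCnt := hF₁.2 _ rfl
  have eo₁ : s₁.arr aOrd = s.arr aOrd := hF₁.2 _ rfl
  generalize hX : s.arr aKx = X at *
  generalize hY : s.arr aKy = Y at *
  let P := stablePos (n + 1) Y
  refine Run.up_vc 0 n 60 (fun p s' =>
    (∀ x ≤ 2 * n + 2, s'.arr aCnt x = below (n + 1) X x +
      ((Finset.range (n + 1)).filter fun k => P k < p ∧ X k = x).card) ∧
    (∀ j ≤ n, P j < p → s'.arr aOut j = crk (n + 1) (fun i => toLex (X i, Y i)) j) ∧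
    (∀ x ≤ 2 * n + 1, s'.arr aLy x = 2 * n + 2 ∨ ∃ j ≤ n, P j < p ∧ X j = x ∧
      s'.arr aLy x = Y j ∧ s'.arr aLv x = below (n + 1) X x +
        ((Finset.range (n + 1)).filter fun k => X k = x ∧ Y k < Y j).card) ∧
    (∀ j ≤ n, P j < p → s'.arr aLy (X j) ≤ 2 * n + 1 ∧ Y j ≤ s'.arr aLy (X j)))
    (by decide) (by omega) hW1
    (by omega) (by decide) (by simp; omega) ?_ ?_ ?_ ?_
  · intro s' hF
    simp [hF.1 rL rfl, hL₁]
  · refine ⟨fun x hx => ?_, fun j _ hj => by omega, fun x hx => Or.inl ?_, fun j _ hj => by omega⟩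
    · simp [ec₁, hc x hx]
    · rw [State.setReg_arr, h₁, if_pos (by omega)]
  · intro p s' h1 h2 h3 hF ⟨hI₁, hI₂, hI₃, hI₄⟩
    obtain ⟨i, hi, hip⟩ := exists_stablePos (n + 1) Y (p := p) (by omega)
    have hi' : i ≤ n := by omega
    have hip' : P i = p := hip
    have ex : s'.arr aKx = X := (hF.2 _ rfl).trans ex₁
    have ey : s'.arr aKy = Y := (hF.2 _ rfl).trans ey₁
    have eo : s'.arr aOrd p = i := by
      rw [show s'.arr aOrd = s.arr aOrd from (hF.2 _ rfl).trans eo₁, ← hip, ho i hi']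
    have hxi := hx i hi'
    have hyi := hy i hi'
    have hcnt := hI₁ (X i) (by omega)
    have hle : below (n + 1) X (X i) +
        ((Finset.range (n + 1)).filter fun k => P k < p ∧ X k = X i).card ≤ n := by
      have : ((Finset.range (n + 1)).filter fun k => X k < X i ∨ (P k < p ∧ X k = X i)).card <
          (Finset.range (n + 1)).card := by
        refine Finset.card_lt_card (Finset.ssubset_iff_of_subset (Finset.filter_subset _ _) |>.2
          ⟨i, by simpa using hi, by simp [hip']⟩)
      unfold below
      rw [← Finset.card_union_of_disjoint, ← Finset.filter_or]
      · simp at this; omega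
      · rw [Finset.disjoint_left]; intro j; simp only [Finset.mem_filter]; omega
    have hstep : ∀ k ≤ n, P k < p + 1 ↔ P k < p ∨ k = i := by
      intro k hk
      constructor
      · intro h
        by_cases h' : P k < p
        · exact Or.inl h'
        · exact Or.inr (stablePos_inj (N := n + 1) (y := Y) (by omega) hi (by
            change P k = P i; omega))
      · rintro (h | rfl) <;> omega
    have hcount : ∀ x, ((Finset.range (n + 1)).filter fun k => P k < p + 1 ∧ X k = x).card =
        ((Finset.range (n + 1)).filter fun k => P k < p ∧ X k = x).card +
          if x = X i then 1 else 0 := by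
      intro x
      by_cases hxx : x = X i
      · rw [if_pos hxx, ← Finset.card_insert_of_notMem (a := i) (by simp [hip'])]
        congr 1; ext k
        simp only [Finset.mem_filter, Finset.mem_insert, Finset.mem_range]
        constructor
        · rintro ⟨hk, hk', hk''⟩
          rcases (hstep k (by omega)).1 hk' with h | h
          · exact Or.inr ⟨hk, h, hk''⟩
          · exact Or.inl h
        · rintro (rfl | ⟨hk, hk', hk''⟩)
          · exact ⟨hi, by omega, hxx.symm⟩
          · exact ⟨hk, by omega, hk''⟩
      · rw [if_neg hxx]
        refine (congrArg Finset.card (Finset.ext fun k => ?_)).trans (Nat.add_zero _).symm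
        simp only [Finset.mem_filter, Finset.mem_range]
        constructor
        · rintro ⟨hk, hk', hk''⟩
          rcases (hstep k (by omega)).1 hk' with h | h
          · exact ⟨hk, h, hk''⟩
          · subst h; exact absurd hk''.symm hxx
        · rintro ⟨hk, hk', hk''⟩
          exact ⟨hk, by omega, hk''⟩
    -- the rank of the pair `(X i, Y i)`, if this is the first visit to it
    have hnew : s'.arr aLy (X i) ≠ Y i →
        ((Finset.range (n + 1)).filter fun k => P k < p ∧ X k = X i).card =
        ((Finset.range (n + 1)).filter fun k => X k = X i ∧ Y k < Y i).card := by
      intro hne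
      congr 1; ext k
      simp only [Finset.mem_filter, Finset.mem_range]
      refine and_congr_right fun hk => ?_
      constructor
      · rintro ⟨hk', hk''⟩
        refine ⟨hk'', lt_of_le_of_ne
          (le_of_stablePos_lt (N := n + 1) (y := Y) hk (by rw [hip]; exact hk')) fun he => hne ?_⟩
        have h4 := hI₄ k (by omega) hk'
        rw [hk'', he] at h4
        rcases hI₃ (X i) hxi with h5 | ⟨j, hj, hjp, -, h5, -⟩
        · omega
        · have := le_of_stablePos_lt (N := n + 1) (y := Y) (i := j) (j := i) (by omega)
            (by rw [hip]; exact hjp)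
          omega
      · rintro ⟨hk', hk''⟩
        have := stablePos_lt_of_lt (N := n + 1) (y := Y) hk hk''
        rw [hip] at this
        exact ⟨this, hk'⟩
    have hrank : crk (n + 1) (fun i => toLex (X i, Y i)) i = below (n + 1) X (X i) +
      ((Finset.range (n + 1)).filter fun k => X k = X i ∧ Y k < Y i).card := crk_pair _ _ _ _
    simp +decide only [block, when, Cmd.vc, Expr.Safe, Expr.val, h3, ex, ey, eo, hcnt, BinOp.Ok, BinOp.eval, Expr.add_def, Expr.sub_def, Expr.val_ofNat, Expr.safe_ofNat,
      State.setArr_reg, State.setArr_arr, State.setReg_reg, State.setReg_arr, reduceIte, Function.update_self]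
    and_intros <;> try first | trivial | omega
    · intro hne
      have hne' : s'.arr aLy (X i) ≠ Y i := fun h => by simp [h] at hne
      and_intros <;> try first | trivial | omega
      · intro x hx
        simp only [Function.update_apply, hcount]
        split
        · subst x; omega
        · rw [hI₁ x hx]; rfl
      · intro j hj hjp
        simp only [Function.update_apply]
        by_cases hji : j = i
        · rw [if_pos hji, hji, hrank, hnew hne']
        · rw [if_neg hji]
          exact hI₂ j hj (by have := (hstep j hj).1 hjp; tauto)
      · intro x hx
        simp only [Function.update_apply]
        by_cases hxx : x = X i
        · refine Or.inr ⟨i, hi', by omega, hxx.symm, ?_, ?_⟩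
          · rw [if_pos hxx]
          · rw [if_pos hxx, hxx, hnew hne']
        · rw [if_neg hxx, if_neg hxx]
          rcases hI₃ x hx with h | ⟨j, hj, hjp, h⟩
          · exact Or.inl h
          · exact Or.inr ⟨j, hj, by omega, h⟩
      · intro j hj hjp
        simp only [Function.update_apply]
        rcases (hstep j hj).1 hjp with h | rfl
        · have h4 := hI₄ j hj h
          split
          · exact ⟨by omega, le_of_stablePos_lt (N := n + 1) (y := Y) (by omega)
              (by rw [hip]; exact h)⟩
          · exact h4
        · simp; omega
    · intro hne
      have heq : s'.arr aLy (X i) = Y i := by by_contra h; simp [h] at hne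
      obtain ⟨j₀, hj₀, hjp₀, hX₀, hY₀, hv₀⟩ : ∃ j ≤ n, P j < p ∧ X j = X i ∧
          s'.arr aLy (X i) = Y j ∧ s'.arr aLv (X i) = below (n + 1) X (X i) +
          ((Finset.range (n + 1)).filter fun k => X k = X i ∧ Y k < Y j).card := by
        rcases hI₃ (X i) hxi with h | h
        · omega
        · exact h
      rw [← hY₀, heq] at hv₀
      have hle' : below (n + 1) X (X i) +
        ((Finset.range (n + 1)).filter fun k => X k = X i ∧ Y k < Y i).card < n + 1 := by
        rw [← hrank]; exact crk_lt hi
      and_intros <;> try first | trivial | omega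
      · intro x hx
        simp only [Function.update_apply, hcount]
        split
        · subst x; omega
        · rw [hI₁ x hx]; rfl
      · intro j hj hjp
        simp only [Function.update_apply]
        by_cases hji : j = i
        · rw [if_pos hji, hji, hrank, hv₀]
        · rw [if_neg hji]
          exact hI₂ j hj (by have := (hstep j hj).1 hjp; tauto)
      · intro x hx
        rcases hI₃ x hx with h | ⟨j, hj, hjp, h⟩
        · exact Or.inl h
        · exact Or.inr ⟨j, hj, by omega, h⟩
      · intro j hj hjp
        rcases (hstep j hj).1 hjp with h | rfl
        · exact hI₄ j hj h
        · omega
  · intro s' t' ht _ hF hI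
    exact ⟨by omega, fun j hj => hI.2.1 j hj (by have := stablePos_lt (N := n + 1) (y := Y) (j := j) (by omega); omega)⟩

/-- The states agree up to the scratch registers and arrays of the ranking procedure. -/
def Scratch (s s' : State) : Prop :=
  (∀ r, r < 10 ∨ 12 < r → s'.reg r = s.reg r) ∧ ∀ a, a < 20 ∨ 26 < a → s'.arr a = s.arr a

theorem Scratch.trans {s s' s'' : State} (h : Scratch s s') (h' : Scratch s' s'') :
    Scratch s s'' :=
  ⟨fun r hr => (h'.1 r hr).trans (h.1 r hr), fun a ha => (h'.2 a ha).trans (h.2 a ha)⟩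

theorem Frame.scratch {c : Cmd} {s s' : State} (h : Frame c s s')
    (hr : ∀ r, r < 10 ∨ 12 < r → c.wR r = false) (ha : ∀ a, a < 20 ∨ 26 < a → c.wA a = false) :
    Scratch s s' :=
  ⟨fun r h' => h.1 r (hr r h'), fun a h' => h.2 a (ha a h')⟩

/-- The pairs `(ex, ey)` of values for `rP = 0, …, n` are ranked lexicographically. -/
def pairRank (ex ey : Expr) : Cmd := block [
  forUp rP 0 (v rL) (.put aKx (v rP) ex),
  forUp rP 0 (v rL) (.put aKy (v rP) ey),
  countBelow aKy, sortByKy, countBelow aKx, rankInOrder]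

theorem pairRank_wR (ex ey : Expr) (r : ℕ) (hr : r < 10 ∨ 12 < r) :
    (pairRank ex ey).wR r = false := by
  simp [pairRank, countBelow, sortByKy, rankInOrder, block, when, forUp, Cmd.wR, rP, rQ, rV]; omega

theorem pairRank_wA (ex ey : Expr) (a : ℕ) (ha : a < 20 ∨ 26 < a) :
    (pairRank ex ey).wA a = false := by
  simp [pairRank, countBelow, sortByKy, rankInOrder, block, when, forUp, Cmd.wA, aKx, aKy, aCnt, aOrd, aOut, aLy, aLv]; omega

theorem run_pairRank {B W n : ℕ} {s : State} {t : ℕ} {R : ℕ → ℕ → Prop} {ex ey : Expr}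
    (X Y : ℕ → ℕ) (hBW : B ≤ W) (hB : 4 * n + 16 ≤ B) (hL : s.reg rL = n)
    (hcx : ex.cost ≤ 60) (hcy : ey.cost ≤ 60)
    (hX : ∀ i ≤ n, X i ≤ 2 * n + 1) (hY : ∀ i ≤ n, Y i ≤ 2 * n + 1)
    (hx : ∀ i ≤ n, ∀ s', s'.reg rP = i → Scratch s s' → ex.Safe B W s' ∧ ex.val s' = X i)
    (hy : ∀ i ≤ n, ∀ s', s'.reg rP = i → Scratch s s' → ey.Safe B W s' ∧ ey.val s' = Y i) :
    Run B W (pairRank ex ey) s t (fun s' t' => t' ≤ t + 2000 * (n + 1) ∧ Scratch s s' ∧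
      ∀ j ≤ n, s'.arr aOut j = crk (n + 1) (fun i => toLex (X i, Y i)) j) R := by
  have hW1 : 1 < W := by omega
  refine Run.post (Q := fun s' t' => (t' ≤ t + 2000 * (n + 1) ∧
      ∀ j ≤ n, s'.arr aOut j = crk (n + 1) (fun i => toLex (X i, Y i)) j) ∧
      Frame (pairRank ex ey) s s') (Run.frame ?_)
    fun s' t' h => ⟨h.1.1, h.2.scratch (pairRank_wR ex ey) (pairRank_wA ex ey), h.1.2⟩
  have sc : ∀ a e, (19 < a ∧ a < 27) → ∀ s s', Frame (forUp rP 0 (v rL) (.put a (v rP) e)) s s' →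
      Scratch s s' := by
    intro a e ha s s' h
    refine h.scratch (fun r hr => ?_) (fun a' ha' => ?_)
    · simp [forUp, block, Cmd.wR, rP]; omega
    · simp [forUp, block, Cmd.wA]; omega
  refine Run.block_cons ?_
  refine Run.up_map 0 n 80 aKx 0 X (by change 1 + ex.cost + 1 + 1 + 1 + 8 ≤ 80; omega) (by omega) hW1
    (by omega) rfl (by simp; omega) ?_ ?_ ?_
  · intro s' hF
    simp [hF.1 rL rfl, hL]
  · intro i s' h1 h2 h3 hF hI
    have := hx i h2 s' h3 (sc _ _ (by decide) _ _ hF)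
    simp [h3, this]; omega
  intro s₁ t₁ ht₁ _ hF₁ h₁
  have hL₁ : s₁.reg rL = n := (hF₁.1 rL rfl).trans hL
  have hs₁ := sc _ _ (by decide) _ _ hF₁
  refine Run.block_cons ?_
  refine Run.up_map 0 n 80 aKy 0 Y (by change 1 + ey.cost + 1 + 1 + 1 + 8 ≤ 80; omega) (by omega) hW1
    (by omega) rfl (by simp; omega) ?_ ?_ ?_
  · intro s' hF
    simp [hF.1 rL rfl, hL₁]
  · intro i s' h1 h2 h3 hF hI
    have := hy i h2 s' h3 (hs₁.trans (sc _ _ (by decide) _ _ hF))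
    simp [h3, this]; omega
  intro s₂ t₂ ht₂ _ hF₂ h₂
  have hL₂ : s₂.reg rL = n := (hF₂.1 rL rfl).trans hL₁
  have ex₂ : ∀ i ≤ n, s₂.arr aKx i = X i := by
    intro i hi
    rw [hF₂.2 aKx rfl, h₁, if_pos (by omega), Nat.sub_zero]
  have ey₂ : ∀ i ≤ n, s₂.arr aKy i = Y i := by
    intro i hi
    rw [h₂, if_pos (by omega), Nat.sub_zero]
  refine Run.block_cons ?_
  refine (run_countBelow hBW hB hL₂ (by decide) fun i hi => by
    rw [ey₂ i hi]; exact hY i hi).frame.post ?_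
  rintro s₃ t₃ ⟨⟨ht₃, h₃⟩, hF₃⟩
  have hL₃ : s₃.reg rL = n := (hF₃.1 rL rfl).trans hL₂
  have ex₃ : s₃.arr aKx = s₂.arr aKx := hF₃.2 _ rfl
  have ey₃ : s₃.arr aKy = s₂.arr aKy := hF₃.2 _ rfl
  refine Run.block_cons ?_
  refine (run_sortByKy hBW hB hL₃ (fun i hi => by
    rw [ey₃, ey₂ i hi]; exact hY i hi) (by rw [ey₃]; exact h₃)).frame.post ?_
  rintro s₄ t₄ ⟨⟨ht₄, h₄⟩, hF₄⟩
  have hL₄ : s₄.reg rL = n := (hF₄.1 rL rfl).trans hL₃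
  have ex₄ : s₄.arr aKx = s₂.arr aKx := (hF₄.2 _ rfl).trans ex₃
  have ey₄ : s₄.arr aKy = s₂.arr aKy := (hF₄.2 _ rfl).trans ey₃
  refine Run.block_cons ?_
  refine (run_countBelow hBW hB hL₄ (by decide) fun i hi => by
    rw [ex₄, ex₂ i hi]; exact hX i hi).frame.post ?_
  rintro s₅ t₅ ⟨⟨ht₅, h₅⟩, hF₅⟩
  have hL₅ : s₅.reg rL = n := (hF₅.1 rL rfl).trans hL₄
  have ex₅ : s₅.arr aKx = s₂.arr aKx := (hF₅.2 _ rfl).trans ex₄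
  have ey₅ : s₅.arr aKy = s₂.arr aKy := (hF₅.2 _ rfl).trans ey₄
  have eo₅ : s₅.arr aOrd = s₄.arr aOrd := hF₅.2 _ rfl
  refine (run_rankInOrder hBW hB hL₅ (fun i hi => by rw [ex₅, ex₂ i hi]; exact hX i hi)
    (fun i hi => by rw [ey₅, ey₂ i hi]; exact hY i hi)
    (by rw [ex₅, ← ex₄]; exact h₅) (by rw [eo₅, ey₅, ← ey₃]; exact h₄)).post ?_
  rintro s₆ t₆ ⟨ht₆, h₆⟩
  refine ⟨by simp only [Nat.sub_zero] at ht₁ ht₂; linarith, fun j hj => ?_⟩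
  rw [h₆ j hj, ex₅, ey₅, crk_pair, crk_pair]
  unfold below
  rw [ex₂ j hj, ey₂ j hj]
  congr 1 <;>
  · refine congrArg Finset.card (Finset.filter_congr fun k hk => ?_)
    have hk' : k ≤ n := by simp at hk; omega
    simp only [ex₂ k hk', ey₂ k hk']

/-! ### Suffix sorting on the machine -/

/-- Names for the prefixes of length `2`. -/
noncomputable def names2 (n : ℕ) (t : ℕ → ℕ) : ℕ → ℕ := crk (n + 1) fun i => toLex (t i, t (i + 1))

/-- Names for the prefixes of length `3`. -/
noncomputable def names3 (n : ℕ) (t : ℕ → ℕ) : ℕ → ℕ :=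
  crk (n + 1) fun i => toLex (names2 n t i, t (i + 2))

theorem isName_names2 (n t) : IsName n t 2 (names2 n t) := (isName_one n t).ext

theorem isName_names3 (n t) : IsName n t 3 (names3 n t) := (isName_names2 n t).ext

theorem names2_le {n t i} (hi : i ≤ n) : names2 n t i ≤ n :=
  Nat.lt_succ_iff.1 (crk_lt (by omega))

theorem names3_le {n t i} (hi : i ≤ n) : names3 n t i ≤ n :=
  Nat.lt_succ_iff.1 (crk_lt (by omega))

/-- Array `dst[0, n]` gets the ranks found by `pairRank`. -/
def copyOut (dst : ℕ) : Cmd := forUp rP 0 (v rL) (.put dst (v rP) (get aOut (v rP)))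

theorem run_copyOut {B W n dst : ℕ} {s : State} {t : ℕ} {R : ℕ → ℕ → Prop} (hBW : B ≤ W)
    (hB : 4 * n + 16 ≤ B) (hL : s.reg rL = n) (hd : dst ≠ aOut) :
    Run B W (copyOut dst) s t (fun s' t' => t' ≤ t + 100 * (n + 1) ∧
      ∀ j ≤ n, s'.arr dst j = s.arr aOut j) R := by
  have hW1 : 1 < W := by omega
  refine Run.up_map 0 n 30 dst 0 (s.arr aOut) (Nat.le_of_ble_eq_true rfl) (by omega) hW1 (by omega)
    rfl (by simp; omega) ?_ ?_ ?_
  · intro s' hF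
    simp [hF.1 rL rfl, hL]
  · intro i s' h1 h2 h3 hF hI
    have : s'.arr aOut = s.arr aOut := hF.2 aOut (by simp [forUp, block, Cmd.wA]; exact hd.symm)
    simp [h3, this]; omega
  · intro s' t' ht _ hF h
    refine ⟨by simp only [Nat.sub_zero] at ht; linarith, fun j hj => ?_⟩
    rw [h, if_pos (by omega), Nat.sub_zero]

/-- Names for triples are computed, and the derived text is written behind the current one; it
becomes the current text. The length of the former is kept in `aPar`, at the offset of the latter. -/
def levelDown : Cmd := block [
  pairRank (get aTxt (v rO + v rP)) (get aTxt (v rO + v rP + 1)),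
  copyOut aNm,
  pairRank (get aNm (v rP)) (get aTxt (v rO + v rP + 2)),
  forUp rP 0 (v rL - .bin .div (v rL) 3 - 1) (
    .ite (lt (v rP) (.bin .div (v rL + 2) 3))
      (.put aTxt (v rO + v rL + 3 + v rP) (get aOut (v rP + v rP + v rP + 1) + 1))
      (.put aTxt (v rO + v rL + 3 + v rP)
        (get aOut (.bin .mul 3 (v rP - .bin .div (v rL + 2) 3) + 2) + 1))),
  .put aPar (v rO + v rL + 3) (v rL),
  .set rO (v rO + v rL + 3),
  .set rL (v rL - .bin .div (v rL) 3)]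

theorem run_levelDown {B W o n : ℕ} {T : ℕ → ℕ} {s : State} {t : ℕ} {R : ℕ → ℕ → Prop}
    (hBW : B ≤ W) (hB : o + 4 * n + 16 ≤ B) (hn : 3 ≤ n) (hO : s.reg rO = o) (hL : s.reg rL = n)
    (hT : IsTxt n T) (hs : ∀ i ≤ n + 2, s.arr aTxt (o + i) = T i) :
    Run B W levelDown s t (fun s' t' => t' ≤ t + 5000 * (n + 1) ∧
      s'.reg rO = o + n + 3 ∧ s'.reg rL = childLen n ∧
      s'.arr aPar = Function.update (s.arr aPar) (o + n + 3) n ∧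
      ∀ j, s'.arr aTxt j = if o + n + 3 ≤ j ∧ j < o + n + 3 + childLen n then
        childTxt n (names3 n T) (j - (o + n + 3)) else s.arr aTxt j) R := by
  have hW1 : 1 < W := by omega
  refine Run.block_cons ?_
  refine (run_pairRank T (fun i => T (i + 1)) hBW (by omega) hL (by decide) (by decide)
    (fun i _ => (hT.le' i).trans (by omega)) (fun i _ => (hT.le' _).trans (by omega))
    ?_ ?_).post ?_
  · intro i hi s' hP hF
    have := hs i (by omega)
    simp [hP, hF.1 rO (by decide), hF.2 aTxt (by decide), hO, this]; omega
  · intro i hi s' hP hF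
    have := hs (i + 1) (by omega)
    simp [hP, hF.1 rO (by decide), hF.2 aTxt (by decide), hO, ← this, Nat.add_assoc]; omega
  rintro s₁ t₁ ⟨ht₁, hF₁, h₁⟩
  have hL₁ : s₁.reg rL = n := (hF₁.1 rL (by decide)).trans hL
  refine Run.block_cons ?_
  refine (run_copyOut hBW (by omega) hL₁ (by decide)).frame.post ?_
  rintro s₂ t₂ ⟨⟨ht₂, h₂⟩, hF₂⟩
  have hL₂ : s₂.reg rL = n := (hF₂.1 rL rfl).trans hL₁
  have hO₂ : s₂.reg rO = o := (hF₂.1 rO rfl).trans ((hF₁.1 rO (by decide)).trans hO)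
  have hT₂ : s₂.arr aTxt = s.arr aTxt := (hF₂.2 aTxt rfl).trans (hF₁.2 aTxt (by decide))
  have hN₂ : ∀ i ≤ n, s₂.arr aNm i = names2 n T i := fun i hi => by rw [h₂ i hi, h₁ i hi]; rfl
  refine Run.block_cons ?_
  refine (run_pairRank (names2 n T) (fun i => T (i + 2)) hBW (by omega) hL₂ (by decide) (by decide)
    (fun i hi => (names2_le hi).trans (by omega)) (fun i _ => (hT.le' _).trans (by omega))
    ?_ ?_).post ?_
  · intro i hi s' hP hF
    simp [hP, hF.2 aNm (by decide), hN₂ i hi]; omega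
  · intro i hi s' hP hF
    have := hs (i + 2) (by omega)
    simp [hP, hF.1 rO (by decide), hF.2 aTxt (by decide), hO₂, hT₂, ← this, Nat.add_assoc]; omega
  rintro s₃ t₃ ⟨ht₃, hF₃, h₃⟩
  have hL₃ : s₃.reg rL = n := (hF₃.1 rL (by decide)).trans hL₂
  have hO₃ : s₃.reg rO = o := (hF₃.1 rO (by decide)).trans hO₂
  have hT₃ : s₃.arr aTxt = s.arr aTxt := (hF₃.2 aTxt (by decide)).trans hT₂
  have hP₃ : s₃.arr aPar = s.arr aPar := (hF₃.2 aPar (by decide)).trans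
    ((hF₂.2 aPar rfl).trans (hF₁.2 aPar (by decide)))
  have h₃' : ∀ i ≤ n, s₃.arr aOut i = names3 n T i := h₃
  have hc : childLen n = n - n / 3 := rfl
  refine Run.block_cons ?_
  refine Run.up_map 0 (childLen n - 1) 60 aTxt (o + n + 3) (childTxt n (names3 n T)) (by decide)
    (by omega) hW1 (by omega) rfl (by simp; omega) ?_ ?_ ?_
  · intro s' hF
    simp [hF.1 rL rfl, hL₃, childLen]; omega
  · intro i s' h1 h2 h3 hF hI
    have hi : i < childLen n := by omega
    have hle := names3_le (t := T) (childPos_le hi)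
    have hpos := childPos_le hi
    have hout : s'.arr aOut = s₃.arr aOut := hF.2 _ rfl
    have hval : childTxt n (names3 n T) i = s'.arr aOut (childPos n i) + 1 := by
      rw [hout, h₃' _ (childPos_le hi)]; simp [childTxt, hi]
    have hle' : s'.arr aOut (childPos n i) ≤ n := by rw [hout, h₃' _ hpos]; exact hle
    rw [hval]
    by_cases hlt : i < (n + 2) / 3
    · have hp : childPos n i = i + i + i + 1 := by rw [childPos, if_pos hlt]; omega
      rw [hp] at hle' hpos ⊢
      simp [h3, hF.1 rL rfl, hL₃, hF.1 rO rfl, hO₃, hlt]; omega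
    · have hp : childPos n i = 3 * (i - (n + 2) / 3) + 2 := by rw [childPos, if_neg hlt]
      rw [hp] at hle' hpos ⊢
      simp [h3, hF.1 rL rfl, hL₃, hF.1 rO rfl, hO₃, hlt]; omega
  intro s₄ t₄ ht₄ _ hF₄ h₄
  have hL₄ : s₄.reg rL = n := (hF₄.1 rL rfl).trans hL₃
  have hO₄ : s₄.reg rO = o := (hF₄.1 rO rfl).trans hO₃
  have hP₄ : s₄.arr aPar = s.arr aPar := (hF₄.2 aPar rfl).trans hP₃
  refine Run.of_vc hW1 ?_
  simp only [block, Cmd.vc]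
  simp only [Expr.Safe, Expr.val, BinOp.Ok, BinOp.eval, Expr.add_def, Expr.sub_def, Expr.val_ofNat,
    Expr.safe_ofNat, hL₄, hO₄, State.setArr_reg, State.setArr_arr, State.setReg_reg,
    State.setReg_arr, reduceIte]
  simp +decide only [hL₄, hO₄, hP₄, reduceIte]
  and_intros <;> try first | trivial | omega
  intro t' ht'
  have hcost : Cmd.cost (block [.put aPar (v rO + v rL + 3) (v rL), .set rO (v rO + v rL + 3),
    .set rL (v rL - .bin .div (v rL) 3)]) ≤ 30 := by decide
  have ht'' := ht'.trans (Nat.add_le_add_left hcost _)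
  simp only [Nat.sub_zero] at ht₄
  have hcn : childLen n - 1 ≤ n := by omega
  refine ⟨by linarith, trivial, rfl, trivial, fun j => ?_⟩
  rw [h₄ j, hT₃]
  have : (o + n + 3 + 0 ≤ j ∧ j ≤ o + n + 3 + (childLen n - 1)) ↔
    (o + n + 3 ≤ j ∧ j < o + n + 3 + childLen n) := by omega
  simp only [this]

/-- `x` if `c` is `1`, and `y` if `c` is `0`. -/
def select (c x y : Expr) : Expr := .bin .add (.bin .mul c x) (.bin .mul (1 - c) y)

/-- The ranks found in the pass of shift `δ` are added to `aSum`. -/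
def pass (δ : ℕ) (e : Expr) : Cmd := block [
  pairRank (select (eq ((v rP + .const δ) % 3) 0) (v rL + v rL + 1) e)
    (get aSm (v rP + .const δ)),
  forUp rP 0 (v rL) (
    .put aSum (v rP) (get aSum (v rP) + select (eq ((v rP + .const δ) % 3) 0) 0 (get aOut (v rP))))]

theorem run_pass {B W n δ : ℕ} {e : Expr} {D S : ℕ → ℕ} {s : State} {t : ℕ} {R : ℕ → ℕ → Prop}
    (hBW : B ≤ W) (hB : 10 * n + 16 ≤ B) (hδ : δ ≤ 2) (hL : s.reg rL = n) (hc : e.cost ≤ 10)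
    (hD : ∀ i ≤ n, D i ≤ 2 * n)
    (he : ∀ i ≤ n, ∀ s', s'.reg rP = i → Scratch s s' → e.Safe B W s' ∧ e.val s' = D i)
    (hS : ∀ i ≤ n + 2, s.arr aSm i = S i) (hS' : ∀ i, S i ≤ n)
    (hA : ∀ i ≤ n, s.arr aSum i ≤ 2 * n) :
    Run B W (pass δ e) s t (fun s' t' => t' ≤ t + 3000 * (n + 1) ∧
      ∀ j ≤ n, s'.arr aSum j = s.arr aSum j + passPart n δ D S j) R := by
  have hW1 : 1 < W := by omega
  have cost_eq : ∀ x, (select (eq ((v rP + .const δ) % 3) 0) x e).cost = x.cost + e.cost + 19 := by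
    intro x
    change (1 + 1 + 1 + 1 + 1 + 1 + 1) + x.cost + 1 + (1 + (1 + 1 + 1 + 1 + 1 + 1 + 1) + 1 + e.cost + 1) + 1 = _
    omega
  refine Run.block_cons ?_
  refine (run_pairRank (fun i => if (i + δ) % 3 = 0 then 2 * n + 1 else D i) (fun i => S (i + δ))
    hBW (by omega) hL ?_ (Nat.le_of_ble_eq_true rfl)
    (fun i hi => ?_) (fun i _ => (hS' _).trans (by omega)) ?_ ?_).post ?_
  · rw [cost_eq]
    change 1 + 1 + 1 + 1 + 1 + e.cost + 19 ≤ 60; omega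
  · have := hD i hi
    split <;> omega
  · intro i hi s' hP hF
    have h1 := he i hi s' hP hF
    have h2 := hD i hi
    have h3 : s'.reg rL = n := (hF.1 rL (by decide)).trans hL
    by_cases hm : (i + δ) % 3 = 0
    · simp [select, hP, hm, h1, h3]; omega
    · simp [select, hP, hm, h1, h3]; omega
  · intro i hi s' hP hF
    have := hS (i + δ) (by omega)
    simp [hP, hF.2 aSm (by decide), this]; omega
  rintro s₁ t₁ ⟨ht₁, hF₁, h₁⟩
  have hL₁ : s₁.reg rL = n := (hF₁.1 rL (by decide)).trans hL
  have hA₁ : s₁.arr aSum = s.arr aSum := hF₁.2 aSum (by decide)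
  refine Run.up_map 0 n 60 aSum 0 (fun i => s.arr aSum i + passPart n δ D S i)
    (Nat.le_of_ble_eq_true rfl) (by omega) hW1 (by omega) rfl (by simp; omega) ?_ ?_ ?_
  · intro s' hF
    simp [hF.1 rL rfl, hL₁]
  · intro i s' h1 h2 h3 hF hI
    have h4 : s'.arr aSum i = s.arr aSum i := by rw [hI, if_neg (by omega), hA₁]
    have h5 : s'.arr aOut i = crk (n + 1) (passKey n δ D S) i := by
      rw [show s'.arr aOut = s₁.arr aOut from hF.2 _ rfl, h₁ i h2]; rfl
    have h6 : crk (n + 1) (passKey n δ D S) i < n + 1 := crk_lt (by omega)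
    have h7 := hA i h2
    by_cases hm : (i + δ) % 3 = 0
    · simp [select, h3, hm, h4, h5, passPart]; omega
    · simp [select, h3, hm, h4, h5, passPart]; omega
  · intro s' t' ht _ hF h
    refine ⟨by simp only [Nat.sub_zero] at ht; linarith, fun j hj => ?_⟩
    rw [h, if_pos (by omega), Nat.sub_zero]

theorem passPart_le {n δ D S i} (hi : i ≤ n) : passPart n δ D S i ≤ n := by
  unfold passPart
  split
  · omega
  · exact Nat.lt_succ_iff.1 (crk_lt (by omega))

/-- The ranks in `aRk` for the derived text are transported to the sample positions. -/
def loadSample : Cmd := forUp rP 0 (v rL + 2) (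
  .ite (lt (v rL) (v rP)) (.put aSm (v rP) 0) (
  .ite (eq (v rP % 3) 1) (.put aSm (v rP) (get aRk (.bin .div (v rP) 3))) (
  .ite (eq (v rP % 3) 2)
    (.put aSm (v rP) (get aRk (.bin .div (v rL + 2) 3 + .bin .div (v rP) 3)))
    (.put aSm (v rP) 0))))

theorem run_loadSample {B W n : ℕ} {s : State} {t : ℕ} {R : ℕ → ℕ → Prop} (hBW : B ≤ W)
    (hB : 4 * n + 16 ≤ B) (hL : s.reg rL = n) :
    Run B W loadSample s t (fun s' t' => t' ≤ t + 300 * (n + 1) ∧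
      ∀ i ≤ n + 2, s'.arr aSm i = sampleRank n (s.arr aRk) i) R := by
  have hW1 : 1 < W := by omega
  refine Run.up_map 0 (n + 2) 60 aSm 0 (sampleRank n (s.arr aRk)) (by decide) (by omega) hW1
    (by omega) rfl (by simp; omega) ?_ ?_ ?_
  · intro s' hF
    simp [hF.1 rL rfl, hL]; omega
  · intro i s' h1 h2 h3 hF hI
    have hrk : s'.arr aRk = s.arr aRk := hF.2 aRk rfl
    have h4 : s'.reg rL = n := (hF.1 rL rfl).trans hL
    unfold sampleRank
    by_cases hin : n < i
    · simp [h3, h4, hin]; omega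
    by_cases hi1 : i % 3 = 1
    · simp [h3, h4, hin, hi1, hrk]; omega
    by_cases hi2 : i % 3 = 2
    · simp [h3, h4, hin, hi2, hrk]; omega
    · simp [h3, h4, hin, hi1, hi2]; omega
  · intro s' t' ht _ hF h
    refine ⟨by simp only [Nat.sub_zero] at ht; linarith, fun i hi => ?_⟩
    rw [h, if_pos (by omega), Nat.sub_zero]

/-- The ranks are computed from the sums in `aSum` and the ranks within the classes. -/
def storeRanks : Cmd := forUp rP 0 (v rL) (
  .ite (eq (v rP % 3) 0) (.put aRk (v rP) (get aSum (v rP) - get aOut (v rP))) (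
  .ite (eq (v rP % 3) 1)
    (.put aRk (v rP) (get aSum (v rP) + (.bin .div (v rL) 3 + 1) - get aOut (v rP)))
    (.put aRk (v rP) (get aSum (v rP) + (.bin .div (v rL) 3 + 1 + .bin .div (v rL + 2) 3) -
      get aOut (v rP)))))

theorem run_storeRanks {B W n : ℕ} {s : State} {t : ℕ} {R : ℕ → ℕ → Prop} (hBW : B ≤ W)
    (hB : 10 * n + 16 ≤ B) (hL : s.reg rL = n) (hA : ∀ i ≤ n, s.arr aSum i ≤ 2 * n) :
    Run B W storeRanks s t (fun s' t' => t' ≤ t + 200 * (n + 1) ∧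
      ∀ i ≤ n, s'.arr aRk i = s.arr aSum i + classOffset n (i % 3) - s.arr aOut i) R := by
  have hW1 : 1 < W := by omega
  refine Run.up_map 0 n 60 aRk 0 (fun i => s.arr aSum i + classOffset n (i % 3) - s.arr aOut i)
    (by decide) (by omega) hW1 (by omega) rfl (by simp; omega) ?_ ?_ ?_
  · intro s' hF
    simp [hF.1 rL rfl, hL]
  · intro i s' h1 h2 h3 hF hI
    have h4 : s'.reg rL = n := (hF.1 rL rfl).trans hL
    have h5 : s'.arr aSum = s.arr aSum := hF.2 aSum rfl
    have h6 : s'.arr aOut = s.arr aOut := hF.2 aOut rfl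
    have h8 := hA i h2
    unfold classOffset
    clear hI hF hA
    by_cases h9 : i % 3 = 0
    · simp [h3, h5, h6, h9]; omega
    by_cases h10 : i % 3 = 1
    · simp [h3, h4, h5, h6, h10]; omega
    · simp [h3, h4, h5, h6, h9, h10]; omega
  · intro s' t' ht _ hF h
    refine ⟨by simp only [Nat.sub_zero] at ht; linarith, fun i hi => ?_⟩
    rw [h, if_pos (by omega), Nat.sub_zero]

/-- From the ranks in `aRk` of the suffixes of the current text, those for the text that it was
derived from are computed. -/
def levelUp : Cmd := block [
  .set rL (get aPar (v rO)),
  .set rO (v rO - v rL - 3),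
  loadSample,
  pairRank (get aTxt (v rO + v rP)) (get aTxt (v rO + v rP + 1)),
  copyOut aNm,
  forUp rP 0 (v rL) (.put aSum (v rP) 0),
  pass 0 0,
  pass 1 (get aTxt (v rO + v rP)),
  pass 2 (get aNm (v rP)),
  pairRank (v rP % 3) (get aSum (v rP)),
  storeRanks]

set_option maxHeartbeats 2000000 in
theorem run_levelUp {B W o n : ℕ} {T : ℕ → ℕ} {s : State} {t : ℕ} {R : ℕ → ℕ → Prop}
    (hBW : B ≤ W) (hB : o + 10 * n + 16 ≤ B) (hO : s.reg rO = o + n + 3)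
    (hP : s.arr aPar (o + n + 3) = n) (hT : IsTxt n T)
    (hs : ∀ i ≤ n + 2, s.arr aTxt (o + i) = T i)
    (hr : IsRank (childLen n) (childTxt n (names3 n T)) (s.arr aRk)) :
    Run B W levelUp s t (fun s' t' => t' ≤ t + 20000 * (n + 1) ∧
      s'.reg rO = o ∧ s'.reg rL = n ∧ s'.arr aPar = s.arr aPar ∧ s'.arr aTxt = s.arr aTxt ∧
      IsRank n T (s'.arr aRk)) R := by
  have hW1 : 1 < W := by omega
  refine Run.block_cons ?_
  refine Run.of_vc hW1 ?_
  simp only [Cmd.vc, Expr.Safe, Expr.val, hO, hP]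
  refine ⟨⟨trivial, by omega⟩, fun t₁ ht₁ => ?_⟩
  replace ht₁ : t₁ ≤ t + 10 := ht₁.trans (Nat.add_le_add_left (by decide) _)
  refine Run.block_cons ?_
  refine Run.of_vc hW1 ?_
  simp +decide only [Cmd.vc, Expr.Safe, Expr.val, BinOp.Ok, BinOp.eval, Expr.sub_def,
    Expr.val_ofNat, Expr.safe_ofNat, State.setReg_reg, reduceIte, hO]
  refine ⟨⟨⟨trivial, trivial, by omega⟩, by omega, by omega⟩, fun t₂ ht₂ => ?_⟩
  replace ht₂ : t₂ ≤ t₁ + 10 := ht₂.trans (Nat.add_le_add_left (by decide) _)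
  rw [show o + n + 3 - n - 3 = o by omega]
  generalize hs₂ : (s.setReg rL n).setReg rO o = s₂
  have hO₂ : s₂.reg rO = o := by subst hs₂; simp
  have hL₂ : s₂.reg rL = n := by subst hs₂; simp
  have hA₂ : s₂.arr = s.arr := by subst hs₂; rfl
  clear hs₂
  have hS' := sampleRank_le hr
  refine Run.block_cons ?_
  refine (run_loadSample hBW (by omega) hL₂).frame.post ?_
  rintro s₃ t₃ ⟨⟨ht₃, h₃⟩, hF₃⟩
  replace ht₃ : t₃ ≤ t + 400 * (n + 1) := by linarith
  clear ht₁ ht₂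
  have hL₃ : s₃.reg rL = n := (hF₃.1 rL rfl).trans hL₂
  have hO₃ : s₃.reg rO = o := (hF₃.1 rO rfl).trans hO₂
  have hT₃ : s₃.arr aTxt = s.arr aTxt := (hF₃.2 aTxt rfl).trans (by rw [hA₂])
  have hP₃ : s₃.arr aPar = s.arr aPar := (hF₃.2 aPar rfl).trans (by rw [hA₂])
  have hS₃ : ∀ i ≤ n + 2, s₃.arr aSm i = sampleRank n (s.arr aRk) i := fun i hi => by
    rw [h₃ i hi, hA₂]
  -- the names for pairs
  refine Run.block_cons ?_
  refine (run_pairRank T (fun i => T (i + 1)) hBW (by omega) hL₃ (by decide) (by decide)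
    (fun i _ => (hT.le' i).trans (by omega)) (fun i _ => (hT.le' _).trans (by omega))
    ?_ ?_).post ?_
  · intro i hi s' hP hF
    have := hs i (by omega)
    simp [hP, hF.1 rO (by decide), hF.2 aTxt (by decide), hO₃, hT₃, this]; omega
  · intro i hi s' hP hF
    have := hs (i + 1) (by omega)
    simp [hP, hF.1 rO (by decide), hF.2 aTxt (by decide), hO₃, hT₃, ← this, Nat.add_assoc]; omega
  rintro s₄ t₄ ⟨ht₄, hF₄, h₄⟩
  replace ht₄ : t₄ ≤ t + 2400 * (n + 1) := by linarith
  clear ht₃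
  have hL₄ : s₄.reg rL = n := (hF₄.1 rL (by decide)).trans hL₃
  refine Run.block_cons ?_
  refine (run_copyOut hBW (by omega) hL₄ (by decide)).frame.post ?_
  rintro s₅ t₅ ⟨⟨ht₅, h₅⟩, hF₅⟩
  replace ht₅ : t₅ ≤ t + 2500 * (n + 1) := by linarith
  clear ht₄
  have hL₅ : s₅.reg rL = n := (hF₅.1 rL rfl).trans hL₄
  have hO₅ : s₅.reg rO = o := (hF₅.1 rO rfl).trans ((hF₄.1 rO (by decide)).trans hO₃)
  have hT₅ : s₅.arr aTxt = s.arr aTxt := (hF₅.2 aTxt rfl).trans ((hF₄.2 aTxt (by decide)).trans hT₃)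
  have hP₅ : s₅.arr aPar = s.arr aPar := (hF₅.2 aPar rfl).trans ((hF₄.2 aPar (by decide)).trans hP₃)
  have hS₅ : s₅.arr aSm = s₃.arr aSm := (hF₅.2 aSm rfl).trans (hF₄.2 aSm (by decide))
  have hN₅ : ∀ i ≤ n, s₅.arr aNm i = names2 n T i := fun i hi => by rw [h₅ i hi, h₄ i hi]; rfl
  refine Run.block_cons ?_
  refine Run.up_map 0 n 30 aSum 0 (fun _ => 0) (by decide) (by omega) hW1 (by omega) rfl
    (by simp; omega) ?_ ?_ ?_
  · intro s' hF
    simp [hF.1 rL rfl, hL₅]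
  · intro i s' h1 h2 h3 hF hI
    simp [h3]; omega
  intro s₆ t₆ ht₆ _ hF₆ h₆
  rw [Nat.sub_zero] at ht₆
  replace ht₆ : t₆ ≤ t + 2600 * (n + 1) := by linarith
  clear ht₅
  have hL₆ : s₆.reg rL = n := (hF₆.1 rL rfl).trans hL₅
  have hO₆ : s₆.reg rO = o := (hF₆.1 rO rfl).trans hO₅
  have hT₆ : s₆.arr aTxt = s.arr aTxt := (hF₆.2 aTxt rfl).trans hT₅
  have hP₆ : s₆.arr aPar = s.arr aPar := (hF₆.2 aPar rfl).trans hP₅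
  have hN₆ : s₆.arr aNm = s₅.arr aNm := hF₆.2 aNm rfl
  have hS₆ : s₆.arr aSm = s₃.arr aSm := (hF₆.2 aSm rfl).trans hS₅
  have hA₆ : ∀ i ≤ n, s₆.arr aSum i = 0 := fun i hi => by rw [h₆, if_pos (by omega)]
  -- the three passes
  refine Run.block_cons ?_
  refine (run_pass (D := fun _ => 0) hBW (by omega) (by omega) hL₆ (by decide) (by simp)
    (fun i _ s' _ _ => by simp; omega) (by rw [hS₆]; exact hS₃) hS'
    (fun i hi => by rw [hA₆ i hi]; omega)).frame.post ?_
  rintro s₇ t₇ ⟨⟨ht₇, h₇⟩, hF₇⟩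
  replace ht₇ : t₇ ≤ t + 5600 * (n + 1) := by linarith
  clear ht₆
  have hL₇ : s₇.reg rL = n := (hF₇.1 rL rfl).trans hL₆
  have hO₇ : s₇.reg rO = o := (hF₇.1 rO rfl).trans hO₆
  have hT₇ : s₇.arr aTxt = s.arr aTxt := (hF₇.2 aTxt rfl).trans hT₆
  have hP₇ : s₇.arr aPar = s.arr aPar := (hF₇.2 aPar rfl).trans hP₆
  have hN₇ : s₇.arr aNm = s₅.arr aNm := (hF₇.2 aNm rfl).trans hN₆
  have hS₇ : s₇.arr aSm = s₃.arr aSm := (hF₇.2 aSm rfl).trans hS₆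
  refine Run.block_cons ?_
  refine (run_pass (D := T) hBW (by omega) (by omega) hL₇ (by decide) (fun i _ => hT.le' i)
    (fun i hi s' hP hF => by
      have := hs i (by omega)
      simp [hP, hF.1 rO (by decide), hF.2 aTxt (by decide), hO₇, hT₇, this]; omega)
    (by rw [hS₇]; exact hS₃) hS'
    (fun i hi => by
      rw [h₇ i hi, hA₆ i hi]
      have := passPart_le (δ := 0) (D := fun _ => 0) (S := sampleRank n (s.arr aRk)) hi
      omega)).frame.post ?_
  rintro s₈ t₈ ⟨⟨ht₈, h₈⟩, hF₈⟩
  replace ht₈ : t₈ ≤ t + 8600 * (n + 1) := by linarith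
  clear ht₇
  have hL₈ : s₈.reg rL = n := (hF₈.1 rL rfl).trans hL₇
  have hO₈ : s₈.reg rO = o := (hF₈.1 rO rfl).trans hO₇
  have hT₈ : s₈.arr aTxt = s.arr aTxt := (hF₈.2 aTxt rfl).trans hT₇
  have hP₈ : s₈.arr aPar = s.arr aPar := (hF₈.2 aPar rfl).trans hP₇
  have hN₈ : s₈.arr aNm = s₅.arr aNm := (hF₈.2 aNm rfl).trans hN₇
  have hS₈ : s₈.arr aSm = s₃.arr aSm := (hF₈.2 aSm rfl).trans hS₇
  refine Run.block_cons ?_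
  refine (run_pass (D := names2 n T) hBW (by omega) (by omega) hL₈ (by decide)
    (fun i hi => (names2_le hi).trans (by omega))
    (fun i hi s' hP hF => by
      simp [hP, hF.2 aNm (by decide), hN₈, hN₅ i hi]; omega)
    (by rw [hS₈]; exact hS₃) hS'
    (fun i hi => by
      rw [h₈ i hi, h₇ i hi, hA₆ i hi]
      have := passPart_le (δ := 0) (D := fun _ => 0) (S := sampleRank n (s.arr aRk)) hi
      have := passPart_le (δ := 1) (D := T) (S := sampleRank n (s.arr aRk)) hi
      omega)).frame.post ?_
  rintro s₉ t₉ ⟨⟨ht₉, h₉⟩, hF₉⟩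
  replace ht₉ : t₉ ≤ t + 11600 * (n + 1) := by linarith
  clear ht₈
  have hL₉ : s₉.reg rL = n := (hF₉.1 rL rfl).trans hL₈
  have hO₉ : s₉.reg rO = o := (hF₉.1 rO rfl).trans hO₈
  have hT₉ : s₉.arr aTxt = s.arr aTxt := (hF₉.2 aTxt rfl).trans hT₈
  have hP₉ : s₉.arr aPar = s.arr aPar := (hF₉.2 aPar rfl).trans hP₈
  obtain ⟨hle, hrank⟩ := rank_of_passes hT (isName_names3 n T) hr (isName_one n T)
    (fun i _ => hT.le' i) (isName_names2 n T) (fun i hi => (names2_le hi).trans (by omega))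
    (s₉.arr aSum) (fun i hi => by rw [h₉ i hi, h₈ i hi, h₇ i hi, hA₆ i hi, Nat.zero_add])
  -- the last ranking, within the residue classes
  refine Run.block_cons ?_
  refine (run_pairRank (fun i => i % 3) (s₉.arr aSum) hBW (by omega) hL₉ (by decide) (by decide)
    (fun i hi => by omega) (fun i hi => (hle i hi).trans (by omega)) ?_ ?_).post ?_
  · intro i hi s' hP hF
    simp [hP]; omega
  · intro i hi s' hP hF
    simp [hP, hF.2 aSum (by decide)]; omega
  rintro s₁₀ t₁₀ ⟨ht₁₀, hF₁₀, h₁₀⟩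
  replace ht₁₀ : t₁₀ ≤ t + 13600 * (n + 1) := by linarith
  clear ht₉
  have hL₁₀ : s₁₀.reg rL = n := (hF₁₀.1 rL (by decide)).trans hL₉
  have hO₁₀ : s₁₀.reg rO = o := (hF₁₀.1 rO (by decide)).trans hO₉
  have hT₁₀ : s₁₀.arr aTxt = s.arr aTxt := (hF₁₀.2 aTxt (by decide)).trans hT₉
  have hP₁₀ : s₁₀.arr aPar = s.arr aPar := (hF₁₀.2 aPar (by decide)).trans hP₉
  have hA₁₀ : s₁₀.arr aSum = s₉.arr aSum := hF₁₀.2 aSum (by decide)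
  refine (run_storeRanks hBW (by omega) hL₁₀ (by rw [hA₁₀]; exact hle)).frame.post ?_
  rintro s' t' ⟨⟨ht, h⟩, hF⟩
  refine ⟨by linarith, (hF.1 rO rfl).trans hO₁₀, (hF.1 rL rfl).trans hL₁₀,
    (hF.2 aPar rfl).trans hP₁₀, (hF.2 aTxt rfl).trans hT₁₀, fun i hi => ?_⟩
  rw [h i hi, h₁₀ i hi, hA₁₀]
  exact hrank i hi

/-- The length of the text at recursion depth `k`. -/
def levLen (n : ℕ) : ℕ → ℕ
  | 0 => n
  | k + 1 => childLen (levLen n k)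

/-- The offset in `aTxt` of the text at recursion depth `k`. -/
def levOff (n : ℕ) : ℕ → ℕ
  | 0 => 0
  | k + 1 => levOff n k + levLen n k + 3

/-- The text at recursion depth `k`. -/
noncomputable def levTxt (n : ℕ) (T : ℕ → ℕ) : ℕ → ℕ → ℕ
  | 0 => T
  | k + 1 => childTxt (levLen n k) (names3 (levLen n k) (levTxt n T k))

theorem isTxt_levTxt {n T k} (hT : IsTxt n T) (hk : ∀ j < k, 3 ≤ levLen n j) :
    IsTxt (levLen n k) (levTxt n T k) := by
  cases k with
  | zero => exact hT
  | succ k => exact isTxt_childTxt (hk k (by omega)) fun p hp => names3_le hp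

/-- The texts shrink geometrically, which bounds their total length. -/
theorem levOff_add_le {n k} (hk : ∀ j < k, 3 ≤ levLen n j) :
    levOff n k + 8 * levLen n k ≤ 8 * n := by
  induction k with
  | zero => simp [levOff, levLen]
  | succ k ih =>
    have h1 := ih fun j hj => hk j (by omega)
    have h2 := hk k (by omega)
    simp only [levOff, levLen, childLen]
    omega

theorem levOff_mono {n j k} (h : j < k) : levOff n j + levLen n j + 3 ≤ levOff n k := by
  induction k with
  | zero => omega
  | succ k ih =>
    rcases Nat.lt_succ_iff_lt_or_eq.1 h with h | rfl
    · have := ih h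
      simp only [levOff]; omega
    · simp [levOff]

/-- The first `k + 1` texts and the lengths of all but the last of them are in memory. -/
def LevelsInMemory (n : ℕ) (T : ℕ → ℕ) (k : ℕ) (s : State) : Prop :=
  (∀ j < k, 3 ≤ levLen n j) ∧
  (∀ j ≤ k, ∀ i ≤ levLen n j + 2, s.arr aTxt (levOff n j + i) = levTxt n T j i) ∧
  ∀ j < k, s.arr aPar (levOff n (j + 1)) = levLen n j

/-- The texts are written one behind the other until the last of them has length two; it is
sorted directly, and the ranks are carried back to the first text. -/
def sortSuffixes : Cmd := block [
  .loop (lt 2 (v rL)) levelDown,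
  .put aRk 0 (2 - lt (get aTxt (v rO)) (get aTxt (v rO + 1))),
  .put aRk 1 (1 + lt (get aTxt (v rO)) (get aTxt (v rO + 1))),
  .put aRk 2 0,
  .loop (v rO) levelUp]

theorem run_sortSuffixes {B W n : ℕ} {T : ℕ → ℕ} {s : State} {t : ℕ} {R : ℕ → ℕ → Prop}
    (hBW : B ≤ W) (hB : 20 * n + 16 ≤ B) (hn : 2 ≤ n) (hO : s.reg rO = 0) (hL : s.reg rL = n)
    (hT : IsTxt n T) (hs : ∀ i < n, s.arr aTxt i = T i) (hz : ∀ i, n ≤ i → s.arr aTxt i = 0) :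
    Run B W sortSuffixes s t (fun s' t' => t' ≤ t + 400000 * (n + 1) ∧
      s'.reg rL = n ∧ (∀ i ≤ n + 2, s'.arr aTxt i = T i) ∧ IsRank n T (s'.arr aRk)) R := by
  have hW1 : 1 < W := by omega
  refine Run.block_cons ?_
  refine Run.loop hW1 (fun s' t' => ∃ k, LevelsInMemory n T k s' ∧
    (∀ i, levOff n k + levLen n k ≤ i → s'.arr aTxt i = 0) ∧ 2 ≤ levLen n k ∧
    s'.reg rO = levOff n k ∧ s'.reg rL = levLen n k ∧ t' ≤ t + 10000 * levOff n k)
    (t + 80000 * n) ?_ ?_ ?_ ?_ ?_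
  · refine ⟨0, ⟨by simp, fun j hj i hi => ?_, by simp⟩, by simpa [levOff, levLen] using hz, hn, hO, hL,
      by simp [levOff]⟩
    obtain rfl : j = 0 := by omega
    simp only [levOff, levTxt, levLen, Nat.zero_add] at *
    by_cases h : i < n
    · exact hs i h
    · rw [hz i (by omega), hT.zero i (by omega)]
  · rintro s' t' ⟨k, h1, h2, h3, h4, h5, h6⟩
    have := levOff_add_le h1.1
    omega
  · rintro s' t' ⟨k, h1, h2, h3, h4, h5, h6⟩
    simp; omega
  · -- the direct sorting and the way back
    rintro s₁ t₁ ⟨k, h1, h2, h3, h4, h5, h6⟩ - hlen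
    have hlen2 : levLen n k = 2 := by
      have : ¬ (2 < levLen n k) := fun h => by simp [h5, h] at hlen
      omega
    have hoff := levOff_add_le h1.1
    have hTk := isTxt_levTxt hT h1.1
    have ht0 := h1.2.1 k le_rfl 0 (by omega)
    have ht1 := h1.2.1 k le_rfl 1 (by omega)
    rw [Nat.add_zero] at ht0
    replace h6 : t₁ + (Expr.cost (lt 2 (v rL)) + 1) ≤ t + 10000 * levOff n k + 4 :=
      Nat.add_le_add_right h6 _
    generalize t₁ + (Expr.cost (lt 2 (v rL)) + 1) = t₂ at h6
    refine Run.block_cons ?_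
    refine Run.of_vc hW1 ?_
    simp only [Cmd.vc, Expr.Safe, Expr.val, BinOp.Ok, BinOp.eval, Expr.add_def, Expr.sub_def,
      Expr.val_ofNat, Expr.safe_ofNat, h4, ht0, ht1]
    and_intros <;> try first | trivial | omega
    intro t₃ ht₃
    replace ht₃ : t₃ ≤ t₂ + 15 := ht₃.trans (Nat.add_le_add_left (by decide) _)
    refine Run.block_cons ?_
    refine Run.of_vc hW1 ?_
    simp +decide only [Cmd.vc, Expr.Safe, Expr.val, BinOp.Ok, BinOp.eval, Expr.add_def, Expr.sub_def,
      Expr.val_ofNat, Expr.safe_ofNat, State.setArr_reg, State.setArr_arr, reduceIte, h4, ht0, ht1]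
    and_intros <;> try first | trivial | omega
    · split <;> omega
    intro t₄ ht₄
    replace ht₄ : t₄ ≤ t₃ + 15 := ht₄.trans (Nat.add_le_add_left (by decide) _)
    refine Run.block_cons ?_
    refine Run.of_vc hW1 ?_
    simp +decide only [Cmd.vc, Expr.Safe, Expr.val, Expr.val_ofNat, Expr.safe_ofNat]
    and_intros <;> try first | trivial | omega
    intro t₅ ht₅
    replace ht₅ : t₅ ≤ t₄ + 15 := ht₅.trans (Nat.add_le_add_left (by decide) _)
    generalize hs₂ : (((s₁.setArr aRk 0 _).setArr aRk 1 _).setArr aRk 2 0) = s₂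
    have hlev : LevelsInMemory n T k s₂ := by
      subst hs₂
      exact h1
    have hO₂ : s₂.reg rO = levOff n k := by subst hs₂; exact h4
    have hL₂ : s₂.reg rL = levLen n k := by subst hs₂; exact h5
    have hrank : IsRank (levLen n k) (levTxt n T k) (s₂.arr aRk) := by
      rw [hlen2] at hTk ⊢
      refine isRank_two hTk ?_ ?_ ?_ <;> subst hs₂ <;> simp [Function.update_apply] <;> split <;> rfl
    have ht₆ : t₅ ≤ t + 10000 * levOff n k + 49 := by
      clear * - ht₅ ht₄ ht₃ h6; omega
    refine Run.loop hW1 (fun s' t' => ∃ k, LevelsInMemory n T k s' ∧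
      s'.reg rO = levOff n k ∧ s'.reg rL = levLen n k ∧
      IsRank (levLen n k) (levTxt n T k) (s'.arr aRk) ∧
      t' + 30000 * levOff n k ≤ t + 320000 * n + 100) (t + 320000 * n + 100) ?_ ?_ ?_ ?_ ?_
    · exact ⟨k, hlev, hO₂, hL₂, hrank, by clear * - ht₆ hoff; omega⟩
    · rintro s' t' ⟨k, -, -, -, -, h⟩
      omega
    · intros; trivial
    · rintro s' t' ⟨k, g1, g2, g3, g4, g5⟩ - hzero
      have hk : k = 0 := by
        by_contra hk
        have := levOff_mono (n := n) (j := 0) (k := k) (by omega)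
        have : levOff n k = 0 := by rw [← g2]; exact hzero
        omega
      subst hk
      refine ⟨?_, g3, fun i hi => by simpa [levOff, levTxt] using g1.2.1 0 le_rfl i hi, g4⟩
      change t' + 2 ≤ _
      clear * - g5; omega
    · rintro s' t' ⟨k, g1, g2, g3, g4, g5⟩ - hzero
      obtain ⟨j, rfl⟩ : ∃ j, k = j + 1 := by
        refine Nat.exists_eq_succ_of_ne_zero fun hk => hzero ?_
        subst hk
        exact g2
      have hj := levOff_add_le (n := n) (k := j) fun i hi => g1.1 i (by omega)
      have hTj := isTxt_levTxt hT (k := j) fun i hi => g1.1 i (by omega)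
      refine (run_levelUp (o := levOff n j) (n := levLen n j) (T := levTxt n T j) hBW
        (by clear * - hj hB; omega) g2 (g1.2.2 j (by omega)) hTj (g1.2.1 j (by omega)) g4).post ?_
      rintro s'' t'' ⟨f1, f2, f3, f4, f5, f6⟩
      refine ⟨j, ⟨fun i hi => g1.1 i (by omega), fun i hi => ?_, fun i hi => ?_⟩, f2, f3, f6, ?_⟩
      · rw [f5]; exact g1.2.1 i (by omega)
      · rw [f4]; exact g1.2.2 i (by omega)
      · simp only [levOff] at g5
        replace f1 : t'' ≤ t' + 2 + 20000 * (levLen n j + 1) := f1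
        clear * - f1 g5; omega
  · rintro s' t' ⟨k, h1, h2, h3, h4, h5, h6⟩ - hlen
    have hlen3 : 3 ≤ levLen n k := by
      by_contra h
      have : ¬ (2 < levLen n k) := by omega
      simp [h5, this] at hlen
    have hk' : ∀ j < k + 1, 3 ≤ levLen n j := fun j hj => by
      rcases Nat.lt_succ_iff_lt_or_eq.1 hj with h | rfl
      exacts [h1.1 j h, hlen3]
    have hoff := levOff_add_le hk'
    have hoff' := levOff_add_le h1.1
    have hTk := isTxt_levTxt hT h1.1
    refine (run_levelDown (T := levTxt n T k) hBW (by clear * - hoff' hB; omega) hlen3 h4 h5 hTk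
      (h1.2.1 k le_rfl)).post ?_
    rintro s'' t'' ⟨f1, f2, f3, f4, f5⟩
    have hpos : 2 ≤ levLen n (k + 1) := by simp only [levLen, childLen]; omega
    refine ⟨k + 1, ⟨hk', fun j hj i hi => ?_, fun j hj => ?_⟩, fun i hi => ?_, hpos, f2, f3, ?_⟩
    · rcases Nat.lt_succ_iff_lt_or_eq.1 (Nat.lt_succ_of_le hj) with hj | rfl
      · replace hj := Nat.le_of_lt_succ hj
        rw [f5]
        have h7 : levOff n j + levLen n j + 3 ≤ levOff n k + levLen n k + 3 := by
          rcases Nat.lt_or_eq_of_le hj with h | rfl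
          · have := levOff_mono (n := n) h; omega
          · exact le_rfl
        rw [if_neg (by omega)]
        exact h1.2.1 j hj i hi
      · simp only [levLen] at hi
        change s''.arr aTxt (levOff n k + levLen n k + 3 + i) = levTxt n T (k + 1) i
        simp only [levTxt]
        rw [f5]
        by_cases hic : i < childLen (levLen n k)
        · rw [if_pos (by omega), Nat.add_sub_cancel_left]
        · rw [if_neg (by omega), h2 _ (by omega)]
          simp [childTxt, hic]
    · rw [f4]
      rcases Nat.lt_succ_iff_lt_or_eq.1 hj with hj | rfl
      · rw [Function.update_of_ne, h1.2.2 j hj]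
        have := levOff_mono (n := n) (j := k) (k := k + 1) (by omega)
        rcases Nat.lt_or_eq_of_le (Nat.succ_le_of_lt hj) with h | h
        · have := levOff_mono (n := n) h
          simp only [Nat.succ_eq_add_one] at this; omega
        · rw [← Nat.succ_eq_add_one, h]; omega
      · exact Function.update_self _ _ _
    · simp only [levOff, levLen] at hi
      rw [f5, if_neg (by omega), h2 _ (by omega)]
    · simp only [levOff]
      replace f1 : t'' ≤ t' + 4 + 5000 * (levLen n k + 1) := f1
      clear * - f1 h6; linarith

/-! ### The suffix array of a list -/

theorem list_lt_iff {u v : List ℕ} (hu : ∀ c ∈ u, 1 ≤ c) (hv : ∀ c ∈ v, 1 ≤ c) :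
    u < v ↔ ∃ k, (∀ j < k, u.getD j 0 = v.getD j 0) ∧ u.getD k 0 < v.getD k 0 := by
  induction u generalizing v with
  | nil =>
    cases v with
    | nil => simp
    | cons b v =>
      refine iff_of_true (List.nil_lt_cons b v) ⟨0, by simp, ?_⟩
      simpa [Nat.pos_iff_ne_zero, Nat.one_le_iff_ne_zero] using hv b (by simp)
  | cons a u ih =>
    cases v with
    | nil => simp
    | cons b v =>
      rw [List.cons_lt_cons_iff, ih (fun c hc => hu c (by simp [hc])) (fun c hc => hv c (by simp [hc]))]
      constructor
      · rintro (h | ⟨rfl, k, h1, h2⟩)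
        · exact ⟨0, by simp, by simpa using h⟩
        · refine ⟨k + 1, fun j hj => ?_, by simpa using h2⟩
          cases j with
          | zero => simp
          | succ j => simpa using h1 j (by omega)
      · rintro ⟨k, h1, h2⟩
        cases k with
        | zero => exact Or.inl (by simpa using h2)
        | succ k =>
          refine Or.inr ⟨by simpa using h1 0 (by omega), k, fun j hj => ?_, by simpa using h2⟩
          simpa using h1 (j + 1) (by omega)

theorem lcp_ge_iff {u v : List ℕ} {m : ℕ} :
    m ≤ lcp u v ↔ m ≤ u.length ∧ m ≤ v.length ∧ ∀ j < m, u.getD j 0 = v.getD j 0 := by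
  induction u generalizing v m with
  | nil => cases v <;> simp +contextual [lcp]
  | cons a u ih =>
    cases v with
    | nil =>
      simp only [lcp, List.length_nil, Nat.le_zero]
      exact ⟨by rintro rfl; simp, fun h => h.2.1⟩
    | cons b v =>
      cases m with
      | zero => simp
      | succ m =>
        by_cases h : a = b
        · subst h
          simp only [lcp, if_true, Nat.add_le_add_iff_right, ih, List.length_cons]
          refine and_congr_right fun _ => and_congr_right fun _ => ⟨fun h j hj => ?_, fun h j hj => ?_⟩
          · cases j with
            | zero => simp
            | succ j => simpa using h j (by omega)
          · simpa using h (j + 1) (by omega)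
        · simp only [lcp, if_neg h]
          refine iff_of_false (by omega) fun h' => h ?_
          simpa using h'.2.2 0 (by omega)

/-- The text as a function, numbered from `0`. -/
def txt (X : List ℕ) (i : ℕ) : ℕ := X.getD i 0

theorem charAt_eq (X : List ℕ) (p : ℕ) : charAt X p = txt X (p - 1) := rfl

theorem getD_suffixAt (X : List ℕ) (p k : ℕ) : (suffixAt X p).getD k 0 = txt X (p - 1 + k) := by
  simp [suffixAt, txt, List.getD_eq_getElem?_getD]

theorem suffixAt_lt_iff {X : List ℕ} (hX : IsTxt X.length (txt X)) {p q : ℕ} :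
    suffixAt X p < suffixAt X q ↔ suf (txt X) (p - 1) < suf (txt X) (q - 1) := by
  have hpos : ∀ c ∈ X, 1 ≤ c := by
    intro c hc
    obtain ⟨i, hi, rfl⟩ := List.getElem_of_mem hc
    have := hX.pos i hi
    rwa [txt, List.getD_eq_getElem _ _ hi] at this
  rw [list_lt_iff (u := suffixAt X p) (v := suffixAt X q) (fun c hc => hpos c (List.mem_of_mem_drop hc))
    (fun c hc => hpos c (List.mem_of_mem_drop hc)), suf_lt_iff]
  simp only [getD_suffixAt, Agree]

theorem saList_perm (X : List ℕ) : (saList X).Perm (List.range' 1 X.length) :=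
  List.mergeSort_perm _ _

theorem length_saList (X : List ℕ) : (saList X).length = X.length := by
  rw [(saList_perm X).length_eq, List.length_range']

theorem nodup_saList (X : List ℕ) : (saList X).Nodup :=
  (saList_perm X).nodup_iff.2 List.nodup_range'

theorem mem_saList {X : List ℕ} {p : ℕ} : p ∈ saList X ↔ 1 ≤ p ∧ p ≤ X.length := by
  rw [(saList_perm X).mem_iff, List.mem_range'_1]; omega

theorem SA_eq_getElem {X : List ℕ} {i : ℕ} (h1 : 1 ≤ i) (h2 : i ≤ X.length) :
    SA X i = (saList X)[i - 1]'(by rw [length_saList]; omega) := by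
  rw [SA, List.getD_eq_getElem _ _ (by rw [length_saList]; omega)]

theorem SA_mem {X : List ℕ} {i : ℕ} (h1 : 1 ≤ i) (h2 : i ≤ X.length) :
    1 ≤ SA X i ∧ SA X i ≤ X.length := by
  rw [← mem_saList, SA_eq_getElem h1 h2]
  exact List.getElem_mem _

theorem ISA_SA {X : List ℕ} {i : ℕ} (h1 : 1 ≤ i) (h2 : i ≤ X.length) : ISA X (SA X i) = i := by
  rw [ISA, SA_eq_getElem h1 h2, (nodup_saList X).idxOf_getElem]; omega

theorem ISA_mem {X : List ℕ} {p : ℕ} (h1 : 1 ≤ p) (h2 : p ≤ X.length) :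
    1 ≤ ISA X p ∧ ISA X p ≤ X.length := by
  have := List.idxOf_lt_length_of_mem (mem_saList.2 ⟨h1, h2⟩)
  rw [length_saList] at this
  simp only [ISA]; omega

theorem SA_ISA {X : List ℕ} {p : ℕ} (h1 : 1 ≤ p) (h2 : p ≤ X.length) : SA X (ISA X p) = p := by
  have h := ISA_mem h1 h2
  rw [SA_eq_getElem h.1 h.2]
  simp [ISA]

/-- The starting position of the `i`-th suffix, numbered from `0`. -/
def row (X : List ℕ) (i : ℕ) : ℕ := SA X i - 1

theorem row_lt {X : List ℕ} {i : ℕ} (h1 : 1 ≤ i) (h2 : i ≤ X.length) : row X i < X.length := by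
  have := SA_mem h1 h2
  simp only [row]; omega

theorem suf_row_lt {X : List ℕ} (hX : IsTxt X.length (txt X)) {i j : ℕ} (h1 : 1 ≤ i) (h2 : i < j)
    (h3 : j ≤ X.length) : suf (txt X) (row X i) < suf (txt X) (row X j) := by
  have hs : (saList X).Pairwise (fun p q => decide (suffixAt X p ≤ suffixAt X q) = true) :=
    List.pairwise_mergeSort (fun a b c h h' => by
      simp only [decide_eq_true_eq] at *; exact le_trans h h')
      (fun a b => by simpa using le_total _ _) _
  have h := List.pairwise_iff_getElem.1 hs (i - 1) (j - 1) (by rw [length_saList]; omega)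
    (by rw [length_saList]; omega) (by omega)
  rw [← SA_eq_getElem h1 (by omega), ← SA_eq_getElem (by omega) h3, decide_eq_true_eq, ← not_lt,
    suffixAt_lt_iff hX, not_lt] at h
  refine lt_of_le_of_ne h fun heq => ?_
  have hi := row_lt h1 (i := i) (X := X) (by omega)
  have hj := row_lt (i := j) (X := X) (by omega) h3
  have hrow := hX.suf_injOn hi.le hj.le heq
  have hi' := SA_mem h1 (i := i) (X := X) (by omega)
  have hj' := SA_mem (i := j) (X := X) (by omega) h3
  have h4 := ISA_SA h1 (i := i) (X := X) (by omega)
  have h5 := ISA_SA (i := j) (X := X) (by omega) h3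
  have : SA X i = SA X j := by simp only [row] at hrow; omega
  rw [this, h5] at h4
  omega

/-- As the empty suffix is ranked, too, ranks of other suffixes are their positions in the suffix
array. -/
theorem IsRank.row {X : List ℕ} (hX : IsTxt X.length (txt X)) {r : ℕ → ℕ}
    (hr : IsRank X.length (txt X) r) {i : ℕ} (h1 : 1 ≤ i) (h2 : i ≤ X.length) :
    r (row X i) = i := by
  have hmono : ∀ i j, 1 ≤ i → i < j → j ≤ X.length → r (SuffTest.row X i) < r (SuffTest.row X j) :=
    fun i j h1 h2 h3 => (hr.lt_iff (row_lt h1 (by omega)).le (row_lt (by omega) h3).le).2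
      (suf_row_lt hX h1 h2 h3)
  have hlo : ∀ i, 1 ≤ i → i ≤ X.length → i ≤ r (SuffTest.row X i) := by
    intro i
    induction i with
    | zero => omega
    | succ i ih =>
      intro _ h2
      rcases Nat.eq_zero_or_pos i with rfl | hi
      · have hlt : r X.length < r (SuffTest.row X 1) := by
          refine (hr.lt_iff le_rfl (row_lt le_rfl h2).le).2 (suf_lt_iff.2 ⟨0, by simp [Agree], ?_⟩)
          rw [hX.zero _ (by omega)]
          exact hX.pos _ (row_lt le_rfl h2)
        exact Nat.succ_le_of_lt (Nat.zero_lt_of_lt hlt)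
      · have := ih hi (by omega)
        have := hmono i (i + 1) hi (by omega) h2
        omega
  have hhi : ∀ k i, X.length - i = k → 1 ≤ i → i ≤ X.length → r (SuffTest.row X i) ≤ i := by
    intro k
    induction k with
    | zero =>
      intro i hk h1 h2
      have := crk_lt (κ := suf (txt X)) (N := X.length + 1) (i := SuffTest.row X i)
        (by have := row_lt h1 h2; omega)
      rw [hr _ (row_lt h1 h2).le]
      omega
    | succ k ih =>
      intro i hk h1 h2
      have := ih (i + 1) (by omega) (by omega) (by omega)
      have := hmono i (i + 1) h1 (by omega) (by omega)
      omega
  exact le_antisymm (hhi _ i rfl h1 h2) (hlo i h1 h2)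

theorem IsRank.ISA_eq {X : List ℕ} (hX : IsTxt X.length (txt X)) {r : ℕ → ℕ}
    (hr : IsRank X.length (txt X) r) {p : ℕ} (h1 : 1 ≤ p) (h2 : p ≤ X.length) :
    ISA X p = r (p - 1) := by
  have h := ISA_mem h1 h2
  have := hr.row hX h.1 h.2
  rwa [SuffTest.row, SA_ISA h1 h2, eq_comm] at this

theorem le_LCP_iff {X : List ℕ} (hX : IsTxt X.length (txt X)) {i m : ℕ} (h1 : 2 ≤ i)
    (h2 : i ≤ X.length) : m ≤ LCP X i ↔ Agree (txt X) m (row X (i - 1)) (row X i) := by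
  have hi := row_lt (i := i) (X := X) (by omega) h2
  have hj := row_lt (i := i - 1) (X := X) (by omega) (by omega)
  have hlen : ∀ p, (suffixAt X p).length = X.length - (p - 1) := fun p => by simp [suffixAt]
  rw [LCP, if_pos ⟨h1, h2⟩, lcp_ge_iff, hlen, hlen]
  simp only [getD_suffixAt]
  refine ⟨fun h => h.2.2, fun h => ?_⟩
  have hne : row X (i - 1) ≠ row X i := fun h => by
    have := suf_row_lt hX (i := i - 1) (j := i) (by omega) (by omega) h2
    rw [h] at this
    exact lt_irrefl _ this
  have := hX.agree_bound hj.le hi.le hne h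
  simp only [row] at this hi hj ⊢
  exact ⟨by omega, by omega, h⟩

theorem LCP_eq_of_agree {X : List ℕ} (hX : IsTxt X.length (txt X)) {i m : ℕ} (h1 : 2 ≤ i)
    (h2 : i ≤ X.length) (h : Agree (txt X) m (row X (i - 1)) (row X i))
    (hne : txt X (row X (i - 1) + m) ≠ txt X (row X i + m)) : LCP X i = m := by
  refine le_antisymm ?_ ((le_LCP_iff hX h1 h2).2 h)
  by_contra hc
  exact hne ((le_LCP_iff hX h1 h2).1 (not_le.1 hc) m (by omega))

theorem IsRank.le {n t r q} (hr : IsRank n t r) (hq : q ≤ n) : r q ≤ n := by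
  rw [hr q hq]; exact Nat.le_of_lt_succ (crk_lt (by omega))

theorem IsRank.inj {n t r i j} (ht : IsTxt n t) (hr : IsRank n t r) (hi : i ≤ n) (hj : j ≤ n)
    (h : r i = r j) : i = j := by
  rw [hr i hi, hr j hj, crk_eq_crk_iff (by omega) (by omega)] at h
  exact ht.suf_injOn hi hj h

theorem IsRank.exists_eq {n t r k} (ht : IsTxt n t) (hr : IsRank n t r) (hk : k ≤ n) :
    ∃ j ≤ n, r j = k := by
  obtain ⟨j, hj, h⟩ := exists_crk_eq (N := n + 1) (κ := suf t)
    (fun i hi j hj h => ht.suf_injOn (by omega) (by omega) h) (p := k) (by omega)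
  exact ⟨j, by omega, by rw [hr j (by omega), h]⟩

theorem IsRank.end_lt {n t r q} (ht : IsTxt n t) (hr : IsRank n t r) (hq : q < n) : r n < r q := by
  rw [hr.lt_iff le_rfl hq.le]
  refine suf_lt_iff.2 ⟨0, by simp [Agree], ?_⟩
  rw [ht.zero _ (by omega)]
  exact ht.pos _ hq

theorem IsRank.end_eq {n t r} (ht : IsTxt n t) (hr : IsRank n t r) : r n = 0 := by
  obtain ⟨j, hj, h⟩ := hr.exists_eq ht (Nat.zero_le n)
  rcases Nat.lt_or_eq_of_le hj with h' | rfl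
  · have := hr.end_lt ht h'; omega
  · exact h

/-- The entries of the LCP array, the empty suffix being the predecessor of the first one. -/
theorem IsRank.LCP_eq {X : List ℕ} (hX : IsTxt X.length (txt X)) {r : ℕ → ℕ}
    (hr : IsRank X.length (txt X) r) {q j m : ℕ} (hq : q < X.length) (hj : j ≤ X.length)
    (hjq : r j + 1 = r q) (h : Agree (txt X) m q j) (hne : txt X (q + m) ≠ txt X (j + m)) :
    LCP X (r q) = m := by
  have hq' := hr.le hq.le
  rcases Nat.eq_zero_or_pos (r j) with h0 | h0
  · obtain rfl : j = X.length := hr.inj hX hj le_rfl (by rw [h0, hr.end_eq hX])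
    have := hX.agree_bound hq.le le_rfl (by omega) h
    rw [← hjq, h0, LCP, if_neg (by omega)]; omega
  · have e1 : SuffTest.row X (r q) = q :=
      hr.inj hX (row_lt (by omega) hq').le hq.le (hr.row hX (by omega) hq')
    have e2 : SuffTest.row X (r q - 1) = j :=
      hr.inj hX (row_lt (by omega) (by omega)).le hj (by rw [hr.row hX (by omega) (by omega)]; omega)
    refine LCP_eq_of_agree hX (by omega) hq' ?_ ?_
    · rw [e1, e2]; exact h.symm
    · rw [e1, e2]; exact hne.symm

/-- The idea of Kasai's algorithm: deleting the first character of a suffix and of its predecessor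
leaves a suffix and a smaller one, which the new predecessor lies between. -/
theorem IsRank.agree_pred {n t r} (ht : IsTxt n t) (hr : IsRank n t r) {q j j' m : ℕ} (hq : q < n)
    (hj : j ≤ n) (hj' : j' ≤ n) (hjq : r j + 1 = r q) (hjq' : r j' + 1 = r (q + 1))
    (h : Agree t m q j) : Agree t (m - 1) (q + 1) j' := by
  cases m with
  | zero => intro k hk; omega
  | succ m =>
    have hb := ht.agree_bound hq.le hj (by rintro rfl; omega) h
    have hlt : suf t j < suf t q := (hr.lt_iff hj hq.le).1 (by omega)
    have hlt' : suf t (j + 1) < suf t (q + 1) := (h.symm.mono (by omega : 1 ≤ m + 1)).suf_lt_suf_iff.1 hlt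
    have h1 : Agree t m (j + 1) (q + 1) := fun k hk => by
      have := h.symm (k + 1) (by omega)
      rwa [Nat.add_assoc, Nat.add_assoc, Nat.add_comm 1 k]
    have h2 := (hr.lt_iff (by omega : j + 1 ≤ n) (by omega : q + 1 ≤ n)).2 hlt'
    have h3 : suf t (j + 1) ≤ suf t j' := not_lt.1 fun h => by
      have := (hr.lt_iff hj' (by omega : j + 1 ≤ n)).2 h; omega
    have h4 : suf t j' ≤ suf t (q + 1) :=
      ((hr.lt_iff hj' (by omega : q + 1 ≤ n)).1 (by omega)).le
    exact h1.symm.trans (h1.between h3 h4)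

theorem isTxt_reverse {σ : ℕ} {T : List ℕ} (hT : IsText σ T) :
    IsTxt T.reverse.length (txt T.reverse) := by
  -- the `σ` characters all occur, so `σ ≤ n`
  have hσ : σ ≤ T.length := by
    have hsub : Finset.Icc 1 σ ⊆ T.toFinset := fun c hc => by
      rw [List.mem_toFinset, hT.alphabet]; simpa using hc
    calc σ = (Finset.Icc 1 σ).card := by simp
      _ ≤ T.toFinset.card := Finset.card_le_card hsub
      _ ≤ T.length := List.toFinset_card_le _
  have hmem : ∀ i < T.reverse.length, 1 ≤ txt T.reverse i ∧ txt T.reverse i ≤ σ := fun i hi => by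
    rw [← hT.alphabet, txt, List.getD_eq_getElem _ _ hi, ← List.mem_reverse]
    exact List.getElem_mem _
  refine ⟨fun i hi => (hmem i hi).1, fun i hi => ?_, fun i hi => ?_⟩
  · have := (hmem i hi).2
    rw [List.length_reverse]; omega
  · rw [txt, List.getD_eq_default _ _ hi]

/-! ### The subroutine for the arrays -/

/-- The length of the common prefix of the current suffix and its predecessor. -/
abbrev rH : ℕ := 13

/-- The reversed text is written to `aTxt`. -/
def loadText : Cmd := block [
  forUp rP 0 (v rN - 1) (.put aTxt (v rP) (get aT (v rN - v rP))),
  .set rO 0,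
  .set rL (v rN)]

theorem run_loadText {B W n : ℕ} {s : State} {t : ℕ} {R : ℕ → ℕ → Prop}
    (hBW : B ≤ W) (hB : 20 * n + 16 ≤ B) (hn : 2 ≤ n) (hN : s.reg rN = n)
    (hz : ∀ i, s.arr aTxt i = 0) :
    Run B W loadText s t (fun s' t' => t' ≤ t + 50 * (n + 1) ∧ s'.reg rO = 0 ∧ s'.reg rL = n ∧
      ∀ i, s'.arr aTxt i = if i < n then s.arr aT (n - i) else 0) R := by
  have hW1 : 1 < W := by omega
  refine Run.block_cons ?_
  refine Run.up_map 0 (n - 1) 30 aTxt 0 (fun i => s.arr aT (n - i)) (by decide) (by omega) hW1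
    (by omega) rfl ⟨by simp; omega, by simp⟩
    (fun s' hF => ⟨by simp [hF.1 rN rfl, hN]; omega, by simp [hF.1 rN rfl, hN]⟩) ?_ ?_
  · intro i s' h1 h2 h3 hF hI
    simp [h3, hF.1 rN rfl, hN, hF.2 aT rfl]
    omega
  · intro s' t' ht h3 hF hI
    refine Run.of_vc hW1 ?_
    simp [block, hF.1 rN rfl, hN]
    refine ⟨by omega, fun t'' ht'' => ⟨?_, fun i => ?_⟩⟩
    · replace ht'' : t'' ≤ t' + 4 := ht''
      omega
    · rw [hI i, hz i]
      have : (0 + 0 ≤ i ∧ i ≤ 0 + (n - 1)) ↔ i < n := by omega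
      simp only [this, Nat.sub_zero]

/-- The inverse suffix array is read off from the ranks, and `aSuf` gets the position of each
rank. -/
def invertRanks : Cmd := block [
  forUp rP 1 (v rN) (.put aISA (v rP) (get aRk (v rP - 1))),
  forUp rP 0 (v rN) (.put aSuf (get aRk (v rP)) (v rP))]

theorem run_invertRanks {B W n : ℕ} {x r : ℕ → ℕ} {s : State} {t : ℕ} {R : ℕ → ℕ → Prop}
    (hBW : B ≤ W) (hB : 20 * n + 16 ≤ B) (hN : s.reg rN = n) (hx : IsTxt n x)
    (hr : IsRank n x r) (hs : s.arr aRk = r) :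
    Run B W invertRanks s t (fun s' t' => t' ≤ t + 100 * (n + 1) ∧
      (∀ p, 1 ≤ p → p ≤ n → s'.arr aISA p = r (p - 1)) ∧
      ∀ q ≤ n, s'.arr aSuf (r q) = q) R := by
  have hW1 : 1 < W := by omega
  refine Run.block_cons ?_
  refine Run.up_map 1 n 30 aISA 0 (fun p => r (p - 1)) (by decide) (by omega) hW1
    (by omega) rfl ⟨by simp; omega, by simp⟩
    (fun s' hF => ⟨by simp, by simp [hF.1 rN rfl, hN]⟩) ?_ ?_
  · intro i s' h1 h2 h3 hF hI
    simp [h3, hF.2 aRk rfl, hs]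
    omega
  · intro s₁ t₁ ht h3 hF₁ hI
    refine Run.up_vc 0 n 30 (fun i s' => ∀ q < i, s'.arr aSuf (r q) = q) (by decide)
      (by omega) hW1 (by omega) rfl ⟨by simp; omega, by simp⟩
      (fun s' hF => ⟨by simp, by simp [hF.1 rN rfl, hF₁.1 rN rfl, hN]⟩) (by simp) ?_ ?_
    · intro i s' h1 h2 h3 hF hI
      have := hr.le h2
      simp [h3, hF.2 aRk rfl, hF₁.2 aRk rfl, hs]
      refine ⟨by omega, by omega, fun q hq => ?_⟩
      rcases Nat.lt_or_eq_of_le hq with hq | rfl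
      · rw [Function.update_of_ne, hI q hq]
        intro h
        have := hr.inj hx (by omega) h2 h; omega
      · simp
    · intro s₂ t₂ ht₂ h3 hF₂ hI₂
      refine ⟨by omega, fun p h1 h2 => ?_, fun q hq => hI₂ q (by omega)⟩
      rw [hF₂.2 aISA rfl, hI p, if_pos (by omega), Nat.sub_zero]

/-- The Burrows-Wheeler transform is read off from the suffix array. -/
def computeBWT : Cmd :=
  forUp rP 1 (v rN) (
    .ite (eq (get aSuf (v rP)) 0)
      (.put aBWT (v rP) (get aTxt (v rN - 1)))
      (.put aBWT (v rP) (get aTxt (get aSuf (v rP) - 1))))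

theorem run_computeBWT {B W : ℕ} {X : List ℕ} {s : State} {t : ℕ} {R : ℕ → ℕ → Prop}
    (hBW : B ≤ W) (hB : 20 * X.length + 16 ≤ B) (hN : s.reg rN = X.length)
    (hx : ∀ i ≤ X.length, s.arr aTxt i = txt X i)
    (hs : ∀ i, 1 ≤ i → i ≤ X.length → s.arr aSuf i = row X i) :
    Run B W computeBWT s t (fun s' t' => t' ≤ t + 50 * (X.length + 1) ∧
      ∀ i, 1 ≤ i → i ≤ X.length → s'.arr aBWT i = BWT X i) R := by
  have hW1 : 1 < W := by omega
  refine Run.up_map 1 X.length 40 aBWT 0 (BWT X) (by decide) (by omega) hW1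
    (by omega) rfl ⟨by simp; omega, by simp⟩
    (fun s' hF => ⟨by simp, by simp [hF.1 rN rfl, hN]⟩) ?_ ?_
  · intro i s' h1 h2 h3 hF hI
    have hrow := row_lt h1 h2
    have hSA := SA_mem h1 h2
    have hrow' : row X i = SA X i - 1 := rfl
    simp only [Cmd.vc, Expr.Safe, Expr.val, BinOp.Ok, BinOp.eval, Expr.sub_def, Expr.val_ofNat,
      Expr.safe_ofNat, h3, hF.2 aSuf rfl, hF.2 aTxt rfl, hF.1 rN rfl, hN, hs i h1 h2,
      hx _ (by omega : row X i - 1 ≤ X.length), hx _ (by omega : X.length - 1 ≤ X.length),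
      State.setArr_arr, Nat.zero_add, if_true, BWT, charAt_eq]
    by_cases h0 : row X i = 0
    · have : SA X i = 1 := by omega
      simp [h0, this]; omega
    · have : SA X i ≠ 1 := by omega
      simp [h0, this, hrow']; omega
  · intro s' t' ht h3 hF hI
    refine ⟨by omega, fun i h1 h2 => ?_⟩
    rw [hI i, if_pos (by omega), Nat.sub_zero]

/-- Kasai's algorithm. -/
def computeLCP : Cmd := block [
  .set rH 0,
  forUp rP 1 (v rN) (block [
    .set rQ (get aISA (v rP)),
    .set rV (get aSuf (v rQ - 1)),
    .loop (eq (get aTxt (v rP - 1 + v rH)) (get aTxt (v rV + v rH))) (.set rH (v rH + 1)),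
    .put aLCP (v rQ) (v rH),
    .set rH (v rH - 1)])]

theorem run_computeLCP {B W : ℕ} {X : List ℕ} {r : ℕ → ℕ} {s : State} {t : ℕ} {R : ℕ → ℕ → Prop}
    (hBW : B ≤ W) (hB : 20 * X.length + 16 ≤ B) (hN : s.reg rN = X.length)
    (hX : IsTxt X.length (txt X)) (hr : IsRank X.length (txt X) r)
    (hx : ∀ i ≤ X.length, s.arr aTxt i = txt X i)
    (hisa : ∀ p, 1 ≤ p → p ≤ X.length → s.arr aISA p = r (p - 1))
    (hs : ∀ q ≤ X.length, s.arr aSuf (r q) = q) :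
    Run B W computeLCP s t (fun s' t' => t' ≤ t + 200 * (X.length + 1) ∧
      ∀ i, 1 ≤ i → i ≤ X.length → s'.arr aLCP i = LCP X i) R := by
  have hW1 : 1 < W := by omega
  have hrle : ∀ q ≤ X.length, r q ≤ X.length := fun q hq => hr.le hq
  have hrpos : ∀ q < X.length, 0 < r q := fun q hq => Nat.zero_lt_of_lt (hr.end_lt hX hq)
  refine Run.block_cons ?_
  refine Run.of_vc hW1 ?_
  simp only [Cmd.vc, Expr.safe_ofNat, Expr.val_ofNat]
  refine ⟨by omega, fun t₁ ht₁ => ?_⟩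
  replace ht₁ : t₁ ≤ t + 2 := ht₁
  -- the common prefix shrinks by at most one per step and never exceeds the length of the text,
  -- which pays for all comparisons
  refine Run.up 1 X.length (fun p s' t' =>
    (∀ q < p - 1, s'.arr aLCP (r q) = LCP X (r q)) ∧ s'.reg rH ≤ X.length ∧
    (∀ j ≤ X.length, p ≤ X.length → r j + 1 = r (p - 1) → Agree (txt X) (s'.reg rH) (p - 1) j) ∧
    t' ≤ t₁ + 4 + 100 * (p - 1) + 30 * s'.reg rH) (by omega) hW1 (by omega) rfl
    ⟨by simp; omega, by simp⟩ (fun s' hF => ⟨by simp, by simp [hF.1 rN rfl, hN]⟩) ?_ ?_ ?_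
  · refine ⟨by simp, by simp, fun j _ _ _ k hk => by simp at hk, ?_⟩
    simp [Expr.cost]
  · rintro p s₁ t₂ h1 h2 h3 hF ⟨g1, g2, g3, g4⟩
    obtain ⟨q, rfl⟩ : ∃ q, p = q + 1 := ⟨p - 1, by omega⟩
    simp only [Nat.add_sub_cancel] at g1 g3 g4
    have hq0 := hrpos q (by omega)
    have hqn := hrle q (by omega)
    obtain ⟨j, hj, hjq⟩ := hr.exists_eq hX (k := r q - 1) (by omega)
    replace hjq : r j + 1 = r q := by omega
    have hjq' : r q - 1 = r j := by omega
    have ha := g3 j hj h2 hjq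
    have hqj : q ≠ j := by rintro rfl; omega
    have hisaq := hisa (q + 1) (by omega) h2
    rw [Nat.add_sub_cancel] at hisaq
    have hsj := hs j hj
    refine Run.block_cons ?_
    refine Run.of_vc hW1 ?_
    simp only [Cmd.vc, Expr.Safe, Expr.val, h3, hF.2 aISA rfl, hisaq]
    refine ⟨⟨trivial, by omega⟩, fun t₃ ht₃ => ?_⟩
    replace ht₃ : t₃ ≤ t₂ + 4 + 3 := ht₃
    refine Run.block_cons ?_
    refine Run.of_vc hW1 ?_
    simp +decide only [Cmd.vc, Expr.Safe, Expr.val, BinOp.Ok, BinOp.eval, Expr.sub_def, Expr.val_ofNat,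
      Expr.safe_ofNat, State.setReg_reg, State.setReg_arr, reduceIte, hF.2 aSuf rfl, hjq', hsj]
    and_intros <;> try first | trivial | omega
    intro t₄ ht₄
    replace ht₄ : t₄ ≤ t₃ + 5 := ht₄
    replace ht₄ : t₄ ≤ t₂ + 15 := by omega
    clear ht₃
    refine Run.block_cons ?_
    refine Run.loop hW1 (fun s' t' => s'.reg rP = q + 1 ∧ s'.reg rQ = r q ∧ s'.reg rV = j ∧
      s'.arr aTxt = s.arr aTxt ∧ s'.arr aLCP = s₁.arr aLCP ∧ Agree (txt X) (s'.reg rH) q j ∧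
      t' + 30 * s₁.reg rH ≤ t₄ + 30 * s'.reg rH) (t₄ + 30 * X.length) ?_ ?_ ?_ ?_ ?_
    · simp +decide only [State.setReg_reg, State.setReg_arr, reduceIte]
      simp only [hisaq, hjq', hsj]
      exact ⟨h3, trivial, trivial, hF.2 aTxt rfl, trivial, ha, le_rfl⟩
    · rintro s' t' ⟨-, -, -, -, -, f, f'⟩
      have := hX.agree_bound (by omega : q ≤ X.length) hj hqj f
      omega
    · rintro s' t' ⟨f1, f2, f3, f4, f5, f6, f7⟩
      have := hX.agree_bound (by omega : q ≤ X.length) hj hqj f6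
      have e1 := hx _ this.1
      have e2 := hx _ this.2
      simp only [Expr.Safe, Expr.val, BinOp.Ok, BinOp.eval, Expr.sub_def, Expr.add_def,
        Expr.val_ofNat, Expr.safe_ofNat, f1, f3, f4, Nat.add_sub_cancel]
      and_intros <;> first | trivial | omega
    · rintro s' t' ⟨f1, f2, f3, f4, f5, f6, f7⟩ - hval
      have hb := hX.agree_bound (by omega : q ≤ X.length) hj hqj f6
      have hne : txt X (q + s'.reg rH) ≠ txt X (j + s'.reg rH) := by
        intro h
        rw [← hx _ hb.1, ← hx _ hb.2] at h
        simp only [Expr.val, BinOp.eval, Expr.sub_def, Expr.add_def, Expr.val_ofNat, f1, f3, f4,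
          Nat.add_sub_cancel, if_pos h] at hval
        exact one_ne_zero hval
      refine Run.of_vc hW1 ?_
      simp +decide only [block, Cmd.vc, Expr.Safe, Expr.val, BinOp.Ok, BinOp.eval, Expr.sub_def,
        Expr.val_ofNat, Expr.safe_ofNat, State.setReg_reg, State.setReg_arr, State.setArr_reg,
        State.setArr_arr, reduceIte, f2]
      and_intros <;> try first | trivial | omega
      intro t₅ ht₅
      simp +decide only [State.setReg_reg, State.setReg_arr, State.setArr_reg,
        State.setArr_arr, reduceIte, f5, Nat.add_sub_cancel]
      replace ht₅ : t₅ ≤ t' + 12 + 7 := ht₅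
      refine ⟨fun q' hq' => ?_, by omega, fun j' hj' hq1 hj1 => ?_, by omega⟩
      · by_cases hqq : q' = q
        · subst hqq
          rw [Function.update_self]
          exact (hr.LCP_eq hX (by omega) hj hjq f6 hne).symm
        · rw [Function.update_of_ne, g1 q' (by omega)]
          intro h
          exact hqq (hr.inj hX (by omega) (by omega) h)
      · exact hr.agree_pred hX (by omega) hj hj' hjq hj1 f6
    · rintro s' t' ⟨f1, f2, f3, f4, f5, f6, f7⟩ - hval
      have hb := hX.agree_bound (by omega : q ≤ X.length) hj hqj f6
      have heq : txt X (q + s'.reg rH) = txt X (j + s'.reg rH) := by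
        rw [← hx _ hb.1, ← hx _ hb.2]
        by_contra h
        simp only [Expr.val, BinOp.eval, Expr.sub_def, Expr.add_def, Expr.val_ofNat, f1, f3, f4,
          Nat.add_sub_cancel, if_neg h] at hval
        exact hval rfl
      refine Run.of_vc hW1 ?_
      simp +decide only [Cmd.vc, Expr.Safe, Expr.val, BinOp.Ok, BinOp.eval, Expr.add_def,
        Expr.val_ofNat, Expr.safe_ofNat, State.setReg_reg, State.setReg_arr, reduceIte, f1, f2, f3,
        f4, f5]
      refine ⟨⟨trivial, by omega, by omega⟩, fun t₅ ht₅ => ⟨trivial, trivial, trivial, trivial,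
        trivial, fun k hk => ?_, ?_⟩⟩
      · rcases Nat.lt_succ_iff_lt_or_eq.1 hk with hk | rfl
        exacts [f6 k hk, heq]
      · replace ht₅ : t₅ ≤ t' + 12 + 4 := ht₅
        omega
  · rintro s' t' h3 hF ⟨g1, g2, g3, g4⟩
    refine ⟨?_, fun i h1 h2 => ?_⟩
    · have : (v rN).cost = 1 := rfl
      omega
    · obtain ⟨q, hq, rfl⟩ := hr.exists_eq hX h2
      refine g1 q ?_
      rcases Nat.lt_or_eq_of_le hq with h | rfl
      · omega
      · rw [hr.end_eq hX] at h1; omega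

/-! ### Previous and next smaller values -/

theorem PSV_lt (A : ℕ → ℕ) {i : ℕ} (hi : 1 ≤ i) : PSV A i < i := by
  rw [PSV, Finset.sup_lt_iff (by simpa using Nat.pos_of_ne_zero (Nat.one_le_iff_ne_zero.1 hi))]
  intro j hj
  simp at hj
  simpa using hj.1.2

theorem PSV_val (A : ℕ → ℕ) {i : ℕ} (h : PSV A i ≠ 0) : A (PSV A i) < A i := by
  have hne : ((Finset.Ico 1 i).filter (fun j => A j < A i)).Nonempty := by
    by_contra hc
    rw [Finset.not_nonempty_iff_eq_empty] at hc
    exact h (by rw [PSV, hc]; rfl)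
  obtain ⟨j, hj, hj'⟩ := Finset.exists_mem_eq_sup _ hne id
  simp at hj
  have : PSV A i = j := hj'
  rw [this]; exact hj.2

theorem PSV_le_of_lt (A : ℕ → ℕ) {i j : ℕ} (h1 : PSV A i < j) (h2 : j < i) : A i ≤ A j := by
  by_contra hc
  have : id j ≤ PSV A i := Finset.le_sup (f := id) (by simp; omega)
  simp only [id] at this; omega

theorem PSV_eq {A : ℕ → ℕ} {i q : ℕ} (h1 : q < i) (h2 : q ≠ 0 → A q < A i)
    (h3 : ∀ j, q < j → j < i → A i ≤ A j) : PSV A i = q := by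
  rcases lt_trichotomy (PSV A i) q with h | h | h
  · have := PSV_le_of_lt A h h1
    have := h2 (by omega); omega
  · exact h
  · have := h3 _ h (PSV_lt A (by omega))
    have := PSV_val A (i := i) (by omega); omega

theorem NSV_mem (n : ℕ) (A : ℕ → ℕ) (i : ℕ) :
    NSV n A i = n + 1 ∨ (i < NSV n A i ∧ NSV n A i ≤ n ∧ A (NSV n A i) < A i) := by
  have := Finset.min'_mem (insert (n + 1) ((Finset.Ioc i n).filter (fun j => A j < A i)))
    (Finset.insert_nonempty _ _)
  rw [Finset.mem_insert, Finset.mem_filter, Finset.mem_Ioc] at this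
  rcases this with h | h
  · exact Or.inl h
  · exact Or.inr ⟨h.1.1, h.1.2, h.2⟩

theorem NSV_le {n : ℕ} {A : ℕ → ℕ} {i j : ℕ} (h1 : i < j) (h2 : j ≤ n) (h3 : A j < A i) :
    NSV n A i ≤ j :=
  Finset.min'_le _ _ (by simp; omega)

theorem NSV_le_succ (n : ℕ) (A : ℕ → ℕ) (i : ℕ) : NSV n A i ≤ n + 1 := by
  rcases NSV_mem n A i with h | h <;> omega

theorem NSV_gt {n : ℕ} (A : ℕ → ℕ) {i : ℕ} (hi : i ≤ n) : i < NSV n A i := by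
  rcases NSV_mem n A i with h | h <;> omega

theorem le_of_lt_NSV {n : ℕ} {A : ℕ → ℕ} {i j : ℕ} (h1 : i < j) (h2 : j < NSV n A i) :
    A i ≤ A j := by
  by_contra hc
  have := NSV_le_succ n A i
  have := NSV_le h1 (by omega : j ≤ n) (not_le.1 hc)
  omega

/-- Next smaller values are previous smaller values in the mirrored array. -/
theorem NSV_eq_PSV {n : ℕ} {A : ℕ → ℕ} {i : ℕ} (h1 : 1 ≤ i) (h2 : i ≤ n) :
    NSV n A i = n + 1 - PSV (fun j => A (n + 1 - j)) (n + 1 - i) := by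
  have hle := NSV_le_succ n A i
  have hgt := NSV_gt (n := n) A h2
  rw [PSV_eq (q := n + 1 - NSV n A i) (by omega)]
  · omega
  · intro h
    rcases NSV_mem n A i with h' | h'
    · omega
    · have e1 : n + 1 - (n + 1 - NSV n A i) = NSV n A i := by omega
      have e2 : n + 1 - (n + 1 - i) = i := by omega
      simp only [e1, e2]
      exact h'.2.2
  · intro j h3 h4
    have e2 : n + 1 - (n + 1 - i) = i := by omega
    simp only [e2]
    exact le_of_lt_NSV (n := n) (by omega) (by omega)

/-- The number of steps from `i` to `0` along previous smaller values, a potential for the time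
spent in following them. -/
def chainLen (A : ℕ → ℕ) (i : ℕ) : ℕ :=
  if h : 1 ≤ i then chainLen A (PSV A i) + 1 else 0
termination_by i
decreasing_by exact PSV_lt A h

/-- The machine has no conjunction: two tests both succeed when their values add up to `2`. -/
theorem two_tests (p q : Prop) [Decidable p] [Decidable q] :
    (if p then 1 else 0) + (if q then 1 else 0) ≤ 2 ∧
    ((if 1 < (if p then 1 else 0) + (if q then 1 else 0) then 1 else 0 : ℕ) ≠ 0 ↔ p ∧ q) := by
  by_cases hp : p <;> by_cases hq : q <;> simp [hp, hq]

/-- Previous smaller values of the array `src`, by following those of the predecessor. -/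
def prevSmaller (src dst : ℕ) : Cmd :=
  forUp rP 1 (v rN) (block [
    .set rQ (v rP - 1),
    .loop (lt 1 (lt 0 (v rQ) + le (get src (v rP)) (get src (v rQ)))) (.set rQ (get dst (v rQ))),
    .put dst (v rP) (v rQ)])

theorem run_prevSmaller {B W n src dst : ℕ} {A : ℕ → ℕ} {s : State} {t : ℕ} {R : ℕ → ℕ → Prop}
    (hBW : B ≤ W) (hB : 20 * n + 16 ≤ B) (hN : s.reg rN = n) (hne : src ≠ dst)
    (hA : ∀ i, 1 ≤ i → i ≤ n → s.arr src i = A i) :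
    Run B W (prevSmaller src dst) s t (fun s' t' => t' ≤ t + 100 * (n + 1) ∧
      ∀ i, 1 ≤ i → i ≤ n → s'.arr dst i = PSV A i) R := by
  have hW1 : 1 < W := by omega
  -- each row lengthens the chain by at most one, and each step of the inner loop shortens it
  refine Run.up 1 n (fun i s' t' => (∀ j, 1 ≤ j → j < i → s'.arr dst j = PSV A j) ∧
    t' + 30 * chainLen A (i - 1) ≤ t + 2 + 80 * (i - 1)) (by omega) hW1 (by omega) rfl
    ⟨by simp; omega, by simp⟩ (fun s' hF => ⟨by simp, by simp [hF.1 rN rfl, hN]⟩) ?_ ?_ ?_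
  · refine ⟨fun j h1 h2 => by omega, ?_⟩
    simp [Expr.cost, chainLen]
  · rintro i s₁ t₁ h1 h2 h3 hF ⟨g1, g2⟩
    have hsrc : s₁.arr src = s.arr src := hF.2 src (by simp [forUp, block, Cmd.wA, hne])
    have hAi := hA i h1 h2
    refine Run.block_cons ?_
    refine Run.of_vc hW1 ?_
    simp only [Cmd.vc, Expr.Safe, Expr.val, BinOp.Ok, BinOp.eval, Expr.sub_def, Expr.val_ofNat,
      Expr.safe_ofNat, h3]
    and_intros <;> try first | trivial | omega
    intro t₂ ht₂
    replace ht₂ : t₂ ≤ t₁ + 4 + 4 := ht₂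
    refine Run.block_cons ?_
    refine Run.loop hW1 (fun s' t' => s'.reg rP = i ∧ s'.arr src = s.arr src ∧
      s'.arr dst = s₁.arr dst ∧ s'.reg rQ < i ∧ (∀ j, s'.reg rQ < j → j < i → A i ≤ A j) ∧
      t' + 30 * chainLen A (s'.reg rQ) ≤ t₂ + 30 * chainLen A (i - 1))
      (t₂ + 30 * chainLen A (i - 1)) ?_ ?_ ?_ ?_ ?_
    · simp +decide only [State.setReg_reg, State.setReg_arr, reduceIte]
      exact ⟨h3, hsrc, trivial, by omega, fun j _ _ => by omega, le_rfl⟩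
    · rintro s' t' ⟨-, -, -, -, -, f⟩
      omega
    · rintro s' t' ⟨f1, f2, f3, f4, f5, f6⟩
      simp only [Expr.Safe, Expr.val, BinOp.Ok, BinOp.eval, Expr.add_def, Expr.val_ofNat,
        Expr.safe_ofNat, f1]
      and_intros <;> first | trivial | exact lt_of_le_of_lt (two_tests _ _).1 (by omega) | omega
    · rintro s' t' ⟨f1, f2, f3, f4, f5, f6⟩ - hval
      have hpsv : PSV A i = s'.reg rQ := by
        refine PSV_eq f4 (fun h0 => ?_) f5
        by_contra hc
        rw [← hAi, ← hA _ (by omega) (by omega : s'.reg rQ ≤ n), not_lt] at hc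
        have h0' : 0 < s'.reg rQ := by omega
        simp only [Expr.val, BinOp.eval, Expr.add_def, Expr.val_ofNat, f1, f2] at hval
        exact (two_tests _ _).2.2 ⟨h0', hc⟩ hval
      refine Run.of_vc hW1 ?_
      simp +decide only [block, Cmd.vc, Expr.Safe, Expr.val, State.setReg_reg, State.setReg_arr,
        State.setArr_reg, State.setArr_arr, reduceIte, f1]
      refine ⟨trivial, trivial, by omega, fun t₅ ht₅ => ⟨fun j h4 h5 => ?_, ?_⟩⟩
      · by_cases hj : j = i
        · subst hj
          rw [Function.update_self, hpsv]
        · rw [Function.update_of_ne hj, f3, g1 j h4 (by omega)]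
      · replace ht₅ : t₅ ≤ t' + 12 + 3 := ht₅
        have : chainLen A i = chainLen A (s'.reg rQ) + 1 := by
          rw [chainLen, dif_pos h1, hpsv]
        simp only [Nat.add_sub_cancel, this]
        omega
    · rintro s' t' ⟨f1, f2, f3, f4, f5, f6⟩ - hval
      have hval' : 0 < s'.reg rQ ∧ s.arr src i ≤ s.arr src (s'.reg rQ) := by
        simp only [Expr.val, BinOp.eval, Expr.add_def, Expr.val_ofNat, f1, f2] at hval
        exact (two_tests _ _).2.1 hval
      rw [hAi, hA _ (by omega) (by omega)] at hval'
      have hd := g1 (s'.reg rQ) (by omega) f4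
      refine Run.of_vc hW1 ?_
      simp +decide only [Cmd.vc, Expr.Safe, Expr.val, State.setReg_reg, State.setReg_arr,
        reduceIte, f1, f2, f3, hd]
      have hlt := PSV_lt A (i := s'.reg rQ) (by omega)
      refine ⟨⟨trivial, by omega⟩, fun t₅ ht₅ => ⟨trivial, trivial, trivial, by omega,
        fun j h4 h5 => ?_, ?_⟩⟩
      · rcases lt_trichotomy j (s'.reg rQ) with h | h | h
        · have := PSV_le_of_lt A h4 h; omega
        · subst h; exact hval'.2
        · exact f5 j h h5
      · replace ht₅ : t₅ ≤ t' + 12 + 3 := ht₅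
        have : chainLen A (s'.reg rQ) = chainLen A (PSV A (s'.reg rQ)) + 1 := by
          rw [chainLen, dif_pos (by omega)]
        omega
  · rintro s' t' h3 hF ⟨g1, g2⟩
    refine ⟨?_, fun i h1 h2 => g1 i h1 (by omega)⟩
    have : (v rN).cost = 1 := rfl
    omega

/-- Next smaller values, by mirroring the array. -/
def computeNSV : Cmd := block [
  forUp rP 1 (v rN) (.put aKx (v rP) (get aLCP (v rN + 1 - v rP))),
  prevSmaller aKx aKy,
  forUp rP 1 (v rN) (.put aNSV (v rP) (v rN + 1 - get aKy (v rN + 1 - v rP)))]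

theorem run_computeNSV {B W n : ℕ} {A : ℕ → ℕ} {s : State} {t : ℕ} {R : ℕ → ℕ → Prop}
    (hBW : B ≤ W) (hB : 20 * n + 16 ≤ B) (hN : s.reg rN = n)
    (hA : ∀ i, 1 ≤ i → i ≤ n → s.arr aLCP i = A i) :
    Run B W computeNSV s t (fun s' t' => t' ≤ t + 200 * (n + 1) ∧
      ∀ i, 1 ≤ i → i ≤ n → s'.arr aNSV i = NSV n A i) R := by
  have hW1 : 1 < W := by omega
  refine Run.block_cons ?_
  refine Run.up_map 1 n 30 aKx 0 (fun i => A (n + 1 - i)) (by decide) (by omega) hW1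
    (by omega) rfl ⟨by simp; omega, by simp⟩
    (fun s' hF => ⟨by simp, by simp [hF.1 rN rfl, hN]⟩) ?_ ?_
  · intro i s' h1 h2 h3 hF hI
    simp [h3, hF.2 aLCP rfl, hF.1 rN rfl, hN, hA (n + 1 - i) (by omega) (by omega)]
    omega
  · intro s₁ t₁ ht h3 hF₁ hI
    refine Run.block_cons ?_
    refine (run_prevSmaller (A := fun i => A (n + 1 - i)) hBW hB (by rw [hF₁.1 rN rfl, hN])
      (by decide) fun i h1 h2 => ?_).frame.post ?_
    · rw [hI i, if_pos (by omega), Nat.sub_zero]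
    · rintro s₂ t₂ ⟨⟨ht₂, hI₂⟩, hF₂⟩
      refine Run.up_map 1 n 30 aNSV 0 (NSV n A) (by decide) (by omega) hW1
        (by omega) rfl ⟨by simp; omega, by simp⟩
        (fun s' hF => ⟨by simp, by simp [hF.1 rN rfl, hF₂.1 rN rfl, hF₁.1 rN rfl, hN]⟩) ?_ ?_
      · intro i s' h1 h2 h3 hF hI
        simp [h3, hF.2 aKy rfl, hF.1 rN rfl, hF₂.1 rN rfl, hF₁.1 rN rfl, hN, NSV_eq_PSV h1 h2,
          hI₂ (n + 1 - i) (by omega) (by omega)]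
        omega
      · intro s₃ t₃ ht₃ h4 hF₃ hI₃
        refine ⟨by omega, fun i h1 h2 => ?_⟩
        rw [hI₃ i, if_pos (by omega), Nat.sub_zero]

/-! ### The whole subroutine -/

/-- The subroutine for the arrays: the suffixes are sorted by the skew algorithm. -/
def computeArrays : Cmd := block [
  loadText,
  sortSuffixes,
  invertRanks,
  computeBWT,
  computeLCP,
  prevSmaller aLCP aPSV,
  computeNSV]

theorem run_computeArrays {B W σ : ℕ} {T S : List ℕ} {R : ℕ → ℕ → Prop} (hT : IsText σ T)
    (hBW : B ≤ W) (hB : 20 * T.length + 16 ≤ B) :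
    Run B W computeArrays (initState σ T S) 0 (fun s t => t ≤ 500000 * (T.length + 1) ∧
      ArraysReady σ T S s) R := by
  have hX := isTxt_reverse hT
  have h2 := hT.two_le
  generalize hXe : T.reverse = X at hX
  have hn : X.length = T.length := by rw [← hXe, List.length_reverse]
  obtain ⟨n, hn'⟩ : ∃ n, n = T.length := ⟨_, rfl⟩
  rw [← hn'] at h2 hB ⊢
  rw [← hn'] at hn
  have hW1 : 1 < W := by omega
  have hN : (initState σ T S).reg rN = n := by simp [initState, hn']
  have hload : ∀ i, (if i < n then (initState σ T S).arr aT (n - i) else 0) = txt X i := by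
    intro i
    split_ifs with h
    · rw [txt, ← hXe, List.getD_reverse _ (by omega)]
      simp only [initState, if_neg (by omega : n - i ≠ 0), if_true]
      congr 1; omega
    · rw [hX.zero i (by omega)]
  refine Run.block_cons ?_
  refine (run_loadText hBW hB h2 hN fun i => by simp [initState]).frame.post ?_
  rintro s₁ t₁ ⟨⟨ht₁, hO₁, hL₁, hx₁⟩, hF₁⟩
  simp only [hload] at hx₁
  refine Run.block_cons ?_
  refine (run_sortSuffixes (T := txt X) hBW hB h2 hO₁ hL₁ (hn ▸ hX) (fun i _ => hx₁ i)
    fun i hi => by rw [hx₁, hX.zero i (by omega)]).frame.post ?_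
  rintro s₂ t₂ ⟨⟨ht₂, -, hx₂, hr⟩, hF₂⟩
  obtain ⟨r, hr'⟩ : ∃ r, r = s₂.arr aRk := ⟨_, rfl⟩
  rw [← hr'] at hr
  have hN₂ : s₂.reg rN = n := by rw [hF₂.1 rN rfl, hF₁.1 rN rfl, hN]
  refine Run.block_cons ?_
  refine (run_invertRanks (x := txt X) hBW hB hN₂ (hn ▸ hX) hr hr'.symm).frame.post ?_
  rintro s₃ t₃ ⟨⟨ht₃, hisa, hsuf⟩, hF₃⟩
  rw [← hn] at hr
  have hrow : ∀ i, 1 ≤ i → i ≤ X.length → s₃.arr aSuf i = row X i := fun i h1 h2 => by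
    have := hsuf (row X i) (by have := row_lt h1 h2; omega)
    rwa [hr.row hX h1 h2] at this
  rw [← hn] at hB hisa hsuf hx₂ hN₂
  refine Run.block_cons ?_
  refine (run_computeBWT (X := X) hBW hB (by rw [hF₃.1 rN rfl, hN₂])
    (fun i hi => by rw [hF₃.2 aTxt rfl, hx₂ i (by omega)]) hrow).frame.post ?_
  rintro s₄ t₄ ⟨⟨ht₄, hbwt⟩, hF₄⟩
  refine Run.block_cons ?_
  refine (run_computeLCP (X := X) (r := r) hBW hB (by rw [hF₄.1 rN rfl, hF₃.1 rN rfl, hN₂]) hX hr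
    (fun i hi => by rw [hF₄.2 aTxt rfl, hF₃.2 aTxt rfl, hx₂ i (by omega)])
    (fun p h1 h2 => by rw [hF₄.2 aISA rfl, hisa p h1 h2])
    (fun q hq => by rw [hF₄.2 aSuf rfl, hsuf q hq])).frame.post ?_
  rintro s₅ t₅ ⟨⟨ht₅, hlcp⟩, hF₅⟩
  refine Run.block_cons ?_
  refine (run_prevSmaller hBW hB (by rw [hF₅.1 rN rfl, hF₄.1 rN rfl, hF₃.1 rN rfl, hN₂])
    (by decide) hlcp).frame.post ?_
  rintro s₆ t₆ ⟨⟨ht₆, hpsv⟩, hF₆⟩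
  refine (run_computeNSV hBW hB
    (by rw [hF₆.1 rN rfl, hF₅.1 rN rfl, hF₄.1 rN rfl, hF₃.1 rN rfl, hN₂])
    (fun i h1 h2 => by rw [hF₆.2 aLCP rfl, hlcp i h1 h2])).frame.post ?_
  rintro s₇ t₇ ⟨⟨ht₇, hnsv⟩, hF₇⟩
  refine ⟨by linarith, fun q hq => ?_, fun a ha => ?_, fun i hi => ?_⟩
  · simp only [List.mem_cons, List.not_mem_nil, or_false] at hq
    rcases hq with rfl | rfl | rfl
    all_goals rw [hF₇.1 _ rfl, hF₆.1 _ rfl, hF₅.1 _ rfl, hF₄.1 _ rfl, hF₃.1 _ rfl, hF₂.1 _ rfl,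
      hF₁.1 _ rfl]
  · simp only [List.mem_cons, List.not_mem_nil, or_false] at ha
    rcases ha with rfl | rfl
    all_goals rw [hF₇.2 _ rfl, hF₆.2 _ rfl, hF₅.2 _ rfl, hF₄.2 _ rfl, hF₃.2 _ rfl, hF₂.2 _ rfl,
      hF₁.2 _ rfl]
  · rw [← hn', ← hn, Finset.mem_Icc] at hi
    rw [hXe, ← hn', ← hn]
    refine ⟨?_, ?_, ?_, ?_, hnsv i hi.1 hi.2⟩
    · rw [hF₇.2 aBWT rfl, hF₆.2 aBWT rfl, hF₅.2 aBWT rfl, hbwt i hi.1 hi.2]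
    · rw [hF₇.2 aLCP rfl, hF₆.2 aLCP rfl, hlcp i hi.1 hi.2]
    · rw [hF₇.2 aISA rfl, hF₆.2 aISA rfl, hF₅.2 aISA rfl, hF₄.2 aISA rfl, hisa i hi.1 hi.2,
        hr.ISA_eq hX hi.1 hi.2]
    · rw [hF₇.2 aPSV rfl, hpsv i hi.1 hi.2]

/-! ### Runs and the array `SLPR` -/

/-- The larger of those elements of `{x, y}` at which `A` is minimal. -/
def maxArgmin (A : ℕ → ℕ) (x y : ℕ) : ℕ :=
  if A x < A y then x else if A y < A x then y else max x y

/-- The larger of those elements of `{x, y}` at which `A` is maximal. -/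
def maxArgmax (A : ℕ → ℕ) (x y : ℕ) : ℕ :=
  if A y < A x then x else if A x < A y then y else max x y

theorem maxArgmin_cases (A : ℕ → ℕ) (x y : ℕ) :
    (maxArgmin A x y = x ∧ A x ≤ A y ∧ (A x = A y → y ≤ x)) ∨
    (maxArgmin A x y = y ∧ A y ≤ A x ∧ (A x = A y → x ≤ y)) := by
  unfold maxArgmin
  split_ifs <;> omega

/-- The row `i` starts a run of equal characters, and it is not the first row. -/
def IsBreak (n : ℕ) (bw : ℕ → ℕ) (i : ℕ) : Prop := 2 ≤ i ∧ i ≤ n ∧ bw (i - 1) ≠ bw i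

/-- The recursions by which the arrays `SBPR`, `SAPR` and `SLPR` are computed from the
Burrows-Wheeler transform `bw` and the LCP array `lc`. -/
structure IsSLPR (n : ℕ) (bw lc sb sa sl : ℕ → ℕ) : Prop where
  lc_one : lc 1 = 0
  sb_one : sb 1 = 1
  sb_step : ∀ i, 2 ≤ i → i ≤ n →
    sb i = if bw (i - 1) ≠ bw i then i else maxArgmin lc (sb (i - 1)) i
  sa_last : sa n = 1
  sa_step : ∀ j, 1 ≤ j → j < n →
    sa j = if bw j ≠ bw (j + 1) then j + 1 else maxArgmin lc (j + 1) (sa (j + 1))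
  sl_eq : ∀ k, 1 ≤ k → k ≤ n → sl k = maxArgmax lc (sb k) (sa k)

namespace IsSLPR
variable {n : ℕ} {bw lc sb sa sl : ℕ → ℕ}

/-- `SBPR[k]` is a position of the minimum of the LCP array between the start of the run of `k`
and `k`. -/
theorem sb_spec (h : IsSLPR n bw lc sb sa sl) {k : ℕ} (h1 : 1 ≤ k) (h2 : k ≤ n) :
    1 ≤ sb k ∧ sb k ≤ k ∧ (∀ l, sb k ≤ l → l ≤ k → lc (sb k) ≤ lc l) ∧
    ∀ i, IsBreak n bw i → i ≤ k → i ≤ sb k := by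
  induction k with
  | zero => omega
  | succ k ih =>
    rcases Nat.eq_zero_or_pos k with rfl | hk
    · rw [h.sb_one]
      refine ⟨le_rfl, le_rfl, fun l _ _ => ?_, fun i _ hi => hi⟩
      obtain rfl : l = 1 := by omega
      exact le_rfl
    obtain ⟨g1, g2, g3, g4⟩ := ih hk (by omega)
    have hstep := h.sb_step (k + 1) (by omega) h2
    rw [Nat.add_sub_cancel] at hstep
    by_cases hb : bw k = bw (k + 1)
    · rw [if_neg (not_not.2 hb), maxArgmin] at hstep
      have hbr : ∀ i, IsBreak n bw i → i ≤ k + 1 → i ≤ sb k := fun i hi hik => by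
        refine g4 i hi ?_
        by_contra hc
        obtain rfl : i = k + 1 := by omega
        exact hi.2.2 hb
      split_ifs at hstep with c1 c2
      · rw [hstep]
        refine ⟨g1, by omega, fun l h3 h4 => ?_, hbr⟩
        rcases Nat.lt_or_eq_of_le h4 with h4 | rfl
        exacts [g3 l h3 (by omega), c1.le]
      all_goals
        have e : sb (k + 1) = k + 1 := by omega
        rw [e]
        refine ⟨by omega, le_rfl, fun l h3 h4 => ?_, fun i hi hik => hik⟩
        obtain rfl : l = k + 1 := by omega
        exact le_rfl
    · rw [if_pos hb] at hstep
      rw [hstep]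
      refine ⟨by omega, le_rfl, fun l h3 h4 => ?_, fun i hi hik => hik⟩
      obtain rfl : l = k + 1 := by omega
      exact le_rfl

/-- `SAPR[k]` is a position of the minimum of the LCP array between `k + 1` and the next break,
except that it may be `1` if there is no further break. -/
theorem sa_spec (h : IsSLPR n bw lc sb sa sl) {k : ℕ} (h1 : 1 ≤ k) (h2 : k ≤ n) :
    (sa k = 1 ∧ ∀ i, IsBreak n bw i → i ≤ k) ∨
    (k < sa k ∧ sa k ≤ n ∧ (∀ l, k < l → l ≤ sa k → lc (sa k) ≤ lc l) ∧
      ∀ i, IsBreak n bw i → k < i → sa k ≤ i) := by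
  obtain ⟨d, rfl⟩ : ∃ d, k = n - d := ⟨n - k, by omega⟩
  induction d with
  | zero => exact Or.inl ⟨h.sa_last, fun i hi => hi.2.1⟩
  | succ d ih =>
    obtain ⟨k, hk⟩ : ∃ k, k = n - (d + 1) := ⟨_, rfl⟩
    have hk' : n - d = k + 1 := by omega
    rw [hk'] at ih
    rw [← hk] at h1 ⊢
    have hstep := h.sa_step k h1 (by omega)
    have hself : ∀ l, k < l → l ≤ k + 1 → lc (k + 1) ≤ lc l := fun l h3 h4 => by
      obtain rfl : l = k + 1 := by omega
      exact le_rfl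
    by_cases hb : bw k = bw (k + 1)
    · rw [if_neg (not_not.2 hb), maxArgmin] at hstep
      have hbr : ∀ i, IsBreak n bw i → k < i → k + 1 < i := fun i hi hik => by
        by_contra hc
        obtain rfl : i = k + 1 := by omega
        exact hi.2.2 hb
      rcases ih (by omega) (by omega) with ⟨g1, g2⟩ | ⟨g1, g2, g3, g4⟩
      · rw [g1, h.lc_one] at hstep
        have hno : ∀ i, IsBreak n bw i → i ≤ k := fun i hi => by
          by_contra hc
          have := hbr i hi (by omega)
          have := g2 i hi
          omega
        split_ifs at hstep with c1 c2
        · omega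
        · exact Or.inl ⟨hstep, hno⟩
        · have e : sa k = k + 1 := by omega
          rw [e]
          exact Or.inr ⟨by omega, by omega, hself, fun i hi hik => by have := hno i hi; omega⟩
      · refine Or.inr ?_
        split_ifs at hstep with c1 c2
        · rw [hstep]
          exact ⟨by omega, by omega, hself, fun i hi hik => hik⟩
        all_goals
          have e : sa k = sa (k + 1) := by omega
          rw [e]
          refine ⟨by omega, g2, fun l h3 h4 => ?_, fun i hi hik => g4 i hi (hbr i hi hik)⟩
          rcases Nat.lt_or_eq_of_le (Nat.succ_le_of_lt h3) with h5 | h5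
          · exact g3 l h5 h4
          · rw [← h5, Nat.succ_eq_add_one]; omega
    · rw [if_pos hb] at hstep
      rw [hstep]
      exact Or.inr ⟨by omega, by omega, hself, fun i hi hik => hik⟩

/-- The rows that share the context of the break `i` are those for which `SLPR` is strictly
between the previous and the next smaller value of `i`. -/
theorem mem_box_iff (h : IsSLPR n bw lc sb sa sl) {i k : ℕ} (hi : IsBreak n bw i) (h1 : 1 ≤ k)
    (h2 : k ≤ n) :
    (PSV lc i ≤ k ∧ k < NSV n lc i) ↔ (PSV lc i < sl k ∧ sl k < NSV n lc i) := by
  obtain ⟨b1, b2, b3, b4⟩ := h.sb_spec h1 h2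
  have ha := h.sa_spec h1 h2
  have hs := h.sl_eq k h1 h2
  have hP := PSV_lt lc (i := i) (by have := hi.1; omega)
  have hN := NSV_gt (n := n) lc hi.2.1
  have hPv := fun h => PSV_val lc (i := i) h
  have hNv := NSV_mem n lc i
  have hNle := NSV_le_succ n lc i
  have hbox : ∀ l, PSV lc i < l → l < NSV n lc i → lc i ≤ lc l := by
    intro l h3 h4
    rcases lt_trichotomy l i with h | rfl | h
    · exact PSV_le_of_lt lc h3 h
    · exact le_rfl
    · exact le_of_lt_NSV h h4
  generalize PSV lc i = P at *
  generalize NSV n lc i = N at *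
  have h10 := h.lc_one
  constructor
  · rintro ⟨hPk, hkN⟩
    -- one of the two minima lies in the box, so the larger one is at least `lc i`, too
    have key : lc i ≤ lc (sl k) := by
      have hle : lc (sb k) ≤ lc (sl k) ∧ lc (sa k) ≤ lc (sl k) := by
        rw [hs, maxArgmax]
        split_ifs
        · omega
        · omega
        · rcases max_choice (sb k) (sa k) with e | e <;> rw [e] <;> omega
      rcases Nat.lt_or_ge k i with hki | hki
      · rcases ha with ⟨-, ha⟩ | ⟨a1, a2, a3, a4⟩
        · have := ha i hi; omega
        · have := a4 i hi hki
          have := hbox (sa k) (by omega) (by omega)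
          omega
      · have := b4 i hi hki
        have := hbox (sb k) (by omega) (by omega)
        omega
    have hcase : sl k = sb k ∨ (sl k = sa k ∧ k < sa k) := by
      rcases ha with ⟨ha, -⟩ | ⟨a1, -⟩
      · rw [ha, maxArgmax, h10] at hs
        left
        split_ifs at hs <;> omega
      · rw [maxArgmax] at hs
        split_ifs at hs <;> omega
    rcases hcase with e | ⟨e, hk⟩
    · rw [e] at key ⊢
      refine ⟨?_, by omega⟩
      by_contra hc
      have := b3 P (by omega) hPk
      have := hPv (by omega)
      omega
    · rcases ha with ⟨ha, -⟩ | ⟨a1, a2, a3, a4⟩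
      · omega
      rw [e] at key ⊢
      refine ⟨by omega, ?_⟩
      by_contra hc
      have := a3 N hkN (by omega)
      rcases hNv with hNv | hNv <;> omega
  · rintro ⟨hPl, hlN⟩
    have key := hbox _ hPl hlN
    have hcase : sl k = sb k ∨ sl k = sa k := by
      rw [hs, maxArgmax]
      split_ifs
      · exact Or.inl rfl
      · exact Or.inr rfl
      · exact max_choice _ _
    rcases hcase with e | e
    · rw [e] at key hPl hlN
      refine ⟨by omega, ?_⟩
      by_contra hc
      have := b3 N hlN.le (by omega)
      rcases hNv with hNv | hNv <;> omega
    · rw [e] at key hPl hlN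
      rcases ha with ⟨ha, -⟩ | ⟨a1, a2, a3, a4⟩
      · rw [ha, h10] at key
        refine ⟨by omega, ?_⟩
        rcases hNv with hNv | hNv <;> omega
      · refine ⟨?_, by omega⟩
        by_contra hc
        have := a3 P (by omega) (by omega)
        have := hPv (by omega)
        omega

theorem sb_le_sl (h : IsSLPR n bw lc sb sa sl) {k : ℕ} (h1 : 1 ≤ k) (h2 : k ≤ n) :
    sb k ≤ sl k := by
  obtain ⟨b1, b2, -⟩ := h.sb_spec h1 h2
  have ha := h.sa_spec h1 h2
  rw [h.sl_eq k h1 h2, maxArgmax]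
  split_ifs with c1 c2
  · exact le_rfl
  · rcases ha with ⟨ha, -⟩ | ⟨a1, -⟩
    · rw [ha, h.lc_one] at c1 c2; omega
    · omega
  · exact le_max_left _ _

theorem sl_le_of_break (h : IsSLPR n bw lc sb sa sl) {k i : ℕ} (h1 : 1 ≤ k) (hi : IsBreak n bw i)
    (hki : k < i) : sl k ≤ i := by
  have h2 := hi.2.1
  obtain ⟨b1, b2, -⟩ := h.sb_spec h1 (by omega)
  have ha : sa k ≤ i := by
    rcases h.sa_spec h1 (by omega) with ⟨ha, -⟩ | ⟨-, -, -, a4⟩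
    · omega
    · exact a4 i hi hki
  rw [h.sl_eq k h1 (by omega), maxArgmax]
  split_ifs <;> omega

theorem sl_le_succ (h : IsSLPR n bw lc sb sa sl) {k : ℕ} (h1 : 1 ≤ k) (h2 : k < n) :
    sl k ≤ sl (k + 1) := by
  by_cases hb : bw k = bw (k + 1)
  · have b := h.sb_spec h1 h2.le
    have b' := h.sb_step (k + 1) (by omega) h2
    have a := h.sa_spec (k := k + 1) (by omega) h2
    have a' := h.sa_step k h1 h2
    have h10 := h.lc_one
    rw [Nat.add_sub_cancel, if_neg (not_not.2 hb)] at b'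
    rw [if_neg (not_not.2 hb)] at a'
    rw [h.sl_eq k h1 h2.le, h.sl_eq (k + 1) (by omega) h2]
    obtain ⟨b1, b2, -⟩ := b
    replace a : (sa (k + 1) = 1 ∧ lc (sa (k + 1)) = 0) ∨ k + 1 < sa (k + 1) := by
      rcases a with ⟨a, -⟩ | ⟨a, -⟩
      · exact Or.inl ⟨a, by rw [a, h10]⟩
      · exact Or.inr a
    generalize sa (k + 1) = r at *
    generalize sb k = s at *
    rw [a', b']
    clear a' b' h hb
    rcases maxArgmin_cases lc (k + 1) r with ⟨e, c1, c2⟩ | ⟨e, c1, c2⟩ <;>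
    rcases maxArgmin_cases lc s (k + 1) with ⟨e', c3, c4⟩ | ⟨e', c3, c4⟩ <;>
    rw [e, e'] <;> unfold maxArgmax <;> split_ifs <;> omega
  · have hi : IsBreak n bw (k + 1) := ⟨by omega, h2, by simpa using hb⟩
    have := h.sl_le_of_break h1 hi (by omega)
    have := (h.sb_spec (k := k + 1) (by omega) h2).2.2.2 _ hi le_rfl
    have := h.sb_le_sl (k := k + 1) (by omega) h2
    omega

/-- The values in each of the lists are therefore sorted, since the rows in the lists are. -/
theorem sl_mono (h : IsSLPR n bw lc sb sa sl) {k k' : ℕ} (h1 : 1 ≤ k) (hk : k ≤ k') (h2 : k' ≤ n) :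
    sl k ≤ sl k' := by
  induction k' with
  | zero => omega
  | succ k' ih =>
    rcases Nat.lt_or_eq_of_le hk with hk | rfl
    · exact (ih (by omega) (by omega)).trans (h.sl_le_succ (by omega) (by omega))
    · exact le_rfl

end IsSLPR

/-! ### Suffixient sets and breaks of the Burrows-Wheeler transform -/

theorem agree_row_iff {X : List ℕ} (hX : IsTxt X.length (txt X)) {j k m : ℕ} (h1 : 1 ≤ j)
    (h2 : j ≤ k) (h3 : k ≤ X.length) :
    Agree (txt X) m (row X j) (row X k) ↔ ∀ l, j < l → l ≤ k → m ≤ LCP X l := by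
  constructor
  · intro h l h4 h5
    have hle : ∀ a b, 1 ≤ a → a ≤ b → b ≤ X.length → suf (txt X) (row X a) ≤ suf (txt X) (row X b) := by
      intro a b ha hab hb
      rcases Nat.lt_or_eq_of_le hab with hab | rfl
      exacts [(suf_row_lt hX ha hab hb).le, le_rfl]
    rw [le_LCP_iff hX (by omega) (by omega)]
    exact (h.between (hle j (l - 1) h1 (by omega) (by omega))
        (hle (l - 1) k (by omega) (by omega) h3)).symm.trans
      (h.between (hle j l h1 (by omega) (by omega)) (hle l k (by omega) (by omega) h3))
  · intro h
    induction k with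
    | zero => omega
    | succ k ih =>
      rcases Nat.lt_or_eq_of_le h2 with h2 | rfl
      · refine (ih (by omega) (by omega) fun l h4 h5 => h l h4 (by omega)).trans ?_
        exact (le_LCP_iff hX (by omega) h3).1 (h (k + 1) (by omega) le_rfl)
      · exact fun _ _ => rfl

/-- The rows between the previous and the next smaller value of `i` are those that share with the
row `i` the first `LCP[i]` characters. -/
theorem mem_box_iff_agree {X : List ℕ} (hX : IsTxt X.length (txt X)) {i k : ℕ} (hi1 : 2 ≤ i)
    (hi2 : i ≤ X.length) (h1 : 1 ≤ k) (h2 : k ≤ X.length) :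
    (PSV (LCP X) i ≤ k ∧ k < NSV X.length (LCP X) i) ↔
      Agree (txt X) (LCP X i) (row X k) (row X i) := by
  have hP := PSV_lt (LCP X) (i := i) (by omega)
  have hN := NSV_gt (n := X.length) (LCP X) hi2
  rcases Nat.le_total k i with hk | hk
  · rw [agree_row_iff hX h1 hk hi2]
    constructor
    · rintro ⟨h3, -⟩ l h4 h5
      rcases Nat.lt_or_eq_of_le h5 with h5 | rfl
      exacts [PSV_le_of_lt _ (by omega) h5, le_rfl]
    · intro h
      refine ⟨?_, by omega⟩
      by_contra hc
      have := h _ (not_le.1 hc) hP.le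
      have := PSV_val (LCP X) (i := i) (by omega)
      omega
  · constructor
    · rintro ⟨-, h3⟩
      exact ((agree_row_iff hX (by omega) hk h2).2 fun l h4 h5 =>
        le_of_lt_NSV h4 (lt_of_le_of_lt h5 h3)).symm
    · intro h
      replace h := (agree_row_iff hX (by omega) hk h2).1 h.symm
      refine ⟨by omega, ?_⟩
      by_contra hc
      rcases NSV_mem X.length (LCP X) i with hN' | hN'
      · omega
      · have := h _ hN (by omega)
        omega

/-- The string `u` occurs at position `p` of `X` (numbered from `0`). -/
def Occ (X : List ℕ) : List ℕ → ℕ → Prop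
  | [], _ => True
  | c :: u, p => 1 ≤ c ∧ txt X p = c ∧ Occ X u (p + 1)

theorem prefix_drop_iff {X : List ℕ} (hX : IsTxt X.length (txt X)) {u : List ℕ} {p : ℕ} :
    u <+: X.drop p ↔ Occ X u p := by
  induction u generalizing p with
  | nil => simp [Occ]
  | cons c u ih =>
    by_cases hp : p < X.length
    · have e : txt X p = X[p] := List.getD_eq_getElem _ _ hp
      have := hX.pos p hp
      rw [List.drop_eq_getElem_cons hp, List.cons_prefix_cons, ih, Occ, ← e]
      constructor
      · rintro ⟨h, h'⟩
        exact ⟨by omega, h.symm, h'⟩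
      · rintro ⟨-, h, h'⟩
        exact ⟨h.symm, h'⟩
    · rw [List.drop_eq_nil_of_le (by omega), Occ, hX.zero p (by omega)]
      refine iff_of_false (by simp) ?_
      rintro ⟨h, h', -⟩
      omega

theorem infix_iff_occ {T : List ℕ} (hX : IsTxt T.reverse.length (txt T.reverse)) {w : List ℕ} :
    w <:+: T ↔ ∃ p, Occ T.reverse w.reverse p := by
  rw [← List.reverse_infix, List.infix_iff_prefix_suffix]
  constructor
  · rintro ⟨v, h1, h2⟩
    rw [List.suffix_iff_eq_drop] at h2
    exact ⟨_, (prefix_drop_iff hX).1 (h2 ▸ h1)⟩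
  · rintro ⟨p, h⟩
    exact ⟨_, (prefix_drop_iff hX).2 h, List.drop_suffix _ _⟩

theorem suffix_take_iff_occ {T : List ℕ} (hX : IsTxt T.reverse.length (txt T.reverse)) {w : List ℕ}
    {x : ℕ} : w <:+ T.take x ↔ Occ T.reverse w.reverse (T.length - x) := by
  rw [← prefix_drop_iff hX, ← List.reverse_prefix, List.reverse_take]

theorem Occ.agree {X u p q} (h : Occ X u p) (h' : Occ X u q) : Agree (txt X) u.length p q := by
  induction u generalizing p q with
  | nil => intro k hk; simp at hk
  | cons c u ih =>
    intro k hk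
    cases k with
    | zero => exact h.2.1.trans h'.2.1.symm
    | succ k =>
      have := ih h.2.2 h'.2.2 k (by simpa using hk)
      rwa [Nat.add_right_comm, Nat.add_right_comm q] at this

theorem Occ.of_agree {X u p q m} (h : Occ X u p) (ha : Agree (txt X) m p q) (hm : u.length ≤ m) :
    Occ X u q := by
  induction u generalizing p q m with
  | nil => trivial
  | cons c u ih =>
    rw [List.length_cons] at hm
    refine ⟨h.1, (ha 0 (by omega)).symm.trans h.2.1, ih (m := m - 1) h.2.2 (fun k hk => ?_) (by omega)⟩
    have := ha (k + 1) (by omega)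
    rw [Nat.add_right_comm p, Nat.add_right_comm q]
    exact this

/-- The row of the character `T[x]` in the Burrows-Wheeler transform of the reversed text. -/
def bwtPos (X : List ℕ) (x : ℕ) : ℕ := ISA X ((X.length + 1 - x) % X.length + 1)

theorem bwtPos_mem {X : List ℕ} (h : 2 ≤ X.length) (x : ℕ) :
    1 ≤ bwtPos X x ∧ bwtPos X x ≤ X.length :=
  ISA_mem (by omega) (Nat.succ_le_of_lt (Nat.mod_lt _ (by omega)))

theorem row_bwtPos {X : List ℕ} (h : 2 ≤ X.length) (x : ℕ) :
    row X (bwtPos X x) = (X.length + 1 - x) % X.length := by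
  rw [row, bwtPos, SA_ISA (by omega) (Nat.succ_le_of_lt (Nat.mod_lt _ (by omega)))]; omega

theorem row_bwtPos_one {X : List ℕ} (h : 2 ≤ X.length) : row X (bwtPos X 1) = 0 := by
  rw [row_bwtPos h, Nat.add_sub_cancel, Nat.mod_self]

theorem row_bwtPos_of_two_le {X : List ℕ} (h : 2 ≤ X.length) {x : ℕ} (h1 : 2 ≤ x)
    (h2 : x ≤ X.length) : row X (bwtPos X x) = X.length + 1 - x := by
  rw [row_bwtPos h, Nat.mod_eq_of_lt (by omega)]

theorem row_inj {X : List ℕ} {i j : ℕ} (h1 : 1 ≤ i) (h2 : i ≤ X.length) (h3 : 1 ≤ j)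
    (h4 : j ≤ X.length) (h : row X i = row X j) : i = j := by
  have := SA_mem h1 h2
  have := SA_mem h3 h4
  rw [← ISA_SA h1 h2, ← ISA_SA h3 h4]
  simp only [row] at h
  congr 1; omega

theorem BWT_eq {X : List ℕ} {k : ℕ} (h1 : 1 ≤ k) (h2 : k ≤ X.length) :
    BWT X k = if row X k = 0 then txt X (X.length - 1) else txt X (row X k - 1) := by
  have := SA_mem h1 h2
  have : row X k = 0 ↔ SA X k = 1 := by simp only [row]; omega
  simp only [BWT, this, charAt_eq]
  rfl

theorem BWT_bwtPos {X : List ℕ} (h : 2 ≤ X.length) {x : ℕ} (h1 : 1 ≤ x) (h2 : x ≤ X.length) :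
    BWT X (bwtPos X x) = txt X (X.length - x) := by
  have hm := bwtPos_mem h x
  rw [BWT_eq hm.1 hm.2]
  rcases Nat.lt_or_eq_of_le h1 with h1 | rfl
  · rw [row_bwtPos_of_two_le h h1 h2, if_neg (by omega)]
    congr 1; omega
  · rw [row_bwtPos_one h, if_pos rfl]

/-- A reversed text: the end marker is its last character and occurs nowhere else. -/
structure IsRevTxt (X : List ℕ) : Prop where
  txt : IsTxt X.length (txt X)
  two_le : 2 ≤ X.length
  eq_one : ∀ i, SuffTest.txt X i = 1 ↔ i + 1 = X.length

theorem IsText.isRevTxt {σ : ℕ} {T : List ℕ} (hT : IsText σ T) : IsRevTxt T.reverse := by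
  refine ⟨isTxt_reverse hT, by simpa using hT.two_le, fun i => ?_⟩
  obtain ⟨h1, -, h3, h4⟩ := hT
  cases T with
  | nil => simp at h3
  | cons c T =>
    obtain rfl : c = 1 := by simpa using h3
    rw [List.count_cons_self, Nat.add_eq_right, List.count_eq_zero] at h4
    rw [txt, List.reverse_cons, List.length_append, List.length_singleton, Nat.add_right_cancel_iff]
    rcases lt_trichotomy i T.reverse.length with h | h | h
    · rw [List.getD_append _ _ _ _ h, List.getD_eq_getElem _ _ h]
      refine iff_of_false (fun hc => h4 ?_) h.ne
      rw [← List.mem_reverse, ← hc]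
      exact List.getElem_mem _
    · rw [h]; simp
    · rw [List.getD_eq_default _ _ (by simp at h ⊢; omega)]
      exact iff_of_false (by simp) h.ne'

namespace IsRevTxt
variable {X : List ℕ}

theorem occ_bwtPos (hX : IsRevTxt X) {c : ℕ} {u : List ℕ} {x : ℕ} (h1 : 1 ≤ x) (h2 : x ≤ X.length)
    (h : Occ X (c :: u) (X.length - x)) :
    BWT X (bwtPos X x) = c ∧ Occ X u (row X (bwtPos X x)) ∧ (c = 1 → u = []) := by
  have hu : x = 1 → u = [] := by
    rintro rfl
    cases u with
    | nil => rfl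
    | cons d u =>
      have h3 := h.2.2.1
      have h4 := h.2.2.2.1
      rw [hX.txt.zero _ (by omega)] at h4
      omega
  refine ⟨(BWT_bwtPos hX.two_le h1 h2).trans h.2.1, ?_, fun hc => ?_⟩
  · rcases Nat.lt_or_eq_of_le h1 with h3 | rfl
    · rw [row_bwtPos_of_two_le hX.two_le h3 h2]
      have := h.2.2
      rwa [show X.length - x + 1 = X.length + 1 - x by omega] at this
    · rw [hu rfl]; trivial
  · refine hu ?_
    have := (hX.eq_one _).1 (h.2.1.trans hc)
    omega

theorem occ_of_bwtPos (hX : IsRevTxt X) {c : ℕ} {u : List ℕ} {x : ℕ} (h1 : 1 ≤ x)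
    (h2 : x ≤ X.length) (hc : BWT X (bwtPos X x) = c) (hu : Occ X u (row X (bwtPos X x)))
    (hu' : c = 1 → u = []) : Occ X (c :: u) (X.length - x) := by
  rw [BWT_bwtPos hX.two_le h1 h2] at hc
  refine ⟨hc ▸ hX.txt.pos _ (by omega), hc, ?_⟩
  rcases Nat.lt_or_eq_of_le h1 with h3 | rfl
  · rw [row_bwtPos_of_two_le hX.two_le h3 h2] at hu
    rwa [show X.length - x + 1 = X.length + 1 - x by omega]
  · rw [hu' (hc.symm.trans ((hX.eq_one _).2 (by omega)))]
    trivial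

theorem exists_row_of_occ (hX : IsRevTxt X) {c : ℕ} {u : List ℕ} {p : ℕ}
    (h : Occ X (c :: u) p) : ∃ k, 1 ≤ k ∧ k ≤ X.length ∧ BWT X k = c ∧ Occ X u (row X k) ∧
      (c = 1 → u = []) := by
  have hp : p < X.length := by
    by_contra hc
    have h1 := h.1
    have h2 := h.2.1
    rw [hX.txt.zero p (by omega)] at h2
    omega
  have hm := bwtPos_mem hX.two_le (X.length - p)
  exact ⟨bwtPos X (X.length - p), hm.1, hm.2, hX.occ_bwtPos (by omega) (by omega)
    (by rwa [show X.length - (X.length - p) = p by omega])⟩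

end IsRevTxt

/-- Between two positions with different characters there is a break, and one that has a given one
of these characters on a side. -/
theorem exists_break {n : ℕ} {bw : ℕ → ℕ} {k k' : ℕ} (h1 : 1 ≤ k) (h2 : k ≤ n) (h3 : 1 ≤ k')
    (h4 : k' ≤ n) (h : bw k' ≠ bw k) :
    ∃ i, IsBreak n bw i ∧ min k k' < i ∧ i ≤ max k k' ∧ (bw (i - 1) = bw k ∨ bw i = bw k) := by
  rcases lt_trichotomy k k' with hk | rfl | hk
  · have hex : ∃ i, k < i ∧ bw i ≠ bw k := ⟨k', hk, h⟩
    classical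
    have hs := Nat.find_spec hex
    have hle := Nat.find_min' hex ⟨hk, h⟩
    have hmin : bw (Nat.find hex - 1) = bw k := by
      by_contra hc
      have := Nat.find_min' hex (m := Nat.find hex - 1)
        ⟨by
          rcases Nat.lt_or_eq_of_le (Nat.le_sub_one_of_lt hs.1) with h | h
          · exact h
          · rw [← h] at hc; exact absurd rfl hc, hc⟩
      omega
    exact ⟨_, ⟨by omega, by omega, by rw [hmin]; exact hs.2.symm⟩, by omega, by omega, Or.inl hmin⟩
  · exact absurd rfl h
  · have hex : ∃ i, k' < i ∧ bw i = bw k := ⟨k, hk, rfl⟩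
    classical
    have hs := Nat.find_spec hex
    have hle := Nat.find_min' hex ⟨hk, rfl⟩
    have hmin : bw (Nat.find hex - 1) ≠ bw k := by
      intro hc
      have := Nat.find_min' hex (m := Nat.find hex - 1)
        ⟨by
          rcases Nat.lt_or_eq_of_le (Nat.le_sub_one_of_lt hs.1) with h' | h'
          · exact h'
          · rw [← h'] at hc; exact absurd hc h, hc⟩
      omega
    exact ⟨_, ⟨by omega, by omega, by rw [hs.2]; exact hmin⟩, by omega, by omega, Or.inr hs.2⟩

/-- A set is suffixient if and only if for every break and both characters at it, it has an element
with this character whose row shares the context of the break. -/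
theorem suffixient_iff {T : List ℕ} (hX : IsRevTxt T.reverse) {S : Set ℕ}
    (hS : ∀ s ∈ S, 1 ≤ s ∧ s ≤ T.length) :
    Suffixient T S ↔ ∀ i, IsBreak T.length (BWT T.reverse) i → ∀ k, k = i - 1 ∨ k = i →
      ∃ s ∈ S, BWT T.reverse (bwtPos T.reverse s) = BWT T.reverse k ∧
        PSV (LCP T.reverse) i ≤ bwtPos T.reverse s ∧
        bwtPos T.reverse s < NSV T.length (LCP T.reverse) i := by
  have hlen : T.reverse.length = T.length := List.length_reverse
  have hXt := hX.txt
  constructor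
  · intro h i hi k hk
    obtain ⟨hi1, hi2, hib⟩ := hi
    have hk' : 1 ≤ k ∧ k ≤ T.length := by omega
    have ht : ∀ (w : List ℕ) (c : ℕ), RightMaximal T w → (∃ p, Occ T.reverse (c :: w.reverse) p) →
        ∃ x ∈ S, Occ T.reverse (c :: w.reverse) (T.reverse.length - x) := by
      intro w c hw hp
      obtain ⟨x, hx, hx'⟩ := h w c hw ((infix_iff_occ hXt).2 (by simpa using hp))
      rw [suffix_take_iff_occ hXt] at hx'
      exact ⟨x, hx, by simpa using hx'⟩
    have hP := PSV_lt (LCP T.reverse) (i := i) (by omega)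
    have hN := NSV_gt (n := T.length) (LCP T.reverse) hi2
    rw [← hlen] at hk' hi2 hS
    by_cases h0 : row T.reverse k = 0
    · -- the character is the end marker: every suffixient set contains `1`
      obtain ⟨x, hx, hx'⟩ := ht [] 1 ⟨⟨T, [], by simp⟩, Or.inl ⟨T, by simp⟩⟩
        ⟨T.reverse.length - 1, le_rfl, (hX.eq_one _).2 (by have := hX.two_le; omega), trivial⟩
      have hxS := hS x hx
      have hx1 := (hX.eq_one _).1 hx'.2.1
      obtain rfl : x = 1 := by omega
      have hm := bwtPos_mem hX.two_le 1
      have : bwtPos T.reverse 1 = k :=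
        row_inj hm.1 hm.2 hk'.1 hk'.2 (by rw [row_bwtPos_one hX.two_le, h0])
      exact ⟨1, hx, by rw [this], by omega, by omega⟩
    · obtain ⟨u, hu⟩ : ∃ u, u = (T.reverse.drop (row T.reverse i)).take (LCP T.reverse i) := ⟨_, rfl⟩
      have ha : Agree (txt T.reverse) (LCP T.reverse i) (row T.reverse (i - 1)) (row T.reverse i) :=
        (le_LCP_iff hXt hi1 hi2).1 le_rfl
      have hri := row_lt (X := T.reverse) (i := i) (by omega) hi2
      have hri' := row_lt (X := T.reverse) (i := i - 1) (by omega) (by omega)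
      have hb := hXt.agree_bound hri'.le hri.le (fun h => by
        have := row_inj (by omega) (by omega) (by omega) hi2 h; omega) ha
      have hul : u.length = LCP T.reverse i := by
        rw [hu, List.length_take, List.length_drop]; omega
      have hocc : Occ T.reverse u (row T.reverse i) :=
        (prefix_drop_iff hXt).1 (hu ▸ List.take_prefix _ _)
      have hocc' : Occ T.reverse u (row T.reverse (i - 1)) := hocc.of_agree ha.symm hul.le
      have hside : ∀ l, l = i - 1 ∨ l = i → row T.reverse l ≠ 0 →
          Occ T.reverse (BWT T.reverse l :: u) (row T.reverse l - 1) := by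
        intro l hl hl0
        have hlr := row_lt (X := T.reverse) (i := l) (by omega) (by omega)
        rw [BWT_eq (by omega) (by omega), if_neg hl0]
        refine ⟨hXt.pos _ (by omega), rfl, ?_⟩
        rw [Nat.sub_add_cancel (by omega)]
        rcases hl with rfl | rfl
        exacts [hocc', hocc]
      have hinf : ∀ l, l = i - 1 ∨ l = i → row T.reverse l ≠ 0 →
          u.reverse ++ [BWT T.reverse l] <:+: T := fun l hl hl0 =>
        (infix_iff_occ hXt).2 ⟨_, by simpa using hside l hl hl0⟩
      have hrm : RightMaximal T u.reverse := by
        refine ⟨(infix_iff_occ hXt).2 ⟨_, by simpa using hocc⟩, ?_⟩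
        by_cases hz : row T.reverse (i - 1) = 0 ∨ row T.reverse i = 0
        · left
          have h1 : Occ T.reverse u 0 := by
            rcases hz with hz | hz
            · rwa [hz] at hocc'
            · rwa [hz] at hocc
          rw [← List.take_length (l := T), suffix_take_iff_occ hXt, List.reverse_reverse,
            Nat.sub_self]
          exact h1
        · rw [not_or] at hz
          exact Or.inr ⟨_, _, hib, hinf _ (Or.inl rfl) hz.1, hinf _ (Or.inr rfl) hz.2⟩
      obtain ⟨x, hx, hx'⟩ := ht _ _ hrm ⟨_, by simpa using hside k hk h0⟩
      rw [List.reverse_reverse] at hx'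
      obtain ⟨g1, g2, -⟩ := hX.occ_bwtPos (hS x hx).1 (hS x hx).2 hx'
      have hm := bwtPos_mem hX.two_le x
      refine ⟨x, hx, g1, ?_⟩
      rw [← hlen, mem_box_iff_agree hXt hi1 hi2 hm.1 hm.2, ← hul]
      exact g2.agree hocc
  · intro h w c hw hwc
    obtain ⟨p, hp⟩ := (infix_iff_occ hXt).1 hwc
    rw [List.reverse_append, List.reverse_singleton, List.singleton_append] at hp
    obtain ⟨k, hk1, hk2, hkc, hku, hc1⟩ := hX.exists_row_of_occ hp
    have hother : ∃ k', 1 ≤ k' ∧ k' ≤ T.reverse.length ∧ BWT T.reverse k' ≠ c ∧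
        Occ T.reverse w.reverse (row T.reverse k') := by
      have hbr : ∀ a, a ≠ c → w ++ [a] <:+: T → ∃ k', 1 ≤ k' ∧ k' ≤ T.reverse.length ∧
          BWT T.reverse k' ≠ c ∧ Occ T.reverse w.reverse (row T.reverse k') := by
        intro a hac ha
        obtain ⟨q, hq⟩ := (infix_iff_occ hXt).1 ha
        rw [List.reverse_append, List.reverse_singleton, List.singleton_append] at hq
        obtain ⟨k', h1, h2, h3, h4, -⟩ := hX.exists_row_of_occ hq
        exact ⟨k', h1, h2, h3 ▸ hac, h4⟩
      rcases hw.2 with hsuf | ⟨a, b, hab, ha, hb⟩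
      · have h2 := hX.two_le
        by_cases hc : c = 1
        · -- the context is empty, and the text has a further character
          have hm := bwtPos_mem hX.two_le 2
          refine ⟨_, hm.1, hm.2, ?_, by rw [hc1 hc]; trivial⟩
          rw [BWT_bwtPos h2 (by omega) h2, hc, Ne, hX.eq_one]
          omega
        · have hm := bwtPos_mem hX.two_le 1
          refine ⟨_, hm.1, hm.2, ?_, ?_⟩
          · rw [BWT_bwtPos h2 le_rfl (by omega), (hX.eq_one _).2 (by omega)]
            exact fun h => hc h.symm
          · rw [row_bwtPos_one h2]
            rw [← List.take_length (l := T), suffix_take_iff_occ hXt, Nat.sub_self] at hsuf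
            exact hsuf
      · by_cases hac : a = c
        · exact hbr b (fun h => hab (hac.trans h.symm)) hb
        · exact hbr a hac ha
    obtain ⟨k', hk1', hk2', hkc', hku'⟩ := hother
    obtain ⟨i, hi, hlo, hhi, hic⟩ := exists_break (bw := BWT T.reverse) hk1 hk2 hk1' hk2' (hkc ▸ hkc')
    have hagree : Agree (txt T.reverse) w.reverse.length (row T.reverse k) (row T.reverse i) ∧
        w.reverse.length ≤ LCP T.reverse i := by
      have ha := hku.agree hku'
      rcases Nat.le_total k k' with hkk | hkk
      · rw [agree_row_iff hXt hk1 hkk hk2'] at ha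
        rw [min_eq_left hkk] at hlo
        rw [max_eq_right hkk] at hhi
        refine ⟨?_, ha i hlo hhi⟩
        rw [agree_row_iff hXt hk1 hlo.le hi.2.1]
        exact fun l h1 h2 => ha l h1 (by omega)
      · have ha := ha.symm
        rw [agree_row_iff hXt hk1' hkk hk2] at ha
        rw [min_eq_right hkk] at hlo
        rw [max_eq_left hkk] at hhi
        refine ⟨Agree.symm ?_, ha i hlo hhi⟩
        rw [agree_row_iff hXt (by omega) hhi hk2]
        exact fun l h1 h2 => ha l (by omega) h2
    obtain ⟨s, hs, hsc, hbox⟩ : ∃ s ∈ S, BWT T.reverse (bwtPos T.reverse s) = c ∧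
        PSV (LCP T.reverse) i ≤ bwtPos T.reverse s ∧
        bwtPos T.reverse s < NSV T.length (LCP T.reverse) i := by
      rw [hlen] at hi
      rcases hic with hic | hic
      · obtain ⟨s, hs, h1, h2⟩ := h i hi (i - 1) (Or.inl rfl)
        exact ⟨s, hs, by rw [h1, hic, hkc], h2⟩
      · obtain ⟨s, hs, h1, h2⟩ := h i hi i (Or.inr rfl)
        exact ⟨s, hs, by rw [h1, hic, hkc], h2⟩
    have hm := bwtPos_mem hX.two_le s
    rw [← hlen, mem_box_iff_agree hXt hi.1 hi.2.1 hm.1 hm.2] at hbox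
    have hS' := hS s hs
    rw [← hlen] at hS'
    refine ⟨s, hs, ?_⟩
    rw [suffix_take_iff_occ hXt, List.reverse_append, List.reverse_singleton, List.singleton_append,
      ← hlen]
    refine hX.occ_of_bwtPos hS'.1 hS'.2 hsc ?_ hc1
    exact (hku.of_agree hagree.1 le_rfl).of_agree hbox.symm hagree.2

/-! ### The given programs: `SLPR` and the sorted set of rows -/

theorem maxArgmin_congr {A A' : ℕ → ℕ} {x y : ℕ} (hx : A x = A' x) (hy : A y = A' y) :
    maxArgmin A x y = maxArgmin A' x y := by
  simp only [maxArgmin, hx, hy]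

theorem maxArgmax_congr {A A' : ℕ → ℕ} {x y : ℕ} (hx : A x = A' x) (hy : A y = A' y) :
    maxArgmax A x y = maxArgmax A' x y := by
  simp only [maxArgmax, hx, hy]

theorem vc_putMaxArgmin {B W : ℕ} {s : State} {a : ℕ} {dst x y : Expr} {Q : State → Prop}
    {R : ℕ → Prop} (hd : dst.Safe B W s) (hx : x.Safe B W s) (hy : y.Safe B W s)
    (hd' : dst.val s < B) (hx' : x.val s < B) (hy' : y.val s < B)
    (h : Q (s.setArr a (dst.val s) (maxArgmin (s.arr aLCP) (x.val s) (y.val s)))) :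
    (putMaxArgmin a dst x y).vc B W s Q R := by
  simp only [putMaxArgmin, Cmd.vc, Expr.Safe, Expr.val, BinOp.Ok, BinOp.eval, hd, hx, hy, hd', hx',
    hy', true_and, maxArgmin] at h ⊢
  by_cases c1 : s.arr aLCP (x.val s) < s.arr aLCP (y.val s) <;>
  by_cases c2 : s.arr aLCP (y.val s) < s.arr aLCP (x.val s) <;>
  by_cases c3 : x.val s < y.val s <;>
  simp only [c1, c2, c3, if_true, if_false, true_and, max_eq_right, max_eq_left,
    max_eq_right_of_lt, le_of_not_gt, not_false_eq_true, ne_eq, one_ne_zero, not_true_eq_false,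
    zero_ne_one, false_imp_iff, true_imp_iff, and_true, and_self] at h ⊢ <;>
  exact h

theorem vc_putMaxArgmax {B W : ℕ} {s : State} {a : ℕ} {dst x y : Expr} {Q : State → Prop}
    {R : ℕ → Prop} (hd : dst.Safe B W s) (hx : x.Safe B W s) (hy : y.Safe B W s)
    (hd' : dst.val s < B) (hx' : x.val s < B) (hy' : y.val s < B)
    (h : Q (s.setArr a (dst.val s) (maxArgmax (s.arr aLCP) (x.val s) (y.val s)))) :
    (putMaxArgmax a dst x y).vc B W s Q R := by
  simp only [putMaxArgmax, Cmd.vc, Expr.Safe, Expr.val, BinOp.Ok, BinOp.eval, hd, hx, hy, hd', hx',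
    hy', true_and, maxArgmax] at h ⊢
  by_cases c1 : s.arr aLCP (x.val s) < s.arr aLCP (y.val s) <;>
  by_cases c2 : s.arr aLCP (y.val s) < s.arr aLCP (x.val s) <;>
  by_cases c3 : x.val s < y.val s <;>
  simp only [c1, c2, c3, if_true, if_false, true_and, max_eq_right, max_eq_left,
    max_eq_right_of_lt, le_of_not_gt, not_false_eq_true, ne_eq, one_ne_zero, not_true_eq_false,
    zero_ne_one, false_imp_iff, true_imp_iff, and_true, and_self] at h ⊢ <;>
  exact h

theorem maxArgmin_mem {A : ℕ → ℕ} {x y n : ℕ} (hx : 1 ≤ x ∧ x ≤ n) (hy : 1 ≤ y ∧ y ≤ n) :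
    1 ≤ maxArgmin A x y ∧ maxArgmin A x y ≤ n := by
  unfold maxArgmin
  split_ifs <;> omega

theorem run_computeSLPR {B W n : ℕ} {bw lc : ℕ → ℕ} {s : State} {t : ℕ} {R : ℕ → ℕ → Prop}
    (hBW : B ≤ W) (hB : 20 * n + 16 ≤ B) (hn : 2 ≤ n) (hN : s.reg rN = n)
    (hbw : ∀ i, 1 ≤ i → i ≤ n → s.arr aBWT i = bw i)
    (hlc : ∀ i, 1 ≤ i → i ≤ n → s.arr aLCP i = lc i) (hlc1 : lc 1 = 0) :
    Run B W computeSLPR s t (fun s' t' => t' ≤ t + 500 * (n + 1) ∧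
      ∃ sb sa, IsSLPR n bw lc sb sa (s'.arr aSLPR)) R := by
  have hW1 : 1 < W := by omega
  refine Run.block_cons ?_
  refine Run.up_vc 1 n 30 (fun i s' => ∀ k, 1 ≤ k → k < i → s'.arr aSAPR k = 1 ∧ s'.arr aSBPR k = 1)
    (by decide) (by omega) hW1 (by omega) rfl ⟨by simp; omega, by simp⟩
    (fun s' hF => ⟨by simp, by simp [hF.1 rN rfl, hN]⟩) (fun k h1 h2 => by omega) ?_ ?_
  · intro i s' h1 h2 h3 hF hI
    simp +decide only [block, Cmd.vc, Expr.Safe, Expr.val, Expr.val_ofNat, Expr.safe_ofNat,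
      State.setArr_reg, State.setArr_arr, State.setReg_arr, h3, reduceIte]
    and_intros <;> try first | trivial | omega
    intro k h4 h5
    by_cases hk : k = i
    · subst hk; simp
    · rw [Function.update_of_ne hk, Function.update_of_ne hk]
      exact hI k h4 (by omega)
  intro s₁ t₁ ht₁ _ hF₁ hI₁
  have hN₁ : s₁.reg rN = n := (hF₁.1 rN rfl).trans hN
  have hbw₁ : s₁.arr aBWT = s.arr aBWT := hF₁.2 aBWT rfl
  have hlc₁ : s₁.arr aLCP = s.arr aLCP := hF₁.2 aLCP rfl
  refine Run.block_cons ?_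
  refine Run.up_vc 2 n 60 (fun i s' => s'.arr aSBPR 1 = 1 ∧
    (∀ k, 1 ≤ k → k < i → 1 ≤ s'.arr aSBPR k ∧ s'.arr aSBPR k ≤ n) ∧
    ∀ k, 2 ≤ k → k < i → s'.arr aSBPR k =
      if bw (k - 1) ≠ bw k then k else maxArgmin lc (s'.arr aSBPR (k - 1)) k)
    (by decide) (by omega) hW1 (by omega) rfl ⟨by simp; omega, by simp⟩
    (fun s' hF => ⟨by simp, by simp [hF.1 rN rfl, hN₁]⟩) ?_ ?_ ?_
  · refine ⟨(hI₁ 1 le_rfl (by omega)).2, fun k h1 h2 => ?_, fun k h1 h2 => by omega⟩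
    rw [State.setReg_arr, (hI₁ k h1 (by omega)).2]
    omega
  · rintro i s' h1 h2 h3 hF ⟨g1, g2, g3⟩
    have e1 := hbw (i - 1) (by omega) (by omega)
    have e2 := hbw i (by omega) (by omega)
    have e3 := hlc i (by omega) (by omega)
    have hm := g2 (i - 1) (by omega) (by omega)
    have e4 := hlc _ hm.1 hm.2
    have hlcs : s'.arr aLCP = s.arr aLCP := (hF.2 aLCP rfl).trans hlc₁
    have hput : ∀ x, 1 ≤ x → x ≤ n →
        (x = if bw (i - 1) ≠ bw i then i else maxArgmin lc (s'.arr aSBPR (i - 1)) i) →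
        (fun s'' : State => s''.arr aSBPR 1 = 1 ∧
          (∀ k, 1 ≤ k → k < i + 1 → 1 ≤ s''.arr aSBPR k ∧ s''.arr aSBPR k ≤ n) ∧
          ∀ k, 2 ≤ k → k < i + 1 → s''.arr aSBPR k =
            if bw (k - 1) ≠ bw k then k else maxArgmin lc (s''.arr aSBPR (k - 1)) k)
          ((s'.setArr aSBPR i x).setReg rI (i + 1)) := by
      intro x hx1 hx2 hx
      simp +decide only [State.setReg_arr, State.setArr_arr, reduceIte]
      refine ⟨by rwa [Function.update_of_ne (by omega)], fun k h4 h5 => ?_, fun k h4 h5 => ?_⟩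
      · by_cases hk : k = i
        · subst hk; rw [Function.update_self]; omega
        · rw [Function.update_of_ne hk]; exact g2 k h4 (by omega)
      · by_cases hk : k = i
        · subst hk
          rw [Function.update_self, Function.update_of_ne (by omega)]
          exact hx
        · rw [Function.update_of_ne hk, Function.update_of_ne (by omega)]
          exact g3 k h4 (by omega)
    simp only [Cmd.vc, Expr.Safe, Expr.val, BinOp.Ok, BinOp.eval, Expr.sub_def, Expr.val_ofNat,
      Expr.safe_ofNat, hF.2 aBWT rfl, hbw₁, h3, e1, e2]
    refine ⟨by and_intros <;> first | trivial | omega, fun hc => ?_, fun hc => ?_⟩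
    · refine ⟨trivial, trivial, by omega, hput i (by omega) h2 ?_⟩
      rw [if_pos]
      intro h; simp [h] at hc
    · refine vc_putMaxArgmin ?_ ?_ ?_ ?_ ?_ ?_ ?_
      all_goals simp only [Expr.Safe, Expr.val, BinOp.Ok, BinOp.eval, Expr.sub_def, Expr.val_ofNat,
        Expr.safe_ofNat, h3]
      any_goals first | trivial | omega
      · and_intros <;> first | trivial | omega
      · rw [hlcs, maxArgmin_congr e4 e3]
        have := maxArgmin_mem (A := lc) hm (y := i) (by omega)
        refine hput _ this.1 this.2 ?_
        rw [if_neg]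
        intro h; simp [h] at hc
  intro s₂ t₂ ht₂ _ hF₂ ⟨g1, g2, g3⟩
  have hN₂ : s₂.reg rN = n := (hF₂.1 rN rfl).trans hN₁
  have hbw₂ : s₂.arr aBWT = s.arr aBWT := (hF₂.2 aBWT rfl).trans hbw₁
  have hlc₂ : s₂.arr aLCP = s.arr aLCP := (hF₂.2 aLCP rfl).trans hlc₁
  have hsa₂ : s₂.arr aSAPR n = 1 := by
    rw [hF₂.2 aSAPR rfl]; exact (hI₁ n (by omega) (by omega)).1
  refine Run.block_cons ?_
  refine Run.block_cons ?_
  refine Run.of_vc hW1 ?_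
  simp only [Cmd.vc, Expr.Safe, Expr.val, BinOp.Ok, BinOp.eval, Expr.sub_def, Expr.val_ofNat,
    Expr.safe_ofNat, hN₂]
  refine ⟨by and_intros <;> first | trivial | omega, fun t₃ ht₃ => ?_⟩
  replace ht₃ : t₃ ≤ t₂ + 4 := ht₃
  refine Run.loop hW1 (fun s' t' => s'.reg rJ ≤ n - 1 ∧ s'.arr aSAPR n = 1 ∧
    s'.reg rN = n ∧ s'.arr aBWT = s.arr aBWT ∧ s'.arr aLCP = s.arr aLCP ∧
    s'.arr aSBPR = s₂.arr aSBPR ∧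
    (∀ k, s'.reg rJ < k → k ≤ n → 1 ≤ s'.arr aSAPR k ∧ s'.arr aSAPR k ≤ n) ∧
    (∀ k, s'.reg rJ < k → k < n → s'.arr aSAPR k =
      if bw k ≠ bw (k + 1) then k + 1 else maxArgmin lc (k + 1) (s'.arr aSAPR (k + 1))) ∧
    t' + 60 * s'.reg rJ ≤ t₃ + 60 * (n - 1)) (t₃ + 60 * (n - 1)) ?_ ?_ ?_ ?_ ?_
  · simp +decide only [State.setReg_reg, State.setReg_arr, reduceIte]
    refine ⟨le_rfl, hsa₂, hN₂, hbw₂, hlc₂, trivial, fun k h1 h2 => ?_, fun k h1 h2 => by omega, le_rfl⟩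
    obtain rfl : k = n := by omega
    rw [hsa₂]; omega
  · rintro s' t' ⟨-, -, -, -, -, -, -, -, h⟩
    omega
  · intro s' t' _
    simp only [Expr.Safe, BinOp.Ok, Expr.safe_ofNat]
    exact ⟨hW1, trivial, trivial⟩
  · rintro s₄ t₄ ⟨f1, f2, f3, f4, f5, f6, f7, f8, f9⟩ - hval
    have hJ : s₄.reg rJ = 0 := by
      change (if 1 ≤ s₄.reg rJ then 1 else 0 : ℕ) = 0 at hval
      by_contra hc
      rw [if_pos (by omega)] at hval
      exact one_ne_zero hval
    rw [hJ] at f7 f8 f9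
    replace f9 : t₄ + (Expr.cost (le 1 (v rJ)) + 1) ≤ t₃ + 60 * (n - 1) + 4 :=
      Nat.add_le_add_right f9 4
    generalize t₄ + (Expr.cost (le 1 (v rJ)) + 1) = t₅ at f9
    refine Run.up_map 1 n 60 aSLPR 0
      (fun k => maxArgmax lc (s₄.arr aSBPR k) (s₄.arr aSAPR k)) (by decide) (by omega) hW1
      (by omega) rfl ⟨by simp; omega, by simp⟩
      (fun s' hF => ⟨by simp, by simp [hF.1 rN rfl, f3]⟩) ?_ ?_
    · intro i s' h1 h2 h3 hF hI
      have b1 := g2 i h1 (by omega)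
      have b2 := f7 i h1 h2
      rw [← f6] at b1
      refine vc_putMaxArgmax ?_ ?_ ?_ ?_ ?_ ?_ ?_
      all_goals simp only [Expr.Safe, Expr.val, h3, hF.2 aSBPR rfl, hF.2 aSAPR rfl, hF.2 aLCP rfl,
        State.setArr_arr, if_true, Nat.zero_add]
      any_goals first | trivial | omega
      · exact ⟨trivial, by omega⟩
      · exact ⟨trivial, by omega⟩
      · rw [f5, maxArgmax_congr (hlc _ b1.1 b1.2) (hlc _ b2.1 b2.2)]
    · intro s₆ t₆ ht₆ h3 hF hI
      refine ⟨by omega, s₄.arr aSBPR, s₄.arr aSAPR, ⟨hlc1, by rw [f6]; exact g1, fun i h1 h2 => ?_, f2,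
        fun j h1 h2 => f8 j h1 h2, fun k h1 h2 => ?_⟩⟩
      · rw [f6]; exact g3 i h1 (by omega)
      · rw [hI k, if_pos (by omega), Nat.sub_zero]
  · rintro s' t' ⟨f1, f2, f3, f4, f5, f6, f7, f8, f9⟩ - hval
    have hJ : 1 ≤ s'.reg rJ := by
      by_contra hc
      change (if 1 ≤ s'.reg rJ then 1 else 0 : ℕ) ≠ 0 at hval
      rw [if_neg hc] at hval
      exact hval rfl
    obtain ⟨j, hj⟩ : ∃ j, j = s'.reg rJ := ⟨_, rfl⟩
    rw [← hj] at f1 f7 f8 f9 hJ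
    have e1 := hbw j hJ (by omega)
    have e2 := hbw (j + 1) (by omega) (by omega)
    have e3 := hlc (j + 1) (by omega) (by omega)
    have hm := f7 (j + 1) (by omega) (by omega)
    have e4 := hlc _ hm.1 hm.2
    have hput : ∀ x, 1 ≤ x → x ≤ n →
        (x = if bw j ≠ bw (j + 1) then j + 1 else maxArgmin lc (j + 1) (s'.arr aSAPR (j + 1))) →
        ∀ t'' ≤ t' + (Expr.cost (le 1 (v rJ)) + 1) + 50,
        (fun (s'' : State) t'' => s''.reg rJ ≤ n - 1 ∧ s''.arr aSAPR n = 1 ∧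
          s''.reg rN = n ∧ s''.arr aBWT = s.arr aBWT ∧ s''.arr aLCP = s.arr aLCP ∧
          s''.arr aSBPR = s₂.arr aSBPR ∧
          (∀ k, s''.reg rJ < k → k ≤ n → 1 ≤ s''.arr aSAPR k ∧ s''.arr aSAPR k ≤ n) ∧
          (∀ k, s''.reg rJ < k → k < n → s''.arr aSAPR k =
            if bw k ≠ bw (k + 1) then k + 1 else maxArgmin lc (k + 1) (s''.arr aSAPR (k + 1))) ∧
          t'' + 60 * s''.reg rJ ≤ t₃ + 60 * (n - 1))
          ((s'.setArr aSAPR j x).setReg rJ (j - 1)) t'' := by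
      intro x hx1 hx2 hx t'' ht''
      replace ht'' : t'' ≤ t' + 4 + 50 := ht''
      simp +decide only [State.setReg_arr, State.setArr_arr, State.setReg_reg, State.setArr_reg,
        reduceIte]
      refine ⟨by omega, by rwa [Function.update_of_ne (by omega)], f3, f4, f5, f6,
        fun k h4 h5 => ?_, fun k h4 h5 => ?_, by omega⟩
      · by_cases hk : k = j
        · subst hk; rw [Function.update_self]; omega
        · rw [Function.update_of_ne hk]; exact f7 k (by omega) h5
      · by_cases hk : k = j
        · subst hk
          rw [Function.update_self, Function.update_of_ne (by omega)]
          exact hx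
        · rw [Function.update_of_ne hk, Function.update_of_ne (by omega)]
          exact f8 k (by omega) h5
    have hW' : n + 1 < W := by omega
    refine Run.block_cons (Run.of_vc hW1 ?_)
    have hset : ∀ x, 1 ≤ x → x ≤ n →
        (x = if bw j ≠ bw (j + 1) then j + 1 else maxArgmin lc (j + 1) (s'.arr aSAPR (j + 1))) →
        ∀ t'' ≤ t' + (Expr.cost (le 1 (v rJ)) + 1) + 46,
        Run B W (block [.set rJ (v rJ - 1)]) (s'.setArr aSAPR j x) t'' (fun s'' t'' =>
          s''.reg rJ ≤ n - 1 ∧ s''.arr aSAPR n = 1 ∧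
          s''.reg rN = n ∧ s''.arr aBWT = s.arr aBWT ∧ s''.arr aLCP = s.arr aLCP ∧
          s''.arr aSBPR = s₂.arr aSBPR ∧
          (∀ k, s''.reg rJ < k → k ≤ n → 1 ≤ s''.arr aSAPR k ∧ s''.arr aSAPR k ≤ n) ∧
          (∀ k, s''.reg rJ < k → k < n → s''.arr aSAPR k =
            if bw k ≠ bw (k + 1) then k + 1 else maxArgmin lc (k + 1) (s''.arr aSAPR (k + 1))) ∧
          t'' + 60 * s''.reg rJ ≤ t₃ + 60 * (n - 1)) R := by
      intro x hx1 hx2 hx t'' ht''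
      refine Run.of_vc hW1 ?_
      simp only [block, Cmd.vc, Expr.Safe, Expr.val, BinOp.Ok, BinOp.eval, Expr.sub_def,
        Expr.val_ofNat, Expr.safe_ofNat, State.setArr_reg, ← hj]
      refine ⟨by and_intros <;> first | trivial | omega, fun t₅ ht₅ => ?_⟩
      replace ht₅ : t₅ ≤ t'' + 4 := ht₅
      exact hput x hx1 hx2 hx t₅ (by omega)
    simp only [Cmd.vc, Expr.Safe, Expr.val, BinOp.Ok, BinOp.eval, Expr.add_def, Expr.val_ofNat,
      Expr.safe_ofNat, f4, ← hj, e1, e2]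
    refine ⟨by and_intros <;> first | trivial | omega, fun hc => ?_, fun hc => ?_⟩
    · refine ⟨trivial, by and_intros <;> first | trivial | omega, by omega, fun t'' ht'' => ?_⟩
      refine hset (j + 1) (by omega) (by omega) ?_ t'' (ht''.trans (Nat.add_le_add_left (by decide) _))
      rw [if_pos]
      intro h; simp [h] at hc
    · refine vc_putMaxArgmin ?_ ?_ ?_ ?_ ?_ ?_ ?_
      all_goals simp only [Expr.Safe, Expr.val, BinOp.Ok, BinOp.eval, Expr.add_def, Expr.val_ofNat,
        Expr.safe_ofNat, ← hj]
      any_goals first | trivial | omega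
      · and_intros <;> first | trivial | omega
      · and_intros <;> first | trivial | omega
      · rw [f5, maxArgmin_congr e3 e4]
        have := maxArgmin_mem (A := lc) (x := j + 1) (by omega) hm
        intro t'' ht''
        refine hset _ this.1 this.2 ?_ t'' (ht''.trans (Nat.add_le_add_left (by decide) _))
        rw [if_neg]
        intro h; simp [h] at hc

theorem run_computeA {B W n m : ℕ} {ps : ℕ → ℕ} {s : State} {t : ℕ} {R : ℕ → ℕ → Prop}
    (hBW : B ≤ W) (hB : 20 * n + 16 ≤ B) (hn : 2 ≤ n) (hm : m ≤ n) (hN : s.reg rN = n)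
    (hM : s.reg rM = m) (hS : ∀ k, 1 ≤ k → k ≤ m → 1 ≤ s.arr aS k ∧ s.arr aS k ≤ n)
    (hps : ∀ x, 1 ≤ x → x ≤ n → s.arr aISA ((n + 1 - x) % n + 1) = ps x) :
    Run B W computeA s t (fun s' t' => t' ≤ t + 50 * (n + 1) ∧
      ∀ k, 1 ≤ k → k ≤ m → s'.arr aA k = ps (s.arr aS k)) R := by
  have hW1 : 1 < W := by omega
  refine Run.up_map 1 m 30 aA 0 (fun k => ps (s.arr aS k)) (by decide) (by omega) hW1
    (by omega) rfl ⟨by simp; omega, by simp⟩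
    (fun s' hF => ⟨by simp, by simp [hF.1 rM rfl, hM]⟩) ?_ ?_
  · intro i s' h1 h2 h3 hF hI
    have hi := hS i h1 h2
    have hmod := Nat.mod_lt (n + 1 - s.arr aS i) (by omega : n > 0)
    have hp := hps _ hi.1 hi.2
    simp only [Cmd.vc, Expr.Safe, Expr.val, BinOp.Ok, BinOp.eval, Expr.add_def, Expr.sub_def,
      Expr.mod_def, Expr.val_ofNat, Expr.safe_ofNat, hF.2 aS rfl, hF.2 aISA rfl, hF.1 rN rfl, hN, h3,
      hp, State.setArr_arr, if_true, Nat.zero_add]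
    and_intros <;> first | trivial | omega
  · intro s' t' ht h3 hF hI
    refine ⟨by omega, fun k h1 h2 => ?_⟩
    rw [hI k, if_pos (by omega), Nat.sub_zero]

/-- The first `b` cells of the array `D` enumerate a set of rows in increasing order. -/
structure Enumerates (n b : ℕ) (D : ℕ → ℕ) (P : ℕ → Prop) : Prop where
  le : b ≤ n
  mem : ∀ k, 1 ≤ k → k ≤ b → 1 ≤ D k ∧ D k ≤ n
  lt : ∀ k k', 1 ≤ k → k < k' → k' ≤ b → D k < D k'
  iff : ∀ j, 1 ≤ j → j ≤ n → (P j ↔ ∃ k, 1 ≤ k ∧ k ≤ b ∧ D k = j)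

theorem run_sortA {B W n m : ℕ} {s : State} {t : ℕ} {R : ℕ → ℕ → Prop}
    (hBW : B ≤ W) (hB : 20 * n + 16 ≤ B) (hn : 2 ≤ n) (hm : m ≤ n) (hN : s.reg rN = n)
    (hM : s.reg rM = m) (hA : ∀ k, 1 ≤ k → k ≤ m → 1 ≤ s.arr aA k ∧ s.arr aA k ≤ n) :
    Run B W sortA s t (fun s' t' => t' ≤ t + 200 * (n + 1) ∧
      Enumerates n (s'.reg rB) (s'.arr aB) (fun j => ∃ k, 1 ≤ k ∧ k ≤ m ∧ s.arr aA k = j)) R := by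
  have hW1 : 1 < W := by omega
  refine Run.block_cons ?_
  refine Run.up_map 1 n 30 aMark 0 (fun _ => 0) (by decide) (by omega) hW1
    (by omega) rfl ⟨by simp; omega, by simp⟩
    (fun s' hF => ⟨by simp, by simp [hF.1 rN rfl, hN]⟩) ?_ ?_
  · intro i s' h1 h2 h3 hF hI
    simp [h3]
    omega
  intro s₁ t₁ ht₁ _ hF₁ hI₁
  have hA₁ : s₁.arr aA = s.arr aA := hF₁.2 aA rfl
  refine Run.block_cons ?_
  refine Run.up_vc 1 m 30 (fun i s' => ∀ j, 1 ≤ j → j ≤ n →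
    (s'.arr aMark j = 1 ↔ ∃ k, 1 ≤ k ∧ k < i ∧ s.arr aA k = j)) (by decide) (by omega) hW1
    (by omega) rfl ⟨by simp; omega, by simp⟩
    (fun s' hF => ⟨by simp, by simp [hF.1 rM rfl, hF₁.1 rM rfl, hM]⟩) ?_ ?_ ?_
  · intro j h1 h2
    rw [State.setReg_arr, hI₁ j, if_pos (by omega)]
    exact iff_of_false (by omega) (by rintro ⟨k, h3, h4, -⟩; omega)
  · intro i s' h1 h2 h3 hF hI
    have hi := hA i h1 h2
    simp only [Cmd.vc, Expr.Safe, Expr.val, Expr.val_ofNat, Expr.safe_ofNat, hF.2 aA rfl, hA₁, h3,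
      State.setReg_arr, State.setArr_arr, if_true]
    refine ⟨⟨trivial, by omega⟩, by omega, by omega, fun j h4 h5 => ?_⟩
    by_cases hj : j = s.arr aA i
    · subst hj
      rw [Function.update_self]
      exact iff_of_true rfl ⟨i, h1, by omega, rfl⟩
    · rw [Function.update_of_ne hj, hI j h4 h5]
      refine exists_congr fun k => and_congr_right fun _ => ⟨fun h => ⟨by omega, h.2⟩, fun h => ⟨?_, h.2⟩⟩
      rcases Nat.lt_succ_iff_lt_or_eq.1 h.1 with hk | rfl
      · exact hk
      · exact absurd h.2.symm hj
  intro s₂ t₂ ht₂ _ hF₂ hI₂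
  refine Run.block_cons (Run.of_vc hW1 ?_)
  simp only [Cmd.vc, Expr.safe_ofNat, Expr.val_ofNat]
  refine ⟨by omega, fun t₃ ht₃ => ?_⟩
  replace ht₃ : t₃ ≤ t₂ + 2 := ht₃
  refine Run.up_vc 1 n 40 (fun i s' => s'.reg rB < i ∧
    (∀ k, 1 ≤ k → k ≤ s'.reg rB → 1 ≤ s'.arr aB k ∧ s'.arr aB k < i) ∧
    (∀ k k', 1 ≤ k → k < k' → k' ≤ s'.reg rB → s'.arr aB k < s'.arr aB k') ∧
    ∀ j, 1 ≤ j → j < i → (s₂.arr aMark j = 1 ↔ ∃ k, 1 ≤ k ∧ k ≤ s'.reg rB ∧ s'.arr aB k = j))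
    (by decide) (by omega) hW1 (by omega) rfl ⟨by simp; omega, by simp⟩
    (fun s' hF => ⟨by simp, by simp [hF.1 rN rfl, hF₂.1 rN rfl, hF₁.1 rN rfl, hN]⟩) ?_ ?_ ?_
  · simp +decide only [State.setReg_reg, reduceIte]
    exact ⟨trivial, fun k h1 h2 => by omega, fun k k' h1 h2 h3 => by omega, fun j h1 h2 => by omega⟩
  · rintro i s' h1 h2 h3 hF ⟨g1, g2, g3, g4⟩
    have hmark : s'.arr aMark = s₂.arr aMark := hF.2 aMark rfl
    simp +decide only [block, when, Cmd.vc, Expr.Safe, Expr.val, BinOp.Ok, BinOp.eval, Expr.add_def,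
      Expr.val_ofNat, Expr.safe_ofNat, State.setReg_reg, State.setReg_arr, State.setArr_reg,
      State.setArr_arr, reduceIte, h3, hmark]
    refine ⟨⟨⟨trivial, by omega⟩, by omega, trivial⟩, fun hc => ?_, fun hc => ?_⟩
    · have hmk : s₂.arr aMark i = 1 := by
        by_contra h
        rw [if_neg h] at hc
        exact hc rfl
      refine ⟨⟨trivial, by omega, by omega⟩, trivial, trivial, by omega, by omega,
        fun k h4 h5 => ?_, fun k k' h4 h5 h6 => ?_, fun j h4 h5 => ?_⟩
      · by_cases hk : k = s'.reg rB + 1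
        · rw [hk, Function.update_self]; omega
        · rw [Function.update_of_ne hk]
          have := g2 k h4 (by omega)
          omega
      · rw [Function.update_of_ne (by omega : k ≠ s'.reg rB + 1)]
        by_cases hk : k' = s'.reg rB + 1
        · rw [hk, Function.update_self]
          exact (g2 k h4 (by omega)).2
        · rw [Function.update_of_ne hk]
          exact g3 k k' h4 h5 (by omega)
      · by_cases hj : j = i
        · subst hj
          exact iff_of_true hmk ⟨s'.reg rB + 1, by omega, le_rfl, Function.update_self _ _ _⟩
        · rw [g4 j h4 (by omega)]
          constructor
          · rintro ⟨k, h6, h7, h8⟩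
            exact ⟨k, h6, by omega, by rwa [Function.update_of_ne (by omega)]⟩
          · rintro ⟨k, h6, h7, h8⟩
            by_cases hk : k = s'.reg rB + 1
            · rw [hk, Function.update_self] at h8
              exact absurd h8.symm hj
            · rw [Function.update_of_ne hk] at h8
              exact ⟨k, h6, by omega, h8⟩
    · have hmk : s₂.arr aMark i ≠ 1 := by
        intro h
        rw [if_pos h] at hc
        exact one_ne_zero hc
      refine ⟨by omega, fun k h4 h5 => ?_, g3, fun j h4 h5 => ?_⟩
      · have := g2 k h4 h5
        omega
      · by_cases hj : j = i
        · subst hj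
          refine iff_of_false hmk ?_
          rintro ⟨k, h6, h7, h8⟩
          have := g2 k h6 h7
          omega
        · exact g4 j h4 (by omega)
  · rintro s₃ t₄ ht₄ - hF₃ ⟨g1, g2, g3, g4⟩
    refine ⟨by omega, by omega, fun k h1 h2 => ?_, g3, fun j h1 h2 => ?_⟩
    · have := g2 k h1 h2
      omega
    · rw [← g4 j h1 (by omega), hI₂ j h1 h2]
      simp only [Nat.lt_succ_iff]

/-! ### The given programs: the lists of nodes -/

/-- `x` is the first node after `k`, among the first `b` ones, that belongs to the list of `c`, or
`0` if there is none. -/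
def IsNext (b : ℕ) (ch : ℕ → ℕ) (c k x : ℕ) : Prop :=
  (x = 0 ∧ ∀ j, k < j → j ≤ b → ch j ≠ c) ∨
  (k < x ∧ x ≤ b ∧ ch x = c ∧ ∀ j, k < j → j < x → ch j ≠ c)

/-- `x` is the last node of the list of `c` among the first `b` nodes, or `0` if there is none. -/
def IsLast (b : ℕ) (ch : ℕ → ℕ) (c x : ℕ) : Prop :=
  (x = 0 ∨ 1 ≤ x ∧ x ≤ b ∧ ch x = c) ∧ ∀ j, x < j → j ≤ b → ch j ≠ c

theorem IsNext.succ {b : ℕ} {ch : ℕ → ℕ} {c k x : ℕ} (h : IsNext b ch c k x)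
    (hx : x ≠ 0 ∨ ch (b + 1) ≠ c) : IsNext (b + 1) ch c k x := by
  rcases h with ⟨h1, h2⟩ | ⟨h1, h2, h3, h4⟩
  · refine Or.inl ⟨h1, fun j h3 h4 => ?_⟩
    rcases Nat.lt_or_eq_of_le h4 with h4 | rfl
    · exact h2 j h3 (by omega)
    · exact hx.resolve_left (by omega)
  · exact Or.inr ⟨h1, by omega, h3, h4⟩

theorem IsLast.isNext {b : ℕ} {ch : ℕ → ℕ} {c x : ℕ} (h : IsLast b ch c x) (hx : x ≤ b)
    (hc : ch (b + 1) = c) : IsNext (b + 1) ch c x (b + 1) :=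
  Or.inr ⟨by omega, le_rfl, hc, fun j h1 h2 => h.2 j h1 (by omega)⟩

/-- The linked lists of the nodes `1, …, b`, where `ch` gives the list and `vl` the value of a
node. -/
structure ListsReady (σ b : ℕ) (ch vl : ℕ → ℕ) (s : State) : Prop where
  val : ∀ k, 1 ≤ k → k ≤ b → s.arr aVal k = vl k
  head : ∀ c, 1 ≤ c → c ≤ σ → IsNext b ch c 0 (s.arr aHead c)
  next : ∀ k, 1 ≤ k → k ≤ b → IsNext b ch (ch k) k (s.arr aNext k)

theorem run_buildLists {B W n σ b : ℕ} {bw sl : ℕ → ℕ} {s : State} {t : ℕ} {R : ℕ → ℕ → Prop}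
    (hBW : B ≤ W) (hB : 20 * n + 16 ≤ B) (hn : 2 ≤ n) (hσ : σ ≤ n) (hb : b ≤ n)
    (hσs : s.reg rSigma = σ) (hbs : s.reg rB = b)
    (hD : ∀ k, 1 ≤ k → k ≤ b → 1 ≤ s.arr aB k ∧ s.arr aB k ≤ n)
    (hbw : ∀ i, 1 ≤ i → i ≤ n → s.arr aBWT i = bw i) (hbwσ : ∀ i, 1 ≤ i → i ≤ n → 1 ≤ bw i ∧ bw i ≤ σ)
    (hsl : ∀ i, 1 ≤ i → i ≤ n → s.arr aSLPR i = sl i) :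
    Run B W buildLists s t (fun s' t' => t' ≤ t + 300 * (n + 1) ∧
      ListsReady σ b (fun k => bw (s.arr aB k)) (fun k => sl (s.arr aB k)) s' ∧
      ∀ c, 1 ≤ c → c ≤ σ → s'.arr aP c = s'.arr aHead c) R := by
  have hW1 : 1 < W := by omega
  refine Run.block_cons ?_
  refine Run.up_vc 1 σ 30 (fun i s' => ∀ c, 1 ≤ c → c < i → s'.arr aHead c = 0 ∧ s'.arr aTail c = 0)
    (by decide) (by omega) hW1 (by omega) rfl ⟨by simp; omega, by simp⟩
    (fun s' hF => ⟨by simp, by simp [hF.1 rSigma rfl, hσs]⟩) (fun k h1 h2 => by omega) ?_ ?_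
  · intro i s' h1 h2 h3 hF hI
    simp +decide only [block, Cmd.vc, Expr.Safe, Expr.val, Expr.val_ofNat, Expr.safe_ofNat,
      State.setArr_reg, State.setArr_arr, State.setReg_arr, h3, reduceIte]
    and_intros <;> try first | trivial | omega
    intro k h4 h5
    by_cases hk : k = i
    · subst hk; simp
    · rw [Function.update_of_ne hk, Function.update_of_ne hk]
      exact hI k h4 (by omega)
  intro s₁ t₁ ht₁ _ hF₁ hI₁
  refine Run.block_cons ?_
  refine Run.up_vc 1 b 60 (fun K s' =>
      ListsReady σ (K - 1) (fun k => bw (s.arr aB k)) (fun k => sl (s.arr aB k)) s' ∧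
      ∀ c, 1 ≤ c → c ≤ σ → IsLast (K - 1) (fun k => bw (s.arr aB k)) c (s'.arr aTail c))
    (by decide) (by omega) hW1 (by omega) rfl ⟨by simp; omega, by simp⟩
    (fun s' hF => ⟨by simp, by simp [hF.1 rB rfl, hF₁.1 rB rfl, hbs]⟩) ?_ ?_ ?_
  · refine ⟨⟨fun k h1 h2 => by omega, fun c h1 h2 => ?_, fun k h1 h2 => by omega⟩, fun c h1 h2 => ?_⟩
    · exact Or.inl ⟨(hI₁ c h1 (by omega)).1, fun j h3 h4 => by omega⟩
    · exact ⟨Or.inl (hI₁ c h1 (by omega)).2, fun j h3 h4 => by omega⟩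
  · rintro K s' h1 h2 h3 hF ⟨hL, hT⟩
    obtain ⟨k, rfl⟩ : ∃ k, K = k + 1 := ⟨K - 1, by omega⟩
    simp only [Nat.add_sub_cancel] at hL hT ⊢
    have hDk := hD (k + 1) h1 h2
    have e1 := hbw _ hDk.1 hDk.2
    have e2 := hsl _ hDk.1 hDk.2
    obtain ⟨c, hc⟩ : ∃ c, c = bw (s.arr aB (k + 1)) := ⟨_, rfl⟩
    have hcσ := hbwσ _ hDk.1 hDk.2
    rw [← hc] at e1 hcσ
    have hTc := hT c hcσ.1 hcσ.2
    -- the new node is appended behind the last one of its list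
    have hother : ∀ (f : ℕ → ℕ), (∀ d, 1 ≤ d → d ≤ σ → IsLast k (fun k => bw (s.arr aB k)) d (f d)) →
        ∀ d, 1 ≤ d → d ≤ σ → IsLast (k + 1) (fun k => bw (s.arr aB k)) d
          (Function.update f c (k + 1) d) := by
      intro f hf d h4 h5
      by_cases hd : d = c
      · subst hd
        rw [Function.update_self]
        exact ⟨Or.inr ⟨by omega, le_rfl, hc.symm⟩, fun j _ _ => by omega⟩
      · rw [Function.update_of_ne hd]
        obtain ⟨g1, g2⟩ := hf d h4 h5
        refine ⟨g1.imp_right fun g => ⟨g.1, by omega, g.2.2⟩, fun j h6 h7 => ?_⟩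
        rcases Nat.lt_or_eq_of_le h7 with h7 | rfl
        · exact g2 j h6 (by omega)
        · exact fun h => hd (h.symm.trans hc.symm)
    have hval : ∀ j, 1 ≤ j → j ≤ k + 1 →
        Function.update (s'.arr aVal) (k + 1) (sl (s.arr aB (k + 1))) j = sl (s.arr aB j) := by
      intro j h4 h5
      by_cases hj : j = k + 1
      · subst hj; exact Function.update_self _ _ _
      · rw [Function.update_of_ne hj]; exact hL.val j h4 (by omega)
    simp +decide only [block, Cmd.vc, Expr.Safe, Expr.val, BinOp.Ok, BinOp.eval, Expr.val_ofNat,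
      Expr.safe_ofNat, State.setReg_reg, State.setReg_arr, State.setArr_reg, State.setArr_arr,
      reduceIte, h3, hF.2 aB rfl, hF₁.2 aB rfl, hF.2 aBWT rfl, hF₁.2 aBWT rfl, hF.2 aSLPR rfl,
      hF₁.2 aSLPR rfl, e1, e2]
    refine ⟨by and_intros <;> first | trivial | omega, trivial,
      by and_intros <;> first | trivial | omega, by omega, trivial, by omega, by omega,
      by and_intros <;> first | trivial | omega, fun h0 => ?_, fun h0 => ?_⟩
    · have htail : s'.arr aTail c = 0 := by
        by_contra h
        rw [if_neg h] at h0
        exact h0 rfl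
      rw [htail] at hTc
      refine ⟨trivial, trivial, by omega, ⟨trivial, trivial, by omega, ⟨hval, fun d h4 h5 => ?_,
        fun j h4 h5 => ?_⟩, hother _ hT⟩⟩
      · simp +decide only [State.setReg_arr, State.setArr_arr, reduceIte]
        by_cases hd : d = c
        · subst hd
          rw [Function.update_self]
          exact hTc.isNext (Nat.zero_le _) hc.symm
        · rw [Function.update_of_ne hd]
          exact (hL.head d h4 h5).succ (Or.inr fun h => hd (h.symm.trans hc.symm))
      · simp +decide only [State.setReg_arr, State.setArr_arr, reduceIte]
        by_cases hj : j = k + 1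
        · subst hj
          rw [Function.update_self]
          exact Or.inl ⟨rfl, fun i _ _ => by omega⟩
        · rw [Function.update_of_ne hj]
          refine (hL.next j h4 (by omega)).succ (Or.inr fun h => ?_)
          exact hTc.2 j (by omega) (by omega) (h.symm.trans hc.symm)
    · have htail : s'.arr aTail c ≠ 0 := by
        intro h
        rw [if_pos h] at h0
        exact one_ne_zero h0
      obtain ⟨x, hx⟩ : ∃ x, x = s'.arr aTail c := ⟨_, rfl⟩
      rw [← hx] at htail hTc ⊢
      obtain ⟨g1, g2⟩ := hTc
      replace g1 := g1.resolve_left htail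
      refine ⟨⟨trivial, by omega⟩, trivial, by omega, trivial, trivial, by omega, ⟨hval,
        fun d h4 h5 => ?_, fun j h4 h5 => ?_⟩, hother _ hT⟩
      · simp +decide only [State.setReg_arr, State.setArr_arr, reduceIte]
        refine (hL.head d h4 h5).succ ?_
        by_cases hd : d = c
        · subst hd
          refine Or.inl fun h => ?_
          rcases hL.head d h4 h5 with ⟨-, hno⟩ | ⟨hpos, -⟩
          · exact hno x (by omega) g1.2.1 g1.2.2
          · omega
        · exact Or.inr fun h => hd (h.symm.trans hc.symm)
      · simp +decide only [State.setReg_arr, State.setArr_arr, reduceIte]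
        by_cases hj : j = k + 1
        · subst hj
          rw [Function.update_of_ne (by omega), Function.update_self]
          exact Or.inl ⟨rfl, fun i _ _ => by omega⟩
        · by_cases hjx : j = x
          · subst hjx
            rw [Function.update_self]
            have : bw (s.arr aB j) = c := g1.2.2
            rw [this]
            exact IsLast.isNext (b := k) ⟨Or.inr g1, g2⟩ g1.2.1 hc.symm
          · rw [Function.update_of_ne hjx, Function.update_of_ne hj]
            refine (hL.next j h4 (by omega)).succ ?_
            by_cases hjc : bw (s.arr aB (k + 1)) = bw (s.arr aB j)
            · refine Or.inl fun h => ?_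
              have hjx' : j < x := by
                by_contra hlt
                exact g2 j (by omega) (by omega) (hjc.symm.trans hc.symm)
              rcases hL.next j h4 (by omega) with ⟨-, hno⟩ | ⟨hpos, -⟩
              · exact hno x hjx' g1.2.1 (g1.2.2.trans (hc.trans hjc))
              · omega
            · exact Or.inr hjc
  · rintro s₂ t₂ ht₂ - hF₂ ⟨hL, -⟩
    rw [Nat.add_sub_cancel] at hL
    refine Run.up_map 1 σ 30 aP 0 (s₂.arr aHead) (by decide) (by omega) hW1
      (by omega) rfl ⟨by simp; omega, by simp⟩
      (fun s' hF => ⟨by simp, by simp [hF.1 rSigma rfl, hF₂.1 rSigma rfl, hF₁.1 rSigma rfl, hσs]⟩) ?_ ?_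
    · intro i s' h1 h2 h3 hF hI
      simp [h3, hF.2 aHead rfl]
      omega
    · intro s₃ t₃ ht₃ _ hF₃ hI₃
      refine ⟨by omega, ⟨fun k h1 h2 => ?_, fun c h1 h2 => ?_, fun k h1 h2 => ?_⟩, fun c h1 h2 => ?_⟩
      · rw [hF₃.2 aVal rfl]; exact hL.val k h1 h2
      · rw [hF₃.2 aHead rfl]; exact hL.head c h1 h2
      · rw [hF₃.2 aNext rfl]; exact hL.next k h1 h2
      · rw [hI₃ c, if_pos (by omega), hF₃.2 aHead rfl, Nat.sub_zero]

/-! ### The given programs: the scan of the breaks -/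

theorem Run.ite {B W : ℕ} (hW : 1 < W) {e : Expr} {c₁ c₂ : Cmd} {s : State} {t : ℕ}
    {Q : State → ℕ → Prop} {R : ℕ → ℕ → Prop} (he : e.Safe B W s)
    (h₁ : e.val s ≠ 0 → Run B W c₁ s (t + (e.cost + 1)) Q R)
    (h₂ : e.val s = 0 → Run B W c₂ s (t + (e.cost + 1)) Q R) :
    Run B W (.ite e c₁ c₂) s t Q R := by
  have he' := Expr.eval_of_safe hW he
  by_cases h0 : e.val s = 0
  · rw [h0] at he'
    rcases h₂ h0 with ⟨s', t', hx, h⟩ | ⟨x, t', hx, h⟩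
    · exact Or.inl ⟨s', _, .ite_false he' hx, by rwa [← Nat.add_assoc]⟩
    · exact Or.inr ⟨x, _, .ite_false he' hx, by rwa [← Nat.add_assoc]⟩
  · rcases h₁ h0 with ⟨s', t', hx, h⟩ | ⟨x, t', hx, h⟩
    · exact Or.inl ⟨s', _, .ite_true he' h0 hx, by rwa [← Nat.add_assoc]⟩
    · exact Or.inr ⟨x, _, .ite_true he' h0 hx, by rwa [← Nat.add_assoc]⟩

theorem Run.when {B W : ℕ} (hW : 1 < W) {e : Expr} {c : Cmd} {s : State} {t : ℕ}
    {Q : State → ℕ → Prop} {R : ℕ → ℕ → Prop} (he : e.Safe B W s)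
    (h₁ : e.val s ≠ 0 → Run B W c s (t + (e.cost + 1)) Q R)
    (h₂ : e.val s = 0 → Q s (t + (e.cost + 2))) :
    Run B W (SuffTest.when e c) s t Q R :=
  Run.ite hW he h₁ fun h0 => Or.inl ⟨s, 1, .skip s, h₂ h0⟩

/-- The value `x` lies strictly between the previous and the next smaller value of `i`. -/
def Hit (n : ℕ) (lc : ℕ → ℕ) (x i : ℕ) : Prop := PSV lc i < x ∧ x < NSV n lc i

/-- If `i'` is hit from the left of the previous smaller value of `i < i'`, then every hit of `i` is
one of `i'`, since the intervals are nested. -/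
theorem Hit.of_nested {n : ℕ} {lc : ℕ → ℕ} {x y i i' : ℕ} (h1 : 1 ≤ i) (h2 : i < i')
    (h3 : i' ≤ n) (hx : Hit n lc x i') (hxi : x ≤ PSV lc i) (hy : Hit n lc y i) : Hit n lc y i' := by
  obtain ⟨hx1, hx2⟩ := hx
  obtain ⟨hy1, hy2⟩ := hy
  have hP := PSV_lt lc h1
  refine ⟨by omega, lt_of_lt_of_le hy2 ?_⟩
  by_contra hc
  have e1 := PSV_le_of_lt lc (i := i') (j := PSV lc i) (by omega) (by omega)
  have e2 := PSV_val lc (i := i) (by omega)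
  have e3 := NSV_gt (n := n) lc h3
  have e4 := NSV_le_succ n lc i
  rcases NSV_mem n lc i' with h | ⟨-, -, h⟩
  · omega
  · have := le_of_lt_NSV (n := n) (A := lc) (i := i) (j := NSV n lc i') (by omega) (by omega)
    omega

section scan
variable (σ n b : ℕ) (bw lc ch vl : ℕ → ℕ)

/-- The list of the character `c` has a node that hits `i`. -/
def Served (i c : ℕ) : Prop := ∃ j, 1 ≤ j ∧ j ≤ b ∧ ch j = c ∧ Hit n lc (vl j) i

/-- The pointers `P[c]` have not passed a node that is needed for a break from `i` on. -/
def PointersOk (head P : ℕ → ℕ) (i : ℕ) : Prop :=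
  ∀ c, 1 ≤ c → c ≤ σ → head c ≠ 0 → (1 ≤ P c ∧ P c ≤ b ∧ ch (P c) = c) ∧
    ∀ i', i ≤ i' → IsBreak n bw i' → Served n b lc ch vl i' c →
      ∃ j, P c ≤ j ∧ j ≤ b ∧ ch j = c ∧ Hit n lc (vl j) i'

/-- The data that the scan reads but does not change. -/
structure ScanEnv (s : State) : Prop where
  bwt : ∀ i, 1 ≤ i → i ≤ n → s.arr aBWT i = bw i
  psv : ∀ i, 1 ≤ i → i ≤ n → s.arr aPSV i = PSV lc i
  nsv : ∀ i, 1 ≤ i → i ≤ n → s.arr aNSV i = NSV n lc i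
  lists : ListsReady σ b ch vl s

/-- The number of nodes in front of the pointers. -/
def nodesLeft (P : ℕ → ℕ) : ℕ := ((Finset.Icc 1 b).filter fun k => P (ch k) < k).card

variable {σ n b bw lc ch vl}

theorem nodesLeft_le (P : ℕ → ℕ) : nodesLeft b ch P ≤ b :=
  (Finset.card_filter_le _ _).trans (by simp)

theorem nodesLeft_update {P : ℕ → ℕ} {c q : ℕ} (h1 : P c < q) (h2 : q ≤ b) (hq : ch q = c) :
    nodesLeft b ch (Function.update P c q) + 1 ≤ nodesLeft b ch P := by
  refine Finset.card_lt_card (Finset.ssubset_iff_of_subset (fun k hk => ?_) |>.2 ⟨q, ?_, ?_⟩)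
  · simp only [Finset.mem_filter] at hk ⊢
    refine ⟨hk.1, ?_⟩
    by_cases hc : ch k = c
    · have := hk.2
      rw [hc, Function.update_self] at this
      rw [hc]; omega
    · rw [Function.update_of_ne hc] at hk
      exact hk.2
  · simp only [Finset.mem_filter, Finset.mem_Icc, hq]
    omega
  · simp [hq]

theorem PointersOk.mono {head P : ℕ → ℕ} {i i' : ℕ} (h : PointersOk σ n b bw lc ch vl head P i)
    (hi : i ≤ i') : PointersOk σ n b bw lc ch vl head P i' :=
  fun c h1 h2 h3 => ⟨(h c h1 h2 h3).1, fun j hj => (h c h1 h2 h3).2 j (hi.trans hj)⟩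

theorem PointersOk.update {head P : ℕ → ℕ} {i c q : ℕ}
    (h : PointersOk σ n b bw lc ch vl head P i) (hi : 1 ≤ i) (hq1 : 1 ≤ q) (hq2 : q ≤ b)
    (hqc : ch q = c) (hskip : ∀ j, P c ≤ j → j < q → ch j = c → vl j ≤ PSV lc i)
    (hit : Hit n lc (vl q) i) :
    PointersOk σ n b bw lc ch vl head (Function.update P c q) i := by
  intro d h1 h2 h3
  obtain ⟨g1, g2⟩ := h d h1 h2 h3
  by_cases hd : d = c
  · subst hd
    rw [Function.update_self]
    refine ⟨⟨hq1, hq2, hqc⟩, fun i' hi' hb hs => ?_⟩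
    obtain ⟨j, f1, f2, f3, f4⟩ := g2 i' hi' hb hs
    by_cases hjq : q ≤ j
    · exact ⟨j, hjq, f2, f3, f4⟩
    · have hle := hskip j f1 (by omega) f3
      refine ⟨q, le_rfl, hq2, hqc, ?_⟩
      rcases Nat.lt_or_eq_of_le hi' with hi' | rfl
      · exact f4.of_nested hi hi' hb.2.1 hle hit
      · exact hit
  · rw [Function.update_of_ne hd]
    exact ⟨g1, g2⟩

theorem ScanEnv.congr {s s' : State} (h : ScanEnv σ n b bw lc ch vl s)
    (hs : ∀ a ∈ [aBWT, aPSV, aNSV, aVal, aHead, aNext], s'.arr a = s.arr a) :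
    ScanEnv σ n b bw lc ch vl s' := by
  refine ⟨?_, ?_, ?_, ⟨?_, ?_, ?_⟩⟩
  · rw [hs aBWT (by decide)]; exact h.bwt
  · rw [hs aPSV (by decide)]; exact h.psv
  · rw [hs aNSV (by decide)]; exact h.nsv
  · rw [hs aVal (by decide)]; exact h.lists.val
  · rw [hs aHead (by decide)]; exact h.lists.head
  · rw [hs aNext (by decide)]; exact h.lists.next

/-- The part of the scan that handles one of the two characters at a break. -/
def serve : Cmd := block [
  .set rC (get aBWT (v rJ)),
  when (eq (get aHead (v rC)) 0) (.ret 0),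
  .loop (le (get aVal (get aP (v rC))) (get aPSV (v rI))) (block [
    when (eq (get aNext (get aP (v rC))) 0) (.ret 0),
    .put aP (v rC) (get aNext (get aP (v rC)))]),
  when (le (get aNSV (v rI)) (get aVal (get aP (v rC)))) (.ret 0)]

theorem run_serve {B W i k : ℕ} {s : State} {t : ℕ}
    (hBW : B ≤ W) (hB : 20 * n + 16 ≤ B) (hb : b ≤ n) (hσ : σ ≤ n)
    (hbwσ : ∀ i, 1 ≤ i → i ≤ n → 1 ≤ bw i ∧ bw i ≤ σ)
    (hmono : ∀ j j', 1 ≤ j → j ≤ j' → j' ≤ b → vl j ≤ vl j')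
    (hE : ScanEnv σ n b bw lc ch vl s) (hI : s.reg rI = i) (hJ : s.reg rJ = k)
    (hk : k = i - 1 ∨ k = i) (hi : IsBreak n bw i)
    (hP : PointersOk σ n b bw lc ch vl (s.arr aHead) (s.arr aP) i) :
    Run B W serve s t (fun s' t' => PointersOk σ n b bw lc ch vl (s.arr aHead) (s'.arr aP) i ∧
        Served n b lc ch vl i (bw k) ∧
        t' + 60 * nodesLeft b ch (s'.arr aP) ≤ t + 100 + 60 * nodesLeft b ch (s.arr aP))
      (fun x t' => x = 0 ∧ ¬ Served n b lc ch vl i (bw k) ∧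
        t' ≤ t + 100 + 60 * nodesLeft b ch (s.arr aP)) := by
  have hW1 : 1 < W := by omega
  obtain ⟨hi1, hi2, hi3⟩ := id hi
  obtain ⟨c, hc⟩ : ∃ c, c = bw k := ⟨_, rfl⟩
  have hkn : 1 ≤ k ∧ k ≤ n := by omega
  have hbk := hE.bwt k hkn.1 hkn.2
  have hcσ := hbwσ k hkn.1 hkn.2
  rw [← hc] at hbk hcσ ⊢
  have hpsv := hE.psv i (by omega) hi2
  have hnsv := hE.nsv i (by omega) hi2
  have hhead := hE.lists.head c hcσ.1 hcσ.2
  obtain ⟨s₁, hs₁⟩ : ∃ s₁, s₁ = s.setReg rC c := ⟨_, rfl⟩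
  have hC₁ : s₁.reg rC = c := by rw [hs₁, State.setReg_reg, if_pos rfl]
  have hI₁ : s₁.reg rI = i := by rw [hs₁, State.setReg_reg, if_neg (by decide), hI]
  have harr : s₁.arr = s.arr := by rw [hs₁]; rfl
  refine Run.block_cons (Run.of_vc hW1 ?_)
  simp only [Cmd.vc, Expr.Safe, Expr.val, hJ, hbk, ← hs₁]
  refine ⟨⟨trivial, by omega⟩, fun t₁ ht₁ => ?_⟩
  replace ht₁ : t₁ ≤ t + 3 := ht₁
  refine Run.block_cons (Run.when hW1 ?_ (fun h0 => ?_) (fun h0 => ?_))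
  · simp only [Expr.Safe, Expr.val, BinOp.Ok, Expr.safe_ofNat, hC₁]
    and_intros <;> first | trivial | omega
  · -- the list is empty
    have hh : s.arr aHead c = 0 := by
      change (if s₁.arr aHead (s₁.reg rC) = 0 then 1 else 0 : ℕ) ≠ 0 at h0
      rw [hC₁, harr] at h0
      by_contra h
      rw [if_neg h] at h0
      exact h0 rfl
    refine Run.of_vc hW1 ⟨show 0 < W by omega, fun t₂ ht₂ => ⟨rfl, ?_, ?_⟩⟩
    · rintro ⟨j, f1, f2, f3, -⟩
      rcases hhead with ⟨-, h⟩ | ⟨h, -⟩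
      · exact h j f1 f2 f3
      · omega
    · replace ht₂ : t₂ ≤ t₁ + 5 + 2 := ht₂
      omega
  have hh : s.arr aHead c ≠ 0 := by
    change (if s₁.arr aHead (s₁.reg rC) = 0 then 1 else 0 : ℕ) = 0 at h0
    rw [hC₁, harr] at h0
    intro h
    rw [if_pos h] at h0
    exact one_ne_zero h0
  obtain ⟨⟨hp1, hp2, hp3⟩, hp4⟩ := hP c hcσ.1 hcσ.2 hh
  have hp4 := hp4 i le_rfl hi
  obtain ⟨t₂, ht₂⟩ : ∃ t₂, t₂ = t₁ + (Expr.cost (eq (get aHead (v rC)) 0) + 2) := ⟨_, rfl⟩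
  rw [← ht₂]
  replace ht₂ : t₂ = t₁ + 6 := ht₂
  refine Run.block_cons ?_
  -- the pointer `q` has passed only nodes to the left of the interval, each paid for by `nodesLeft`
  refine Run.loop hW1 (fun s' t' => ∃ q, s'.reg rC = c ∧ s'.reg rI = i ∧
    (∀ a, a ≠ aP → s'.arr a = s.arr a) ∧ s.arr aP c ≤ q ∧ q ≤ b ∧ ch q = c ∧
    (∀ j, s.arr aP c ≤ j → j < q → ch j = c → vl j ≤ PSV lc i) ∧
    s'.arr aP = Function.update (s.arr aP) c q ∧
    t' + 60 * nodesLeft b ch (s'.arr aP) ≤ t₂ + 60 * nodesLeft b ch (s.arr aP))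
    (t₂ + 60 * nodesLeft b ch (s.arr aP)) ?_ ?_ ?_ ?_ ?_
  · refine ⟨_, hC₁, hI₁, fun a _ => by rw [harr], le_rfl, hp2, hp3, fun j h1 h2 => by omega, ?_, ?_⟩
    · rw [harr, Function.update_eq_self]
    · rw [harr]
  · rintro s' t' ⟨q, -, -, -, -, -, -, -, -, h⟩
    omega
  · rintro s' t' ⟨q, r1, r2, r3, g1, g2, g3, g4, g5, g6⟩
    simp only [Expr.Safe, Expr.val, BinOp.Ok, r1, r2, g5, Function.update_self]
    and_intros <;> first | trivial | omega
  · rintro s' t' ⟨q, r1, r2, r3, g1, g2, g3, g4, g5, g6⟩ - hval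
    have hgt : PSV lc i < vl q := by
      change (if s'.arr aVal (s'.arr aP (s'.reg rC)) ≤ s'.arr aPSV (s'.reg rI) then 1 else 0 : ℕ) = 0
        at hval
      rw [r1, r2, g5, Function.update_self, r3 aVal (by decide), r3 aPSV (by decide), hpsv,
        hE.lists.val q (by omega) g2] at hval
      by_contra h
      rw [if_pos (not_lt.1 h)] at hval
      exact one_ne_zero hval
    replace g6 : t' + (Expr.cost (le (get aVal (get aP (v rC))) (get aPSV (v rI))) + 1) +
        60 * nodesLeft b ch (s'.arr aP) ≤ t₂ + 7 + 60 * nodesLeft b ch (s.arr aP) := by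
      have : Expr.cost (le (get aVal (get aP (v rC))) (get aPSV (v rI))) = 6 := rfl
      omega
    generalize t' + (Expr.cost (le (get aVal (get aP (v rC))) (get aPSV (v rI))) + 1) = t₃ at g6
    have hcond : (le (get aNSV (v rI)) (get aVal (get aP (v rC)))).val s' =
        if NSV n lc i ≤ vl q then 1 else 0 := by
      change (if s'.arr aNSV (s'.reg rI) ≤ s'.arr aVal (s'.arr aP (s'.reg rC)) then 1 else 0 : ℕ) = _
      rw [r1, r2, g5, Function.update_self, r3 aVal (by decide), r3 aNSV (by decide), hnsv,
        hE.lists.val q (by omega) g2]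
    refine Run.when hW1 ?_ (fun h0 => ?_) (fun h0 => ?_)
    · simp only [Expr.Safe, Expr.val, BinOp.Ok, r1, r2, g5, Function.update_self]
      and_intros <;> first | trivial | omega
    · -- all the nodes from the pointer on are too far to the right
      refine Run.of_vc hW1 ⟨show 0 < W by omega, fun t₄ ht₄ => ⟨rfl, fun hs => ?_, ?_⟩⟩
      · rw [hcond] at h0
        obtain ⟨j, f1, f2, f3, f4⟩ := hp4 hs
        by_cases hjq : j < q
        · have := g4 j f1 hjq f3
          have := f4.1
          omega
        · have := hmono q j (by omega) (by omega) f2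
          have := f4.2
          rw [if_neg (by omega)] at h0
          exact h0 rfl
      · replace ht₄ : t₄ ≤ t₃ + 7 + 2 := ht₄
        omega
    · rw [hcond] at h0
      have hit : Hit n lc (vl q) i := by
        refine ⟨hgt, ?_⟩
        by_contra h
        rw [if_pos (not_lt.1 h)] at h0
        exact one_ne_zero h0
      refine ⟨?_, ⟨q, by omega, g2, g3, hit⟩, ?_⟩
      · rw [g5]
        exact hP.update (by omega) (by omega) g2 g3 g4 hit
      · have : Expr.cost (le (get aNSV (v rI)) (get aVal (get aP (v rC)))) = 6 := rfl
        omega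
  · rintro s' t' ⟨q, r1, r2, r3, g1, g2, g3, g4, g5, g6⟩ - hval
    have hle : vl q ≤ PSV lc i := by
      change (if s'.arr aVal (s'.arr aP (s'.reg rC)) ≤ s'.arr aPSV (s'.reg rI) then 1 else 0 : ℕ) ≠ 0
        at hval
      rw [r1, r2, g5, Function.update_self, r3 aVal (by decide), r3 aPSV (by decide), hpsv,
        hE.lists.val q (by omega) g2] at hval
      by_contra h
      rw [if_neg h] at hval
      exact hval rfl
    have hskip : ∀ j, s.arr aP c ≤ j → j ≤ q → ch j = c → vl j ≤ PSV lc i := by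
      intro j h1 h2 h3
      rcases Nat.lt_or_eq_of_le h2 with h2 | rfl
      exacts [g4 j h1 h2 h3, hle]
    have hnext := hE.lists.next q (by omega) g2
    rw [g3] at hnext
    replace g6 : t' + (Expr.cost (le (get aVal (get aP (v rC))) (get aPSV (v rI))) + 1) +
        60 * nodesLeft b ch (s'.arr aP) ≤ t₂ + 7 + 60 * nodesLeft b ch (s.arr aP) := by
      have : Expr.cost (le (get aVal (get aP (v rC))) (get aPSV (v rI))) = 6 := rfl
      omega
    generalize t' + (Expr.cost (le (get aVal (get aP (v rC))) (get aPSV (v rI))) + 1) = t₃ at g6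
    have hcond : (eq (get aNext (get aP (v rC))) 0).val s' =
        if s.arr aNext q = 0 then 1 else 0 := by
      change (if s'.arr aNext (s'.arr aP (s'.reg rC)) = 0 then 1 else 0 : ℕ) = _
      rw [r1, g5, Function.update_self, r3 aNext (by decide)]
    refine Run.block_cons (Run.when hW1 ?_ (fun h0 => ?_) (fun h0 => ?_))
    · simp only [Expr.Safe, Expr.val, BinOp.Ok, Expr.safe_ofNat, r1, g5, Function.update_self]
      and_intros <;> first | trivial | omega
    · -- all the nodes of the list are too far to the left
      refine Run.of_vc hW1 ⟨show 0 < W by omega, fun t₄ ht₄ => ⟨rfl, fun hs => ?_, ?_⟩⟩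
      · rw [hcond] at h0
        have hz : s.arr aNext q = 0 := by
          by_contra h
          rw [if_neg h] at h0
          exact h0 rfl
        obtain ⟨j, f1, f2, f3, f4⟩ := hp4 hs
        have hjq : j ≤ q := by
          by_contra h
          rcases hnext with ⟨-, h'⟩ | ⟨h', -⟩
          · exact h' j (not_le.1 h) f2 f3
          · omega
        have := hskip j f1 hjq f3
        have := f4.1
        omega
      · replace ht₄ : t₄ ≤ t₃ + 6 + 2 := ht₄
        omega
    · rw [hcond] at h0
      have hz : s.arr aNext q ≠ 0 := by
        intro h
        rw [if_pos h] at h0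
        exact one_ne_zero h0
      obtain ⟨q', hq'⟩ : ∃ q', q' = s.arr aNext q := ⟨_, rfl⟩
      rw [← hq'] at hz hnext
      obtain ⟨k1, k2, k3, k4⟩ := hnext.resolve_left fun h => hz h.1
      have hupd : Function.update (Function.update (s.arr aP) c q) c q' =
          Function.update (s.arr aP) c q' := Function.update_idem _ _ _
      refine Run.of_vc hW1 ?_
      simp +decide only [block, Cmd.vc, Expr.Safe, Expr.val, State.setArr_reg, State.setArr_arr,
        reduceIte, r1, r2, g5, Function.update_self, r3 aNext (by decide), ← hq', hupd]
      refine ⟨trivial, ⟨⟨trivial, by omega⟩, by omega⟩, by omega, fun t₄ ht₄ => ?_⟩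
      have hleft := nodesLeft_update (b := b) (ch := ch) (P := s'.arr aP) (c := c) (q := q')
        (by rw [g5, Function.update_self]; exact k1) k2 k3
      rw [g5, hupd] at hleft
      rw [g5] at g6
      refine ⟨q', trivial, trivial, fun a ha => ?_, by omega, k2, k3, fun j h1 h2 h3 => ?_, rfl, ?_⟩
      · rw [if_neg ha]; exact r3 a ha
      · refine hskip j h1 ?_ h3
        by_contra h
        exact k4 j (not_le.1 h) h2 h3
      · replace ht₄ : t₄ ≤ t₃ + 7 + 5 := ht₄
        omega

end scan

theorem run_scan {B W σ n b : ℕ} {bw lc ch vl : ℕ → ℕ} {s : State} {t : ℕ}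
    (hBW : B ≤ W) (hB : 20 * n + 16 ≤ B) (hn : 2 ≤ n) (hb : b ≤ n) (hσ : σ ≤ n) (hN : s.reg rN = n)
    (hbwσ : ∀ i, 1 ≤ i → i ≤ n → 1 ≤ bw i ∧ bw i ≤ σ)
    (hmono : ∀ j j', 1 ≤ j → j ≤ j' → j' ≤ b → vl j ≤ vl j')
    (hE : ScanEnv σ n b bw lc ch vl s)
    (hP : ∀ c, 1 ≤ c → c ≤ σ → s.arr aP c = s.arr aHead c) :
    Run B W scan s t (fun _ _ => False) (fun x t' => ∃ r : Bool, x = r.toNat ∧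
      t' ≤ t + 1000 * (n + 1) ∧ (r = true ↔ ∀ i, IsBreak n bw i → ∀ k, k = i - 1 ∨ k = i →
        Served n b lc ch vl i (bw k))) := by
  have hW1 : 1 < W := by omega
  -- every step of a pointer lowers `nodesLeft`, so that the whole scan takes at most `b` of them
  have hpot := nodesLeft_le (b := b) (ch := ch) (s.arr aP)
  -- at the beginning, each pointer is at the head of its list
  have hP0 : PointersOk σ n b bw lc ch vl (s.arr aHead) (s.arr aP) 2 := by
    intro c h1 h2 h3
    rw [hP c h1 h2]
    obtain ⟨k1, k2, k3, k4⟩ := (hE.lists.head c h1 h2).resolve_left fun h => h3 h.1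
    refine ⟨⟨k1, k2, k3⟩, fun i _ _ ⟨j, f1, f2, f3, f4⟩ => ⟨j, ?_, f2, f3, f4⟩⟩
    by_contra h
    exact k4 j f1 (not_le.1 h) f3
  refine Run.block_cons ?_
  refine Run.up 2 n (fun i s' t' => PointersOk σ n b bw lc ch vl (s.arr aHead) (s'.arr aP) i ∧
    (∀ i', i' < i → IsBreak n bw i' → ∀ k, k = i' - 1 ∨ k = i' → Served n b lc ch vl i' (bw k)) ∧
    t' + 60 * nodesLeft b ch (s'.arr aP) ≤ t + 2 + 60 * nodesLeft b ch (s.arr aP) + 400 * (i - 2))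
    (by omega) hW1 (by omega) rfl ⟨by simp; omega, by simp⟩
    (fun s' hF => ⟨by simp, by simp [hF.1 rN rfl, hN]⟩) ?_ ?_ ?_
  · refine ⟨hP0, fun i' h1 h2 => ?_, ?_⟩
    · have := h2.1
      omega
    · change t + 1 + 1 + _ ≤ _
      simp
  · rintro i s₁ t₁ h1 h2 h3 hF₁ ⟨g1, g2, g3⟩
    have hE₁ := hE.congr (s' := s₁) (fun a ha => hF₁.2 a (by fin_cases ha <;> rfl))
    have hh₁ : s₁.arr aHead = s.arr aHead := hF₁.2 aHead rfl
    have e1 := hE₁.bwt (i - 1) (by omega) (by omega)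
    have e2 := hE₁.bwt i (by omega) h2
    have hcond : (ne (get aBWT (v rI - 1)) (get aBWT (v rI))).val s₁ =
        if bw (i - 1) = bw i then 0 else 1 := by
      change (if s₁.arr aBWT (s₁.reg rI - 1) = s₁.arr aBWT (s₁.reg rI) then 0 else 1 : ℕ) = _
      rw [h3, e1, e2]
    refine Run.when hW1 ?_ (fun h0 => ?_) (fun h0 => ?_)
    · simp only [Expr.Safe, Expr.val, BinOp.Ok, BinOp.eval, Expr.sub_def, Expr.val_ofNat,
        Expr.safe_ofNat, h3]
      and_intros <;> first | trivial | omega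
    · have hi : IsBreak n bw i := by
        refine ⟨h1, h2, fun h => ?_⟩
        rw [hcond, if_pos h] at h0
        exact h0 rfl
      obtain ⟨t₂, ht₂⟩ : ∃ t₂, t₂ = t₁ + (v rN).cost + 3 +
        ((ne (get aBWT (v rI - 1)) (get aBWT (v rI))).cost + 1) := ⟨_, rfl⟩
      rw [← ht₂]
      replace ht₂ : t₂ = t₁ + 1 + 3 + 8 := ht₂
      refine Run.up (i - 1) i (fun k s' t' =>
        PointersOk σ n b bw lc ch vl (s.arr aHead) (s'.arr aP) i ∧
        (∀ k', i - 1 ≤ k' → k' < k → Served n b lc ch vl i (bw k')) ∧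
        t' + 60 * nodesLeft b ch (s'.arr aP) ≤
          t₂ + 4 + 60 * nodesLeft b ch (s₁.arr aP) + 120 * (k - (i - 1)))
        (by omega) hW1 (by omega) rfl ⟨?_, by simp [h3]⟩
        (fun s' hF => ⟨by simp, by simp [hF.1 rI rfl, h3]⟩) ?_ ?_ ?_
      · simp [h3]; omega
      · refine ⟨g1, fun k' h4 h5 => by omega, ?_⟩
        change t₂ + 3 + 1 + 60 * nodesLeft b ch (s₁.arr aP) ≤ _
        omega
      · rintro k s₂ t₃ h4 h5 h6 hF₂ ⟨f1, f2, f3⟩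
        have hh₂ : s₂.arr aHead = s.arr aHead := (hF₂.2 aHead rfl).trans hh₁
        refine (run_serve hBW hB hb hσ hbwσ hmono
          (hE₁.congr (fun a ha => hF₂.2 a (by fin_cases ha <;> rfl)))
          ((hF₂.1 rI rfl).trans h3) h6 (by omega) hi (by rw [hh₂]; exact f1)).mono ?_ ?_
        · rintro s₄ t₄ ⟨d1, d2, d3⟩
          rw [hh₂] at d1
          refine ⟨d1, fun k' h7 h8 => ?_, ?_⟩
          · rcases Nat.lt_succ_iff_lt_or_eq.1 h8 with h8 | rfl
            exacts [f2 k' h7 h8, d2]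
          · replace d3 : t₄ + 60 * nodesLeft b ch (s₄.arr aP) ≤
              t₃ + 1 + 3 + 100 + 60 * nodesLeft b ch (s₂.arr aP) := d3
            rw [State.setReg_arr]
            omega
        · rintro x t₄ ⟨rfl, d2, d3⟩
          replace d3 : t₄ ≤ t₃ + 1 + 3 + 100 + 60 * nodesLeft b ch (s₂.arr aP) := d3
          refine ⟨false, rfl, by omega, ?_⟩
          simp only [Bool.false_eq_true, false_iff]
          exact fun h => d2 (h i hi k (by omega))
      · rintro s₂ t₃ - hF₂ ⟨f1, f2, f3⟩
        refine ⟨f1.mono (by omega), fun i' h4 h5 k hk => ?_, ?_⟩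
        · rcases Nat.lt_succ_iff_lt_or_eq.1 h4 with h4 | rfl
          · exact g2 i' h4 h5 k hk
          · exact f2 k (by omega) (by omega)
        · change t₃ + 1 + 3 + 4 + 60 * nodesLeft b ch (s₂.arr aP) ≤ _
          omega
    · refine ⟨g1.mono (by omega), fun i' h4 h5 => ?_, ?_⟩
      · rcases Nat.lt_succ_iff_lt_or_eq.1 h4 with h4 | rfl
        · exact g2 i' h4 h5
        · rw [hcond, if_neg h5.2.2] at h0
          exact absurd h0 one_ne_zero
      · change t₁ + 1 + 3 + 9 + 4 + 60 * nodesLeft b ch (s₁.arr aP) ≤ _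
        omega
  · rintro s₁ t₁ - hF₁ ⟨-, g2, g3⟩
    refine Run.of_vc hW1 ⟨show 1 < W by omega, fun t₂ ht₂ => ⟨true, rfl, ?_, ?_⟩⟩
    · replace ht₂ : t₂ ≤ t₁ + 1 + 3 + 2 := ht₂
      omega
    · simp only [true_iff]
      intro i hi
      exact g2 i (by have := hi.2.1; omega) hi

/-! ### The whole algorithm -/

theorem initState_aS {σ : ℕ} {T L : List ℕ} {k : ℕ} (h1 : 1 ≤ k) (h2 : k ≤ L.length) :
    (initState σ T L).arr aS k ∈ L := by
  simp only [initState, if_neg (by omega : k ≠ 0), if_neg (by decide : ¬ (aS = aT)), if_true]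
  rw [List.getD_eq_getElem _ _ (by omega)]
  exact List.getElem_mem _

theorem exists_initState_aS {σ : ℕ} {T L : List ℕ} {x : ℕ} (hx : x ∈ L) :
    ∃ k, 1 ≤ k ∧ k ≤ L.length ∧ (initState σ T L).arr aS k = x := by
  obtain ⟨k, hk, rfl⟩ := List.getElem_of_mem hx
  refine ⟨k + 1, by omega, by omega, ?_⟩
  simp only [initState, if_neg (by omega : k + 1 ≠ 0), if_neg (by decide : ¬ (aS = aT)), if_true]
  rw [Nat.add_sub_cancel, List.getD_eq_getElem _ _ hk]

theorem run_testSuffixient {B W σ : ℕ} {T L : List ℕ} (hT : IsText σ T)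
    (hL : ∀ x ∈ L, 1 ≤ x ∧ x ≤ T.length) (hLn : L.length ≤ T.length)
    (hBW : B ≤ W) (hB : 20 * T.length + 16 ≤ B) :
    Run B W (testSuffixient computeArrays) (initState σ T L) 0 (fun _ _ => False)
      (fun x t => ∃ r : Bool, x = r.toNat ∧ t ≤ 510000 * (T.length + 1) ∧
        (r = true ↔ Suffixient T {x | x ∈ L})) := by
  have hW1 : 1 < W := by omega
  have hn := hT.two_le
  have hX := hT.isRevTxt
  have hσ : ∀ i, 1 ≤ i → i ≤ T.length → 1 ≤ BWT T.reverse i ∧ BWT T.reverse i ≤ σ := by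
    intro i h1 h2
    have hlt : ∀ q, q < T.length → 1 ≤ txt T.reverse q ∧ txt T.reverse q ≤ σ := fun q hq => by
      rw [← hT.alphabet, txt, List.getD_eq_getElem _ _ (by simpa using hq), ← List.mem_reverse]
      exact List.getElem_mem _
    have hrow := row_lt (X := T.reverse) h1 (by simpa using h2)
    rw [List.length_reverse] at hrow
    rw [BWT_eq h1 (by simpa using h2), List.length_reverse]
    split_ifs
    exacts [hlt _ (by omega), hlt _ (by omega)]
  have hσn : σ ≤ T.length := by
    have hsub : Finset.Icc 1 σ ⊆ T.toFinset := fun c hc => by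
      rw [List.mem_toFinset, hT.alphabet]; simpa using hc
    calc σ = (Finset.Icc 1 σ).card := by simp
      _ ≤ T.toFinset.card := Finset.card_le_card hsub
      _ ≤ T.length := List.toFinset_card_le _
  have hlen : T.reverse.length = T.length := List.length_reverse
  refine Run.block_cons ?_
  refine (run_computeArrays hT hBW hB).post ?_
  rintro s₁ t₁ ⟨ht₁, hreg, harr, hready⟩
  have hN₁ : s₁.reg rN = T.length := by rw [hreg rN (by decide)]; rfl
  have hσ₁ : s₁.reg rSigma = σ := by rw [hreg rSigma (by decide)]; rfl
  have hM₁ : s₁.reg rM = L.length := by rw [hreg rM (by decide)]; rfl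
  have hS₁ : s₁.arr aS = (initState σ T L).arr aS := harr aS (by decide)
  simp only [Finset.mem_Icc] at hready
  generalize hn' : T.length = n at *
  -- `SLPR`
  refine Run.block_cons ?_
  refine (run_computeSLPR (bw := BWT T.reverse) (lc := LCP T.reverse) hBW hB hn hN₁
    (fun i h1 h2 => (hready i ⟨h1, h2⟩).1) (fun i h1 h2 => (hready i ⟨h1, h2⟩).2.1)
    (by rw [LCP, if_neg (by omega)])).frame.post ?_
  rintro s₂ t₂ ⟨⟨ht₂, sb, sa, hsl⟩, hF₂⟩
  -- the rows of the elements of `S`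
  refine Run.block_cons ?_
  refine (run_computeA (ps := bwtPos T.reverse) hBW hB hn hLn ((hF₂.1 rN rfl).trans hN₁)
    ((hF₂.1 rM rfl).trans hM₁) (fun k h1 h2 => ?_) (fun x h1 h2 => ?_)).frame.post ?_
  · rw [hF₂.2 aS rfl, hS₁]
    exact hL _ (initState_aS h1 h2)
  · have := Nat.mod_lt (n + 1 - x) (by omega : n > 0)
    rw [hF₂.2 aISA rfl, (hready _ ⟨by omega, by omega⟩).2.2.1, bwtPos, hlen]
  rintro s₃ t₃ ⟨⟨ht₃, hA⟩, hF₃⟩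
  rw [hF₂.2 aS rfl, hS₁] at hA
  have hpos := fun x => bwtPos_mem hX.two_le x
  rw [hlen] at hpos
  refine Run.block_cons ?_
  refine (run_sortA hBW hB hn hLn (by rw [hF₃.1 rN rfl, hF₂.1 rN rfl, hN₁])
    (by rw [hF₃.1 rM rfl, hF₂.1 rM rfl, hM₁]) (fun k h1 h2 => by rw [hA k h1 h2]; exact hpos _)).frame.post ?_
  rintro s₄ t₄ ⟨⟨ht₄, hD⟩, hF₄⟩
  -- the lists
  refine Run.block_cons ?_
  refine (run_buildLists (bw := BWT T.reverse) (sl := s₂.arr aSLPR) hBW hB hn hσn hD.le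
    (by rw [hF₄.1 rSigma rfl, hF₃.1 rSigma rfl, hF₂.1 rSigma rfl, hσ₁]) rfl hD.mem
    (fun i h1 h2 => by
      rw [hF₄.2 aBWT rfl, hF₃.2 aBWT rfl, hF₂.2 aBWT rfl, (hready i ⟨h1, h2⟩).1])
    hσ (fun i h1 h2 => by rw [hF₄.2 aSLPR rfl, hF₃.2 aSLPR rfl])).frame.post ?_
  rintro s₅ t₅ ⟨⟨ht₅, hlists, hP⟩, hF₅⟩
  -- the scan
  refine (run_scan (lc := LCP T.reverse) hBW hB hn hD.le hσn
    (by rw [hF₅.1 rN rfl, hF₄.1 rN rfl, hF₃.1 rN rfl, hF₂.1 rN rfl, hN₁]) hσ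
    (fun j j' h1 h2 h3 => ?_) ⟨fun i h1 h2 => ?_, fun i h1 h2 => ?_, fun i h1 h2 => ?_, hlists⟩
    hP).mono (fun _ _ h => h) ?_
  · have h4 := hD.mem j h1 (by omega)
    have h5 := hD.mem j' (by omega) h3
    refine hsl.sl_mono h4.1 ?_ h5.2
    rcases Nat.lt_or_eq_of_le h2 with h2 | rfl
    exacts [(hD.lt j j' h1 h2 h3).le, le_rfl]
  · rw [hF₅.2 aBWT rfl, hF₄.2 aBWT rfl, hF₃.2 aBWT rfl, hF₂.2 aBWT rfl, (hready i ⟨h1, h2⟩).1]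
  · rw [hF₅.2 aPSV rfl, hF₄.2 aPSV rfl, hF₃.2 aPSV rfl, hF₂.2 aPSV rfl,
      (hready i ⟨h1, h2⟩).2.2.2.1]
  · rw [hF₅.2 aNSV rfl, hF₄.2 aNSV rfl, hF₃.2 aNSV rfl, hF₂.2 aNSV rfl,
      (hready i ⟨h1, h2⟩).2.2.2.2]
  rintro x t₆ ⟨r, rfl, ht₆, hr⟩
  refine ⟨r, rfl, by linarith, ?_⟩
  rw [hr, suffixient_iff hX (by simpa [hn'] using hL)]
  refine forall_congr' fun i => ?_
  rw [hn']
  refine forall_congr' fun hi => forall_congr' fun k => forall_congr' fun hk => ?_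
  constructor
  · rintro ⟨j, h1, h2, h3, h4⟩
    have hDj := hD.mem j h1 h2
    obtain ⟨k', h5, h6, h7⟩ := (hD.iff _ hDj.1 hDj.2).2 ⟨j, h1, h2, rfl⟩
    rw [hA k' h5 h6] at h7
    refine ⟨_, initState_aS (σ := σ) (T := T) h5 h6, by rw [h7]; exact h3, ?_⟩
    rw [h7]
    exact (hsl.mem_box_iff hi hDj.1 hDj.2).2 h4
  · rintro ⟨x, hx, h3, h4⟩
    obtain ⟨k', h5, h6, h7⟩ := exists_initState_aS (σ := σ) (T := T) hx
    have hp := hpos x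
    obtain ⟨j, h1, h2, h8⟩ := (hD.iff _ hp.1 hp.2).1 ⟨k', h5, h6, by rw [hA k' h5 h6, h7]⟩
    refine ⟨j, h1, h2, by simp only [h8]; exact h3, ?_⟩
    have := (hsl.mem_box_iff hi hp.1 hp.2).1 h4
    simp only [h8]
    exact this

end SuffTest

theorem mainTheorem1 :
    ∃ (computeArrays : SuffTest.Cmd) (K : ℕ),
      ∀ (σ : ℕ) (T : List ℕ), SuffTest.IsText σ T →
      ∀ S : Finset ℕ, S ⊆ Finset.Icc 1 T.length →
      ∀ L : List ℕ, L.Nodup → L.toFinset = S →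
      ∃ B : ℕ, (SuffTest.testSuffixient computeArrays).words B ≤ K * T.length ∧
        (∃ (s : SuffTest.State) (t : ℕ),
          SuffTest.Exec B (T.length ^ K) computeArrays (SuffTest.initState σ T L) (.next s) t ∧
          t ≤ K * T.length ∧ SuffTest.ArraysReady σ T L s) ∧
        ∃ (b : Bool) (t : ℕ),
          SuffTest.Exec B (T.length ^ K) (SuffTest.testSuffixient computeArrays)
            (SuffTest.initState σ T L) (.ret b.toNat) t ∧
          t ≤ K * T.length ∧ (b = true ↔ SuffTest.Suffixient T (S : Set ℕ)) := by
  obtain ⟨K, hK⟩ : ∃ K, K = (SuffTest.testSuffixient SuffTest.computeArrays).regs.card +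
    (SuffTest.testSuffixient SuffTest.computeArrays).arrs.card * 28 + 1020000 := ⟨_, rfl⟩
  refine ⟨SuffTest.computeArrays, K, fun σ T hT S hS L hL hLS => ⟨20 * T.length + 16, ?_, ?_, ?_⟩⟩
  all_goals
    have hn := hT.two_le
    have hmem : ∀ x ∈ L, 1 ≤ x ∧ x ≤ T.length := fun x hx => by
      have := hS (hLS ▸ List.mem_toFinset.2 hx)
      simpa using this
    have hLn : L.length ≤ T.length := by
      rw [← List.toFinset_card_of_nodup hL, hLS]
      simpa using Finset.card_le_card hS
    -- the length of the arrays is at most `n ^ 6`, as `n ≥ 2`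
    have hBW : 20 * T.length + 16 ≤ T.length ^ K := by
      have h5 : 2 ^ 5 ≤ T.length ^ 5 := Nat.pow_le_pow_left hn 5
      have h6 : T.length ^ 6 ≤ T.length ^ K := Nat.pow_le_pow_right (by omega) (by omega)
      have h7 : T.length ^ 6 = T.length ^ 5 * T.length := pow_succ _ _
      have h8 := Nat.mul_le_mul_right T.length h5
      omega
  · rw [SuffTest.Cmd.words]
    generalize (SuffTest.testSuffixient SuffTest.computeArrays).regs.card = p at hK ⊢
    generalize (SuffTest.testSuffixient SuffTest.computeArrays).arrs.card = q at hK ⊢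
    have h1 : q * (20 * T.length + 16) ≤ q * (28 * T.length) := Nat.mul_le_mul_left q (by omega)
    have h2 : p * 1 ≤ p * T.length := Nat.mul_le_mul_left p (by omega)
    rw [hK, Nat.add_mul, Nat.add_mul, Nat.mul_assoc q]
    omega
  · rcases SuffTest.run_computeArrays (S := L) (R := fun _ _ => False) hT hBW le_rfl with
      ⟨s, t, h, ht, hs⟩ | ⟨_, _, _, h⟩
    · refine ⟨s, t, h, ?_, hs⟩
      have h1 : 1020000 * T.length ≤ K * T.length := Nat.mul_le_mul_right _ (by omega)
      omega
    · exact h.elim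
  · rcases SuffTest.run_testSuffixient hT hmem hLn hBW le_rfl with
      ⟨_, _, _, h⟩ | ⟨_, t, h, b, rfl, ht, hb⟩
    · exact h.elim
    · refine ⟨b, t, h, ?_, ?_⟩
      · have h1 : 1020000 * T.length ≤ K * T.length := Nat.mul_le_mul_right _ (by omega)
        omega
      · rw [hb, ← hLS]
        simp only [List.coe_toFinset]
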